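/- Let $X$ be a connected (Hausdorff, second countable, finite-dimensional) $C^\infty$ manifold and $x\in X$. Let $\mathcal N$ be the category of finite-dimensional nilpotent real Lie algebras $\mathfrak g$ equipped with an action of $\pi_1(X,x)$ by Lie algebra automorphisms which is semisimple as a linear representation (equivalently, with an algebraic action of $\varpi_1^{\mathrm{red}}(X,x)$, the reductive quotient of the real pro-algebraic completion of $\pi_1(X,x)$); morphisms are the equivariant Lie algebra homomorphisms. For $\mathfrak g\in\mathcal N$ let $\underline{\mathfrak g}$ be the associated local system of Lie algebras on $X$, let $A^i(\mathfrak g)=\Gamma(X,\underline{\mathfrak g}\otimes\mathscr A^i)$, where $\mathscr A^i$ is the sheaf of real $C^\infty$ $i$-forms, and let $\exp(\underline{\mathfrak g})$ be the sheaf of groups with underlying sheaf $\underline{\mathfrak g}$ and the Campbell–Baker–Hausdorff product; $\exp(A^0(\mathfrak g))$ and $\exp(\underline{\mathfrak g}\otimes\mathscr A^0)$ are defined in the same way. The deformation groupoid $\mathfrak{Def}_A(\mathfrak g)$ has as objects the Maurer–Cartan elements $\omega\in A^1(\mathfrak g)$, $d\omega+\tfrac12[\omega,\omega]=0$, and as morphisms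 $\omega\to\omega'$ the $h\in\exp(A^0(\mathfrak g))$ with $h*\omega=\omega'$, where $*$ is the gauge action: $\exp(a)*\omega=\exp(\mathrm{ad}_a)(\omega+d)-d$, computed in $A^1(\mathfrak g)\oplus\mathbb R d$ with $[d,a]=da$ and $[d,d]=0$. An $\exp(\underline{\mathfrak g})$-torsor is a sheaf of sets $\mathbb B$ on $X$ with a multiplication $\exp(\underline{\mathfrak g})\times\mathbb B\to\mathbb B$ such that $g\cdot(h\cdot b)=(gh)\cdot b$ and such that each stalk $\mathbb B_y$ is isomorphic to $\exp(\underline{\mathfrak g})_y$ as a set with an action of $\exp(\underline{\mathfrak g})_y$; a morphism of torsors is an equivariant morphism of sheaves. For a Maurer–Cartan element $\omega$ let $\mathbb B_\omega$ be the sheaf of sections $\alpha$ of $\exp(\underline{\mathfrak g}\otimes\mathscr A^0)$ with $\alpha^{-1}d\alpha=\omega$, on which $\exp(\underline{\mathfrak g})$ acts by left multiplication. Then: 1. $\mathfrak{Def}_A(\mathfrak g)$ is a groupoid (the Campbell–Baker–Hausdorff product is a group law and $*$ is an action of $\exp(A^0(\mathfrak g))$ on the set of Maurer–Cartan elements), and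 each $\mathbb B_\omega$ is an $\exp(\underline{\mathfrak g})$-torsor. 2. For $h:\omega\to\omega'$ in $\mathfrak{Def}_A(\mathfrak g)$, the rule $\alpha\mapsto\alpha h^{-1}$ defines a morphism of torsors $\mathbb B_\omega\to\mathbb B_{\omega'}$, and the resulting functor $\mathbb B$ from $\mathfrak{Def}_A(\mathfrak g)$ to the category of $\exp(\underline{\mathfrak g})$-torsors is an equivalence. 3. This is functorial in $\mathfrak g$: for each $\theta:\mathfrak g\to\mathfrak h$ in $\mathcal N$, the maps $\alpha\mapsto\theta(\alpha)$ are $\exp(\theta)$-equivariant morphisms $\mathbb B_\omega\to\mathbb B_{\theta(\omega)}$, natural in $\omega\in\mathfrak{Def}_A(\mathfrak g)$ and compatible with identities and composition of morphisms $\theta$, and they exhibit $\mathbb B_{\theta(\omega)}$ as the torsor obtained from $\mathbb B_\omega$ by change of structure group along $\exp(\theta)$: every $\exp(\theta)$-equivariant morphism from $\mathbb B_\omega$ to an $\exp(\underline{\mathfrak h})$-torsor factors uniquely through a morphism of $\exp(\underline{\mathfrak h})$-torsors from $\mathbb B_{\theta(\omega)}$. -/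

import Mathlib

open CategoryTheory TopologicalSpace Opposite
open scoped Manifold ContDiff Nat Topology

universe u

namespace FlatTorsor

noncomputable section

/-! ### The group `exp(L)` of a nilpotent Lie algebra -/

section BCH

variable {L : Type*} [LieRing L] [LieAlgebra ℝ L]

/-- The right-nested bracket `[a₁, [a₂, [..., [aₘ₋₁, aₘ]]]]`. -/
def nestedBracket : List L → L
  | [] => 0
  | [a] => a
  | a :: b :: l => ⁅a, nestedBracket (b :: l)⁆

/-- The word `x^{r₁} y^{s₁} ⋯ x^{rₖ} y^{sₖ}`. -/
def dynkinWord (x y : L) (l : List (ℕ × ℕ)) : List L :=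
  l.flatMap fun rs => List.replicate rs.1 x ++ List.replicate rs.2 y

/-- The coefficient `(-1)^(k-1) / (k * ∑ (rᵢ + sᵢ) * ∏ rᵢ! sᵢ!)`. -/
def dynkinCoeff (l : List (ℕ × ℕ)) : ℝ :=
  (-1) ^ (l.length - 1) /
    (l.length * (l.map fun rs => rs.1 + rs.2).sum * (l.map fun rs => rs.1 ! * rs.2 !).prod : ℕ)

/-- The index set of the series: nonempty lists of pairs `(rᵢ, sᵢ) ≠ (0, 0)`. -/
def dynkinIndex : Set (List (ℕ × ℕ)) := {l | l ≠ [] ∧ ∀ rs ∈ l, rs ≠ (0, 0)}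

/-- The Campbell-Baker-Hausdorff product `x + y + ½[x, y] + ⋯`, by Dynkin's formula. For nilpotent
`L` only finitely many terms are nonzero. -/
def bch (x y : L) : L :=
  ∑ᶠ l ∈ dynkinIndex, dynkinCoeff l • nestedBracket (dynkinWord x y l)

lemma nestedBracket_mem (l : List L) (m : ℕ) (h : m + 1 ≤ l.length) :
    nestedBracket l ∈ LieModule.lowerCentralSeries ℝ L L m := by
  induction l generalizing m with
  | nil => simp at h
  | cons a l ih =>
    cases l with
    | nil =>
      have : m = 0 := by simpa using h
      subst this
      simp
    | cons b l =>
      cases m with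
      | zero => simp
      | succ m =>
        rw [nestedBracket, LieModule.lowerCentralSeries_succ]
        exact LieSubmodule.lie_mem_lie (LieSubmodule.mem_top a) (ih m (by simpa using h))

lemma length_dynkinWord {L : Type*} (x y : L) (l : List (ℕ × ℕ)) :
    (dynkinWord x y l).length = (l.map fun rs => rs.1 + rs.2).sum := by
  simp [dynkinWord, List.length_flatMap]

variable (L) in
/-- A finite set of words outside of which all terms of the series vanish. -/
lemma exists_finset_bch [LieRing.IsNilpotent L] : ∃ s : Finset (List (ℕ × ℕ)),
    (↑s ⊆ dynkinIndex) ∧ ∀ x y : L, ∀ l ∈ dynkinIndex, l ∉ s →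
      nestedBracket (dynkinWord x y l) = 0 := by
  obtain ⟨N, hN⟩ := LieModule.IsNilpotent.nilpotent ℝ L L
  let f : (Fin (N + 1) × Fin (N + 1)) → ℕ × ℕ := fun q => (q.1, q.2)
  have hfin : {l : List (ℕ × ℕ) | l ∈ dynkinIndex ∧
      (l.map fun rs => rs.1 + rs.2).sum ≤ N}.Finite := by
    refine Set.Finite.subset
      ((List.finite_length_le (Fin (N + 1) × Fin (N + 1)) N).image (List.map f)) ?_
    rintro l ⟨⟨-, h1⟩, h2⟩
    have hb : ∀ rs ∈ l, rs.1 + rs.2 ≤ N := fun rs hrs =>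
      (List.le_sum_of_mem (List.mem_map.2 ⟨rs, hrs, rfl⟩)).trans h2
    have hlen : l.length ≤ N := by
      refine le_trans ?_ h2
      have := List.length_le_sum_of_one_le (l.map fun rs : ℕ × ℕ => rs.1 + rs.2) (by
        intro i hi
        obtain ⟨rs, hrs, rfl⟩ := List.mem_map.1 hi
        have := h1 rs hrs
        rcases rs with ⟨a, b⟩
        simp only [ne_eq, Prod.mk.injEq, not_and] at this
        simp only
        omega)
      simpa using this
    refine ⟨l.map fun rs => (⟨min rs.1 N, by omega⟩, ⟨min rs.2 N, by omega⟩), ?_, ?_⟩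
    · simpa using hlen
    · rw [List.map_map]
      conv_rhs => rw [← List.map_id l]
      refine List.map_congr_left fun rs hrs => ?_
      have := hb rs hrs
      simp only [f, Function.comp, id]
      ext <;> simp <;> omega
  refine ⟨hfin.toFinset, fun l hl => ?_, fun x y l hl hls => ?_⟩
  · exact (hfin.mem_toFinset.1 hl).1
  · have h : N + 1 ≤ (dynkinWord x y l).length := by
      rw [length_dynkinWord]
      by_contra hc
      exact hls (hfin.mem_toFinset.2 ⟨hl, by omega⟩)
    have := nestedBracket_mem _ N h
    rwa [hN, LieSubmodule.mem_bot] at this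

lemma bch_eq_sum {s : Finset (List (ℕ × ℕ))} (hs : ↑s ⊆ dynkinIndex) (x y : L)
    (h : ∀ l ∈ dynkinIndex, l ∉ s → nestedBracket (dynkinWord x y l) = 0) :
    bch x y = ∑ l ∈ s, dynkinCoeff l • nestedBracket (dynkinWord x y l) := by
  refine finsum_mem_eq_sum_of_inter_support_eq _ ?_
  ext l
  simp only [Set.mem_inter_iff, Function.mem_support, Finset.mem_coe]
  refine ⟨fun ⟨h1, h2⟩ => ⟨?_, h2⟩, fun ⟨h1, h2⟩ => ⟨hs h1, h2⟩⟩
  by_contra hl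
  exact h2 (by rw [h l h1 hl, smul_zero])

section Map

variable {L' : Type*} [LieRing L'] [LieAlgebra ℝ L']

lemma map_nestedBracket (f : L →ₗ⁅ℝ⁆ L') (l : List L) :
    f (nestedBracket l) = nestedBracket (l.map f) := by
  induction l with
  | nil => simp [nestedBracket]
  | cons a l ih =>
    cases l with
    | nil => simp [nestedBracket]
    | cons b l => simpa [nestedBracket] using congrArg (fun z => ⁅f a, z⁆) ih

lemma map_dynkinWord (f : L →ₗ⁅ℝ⁆ L') (x y : L) (l : List (ℕ × ℕ)) :
    (dynkinWord x y l).map f = dynkinWord (f x) (f y) l := by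
  simp [dynkinWord, List.map_flatMap]

lemma map_bch [LieRing.IsNilpotent L] (f : L →ₗ⁅ℝ⁆ L') (x y : L) :
    f (bch x y) = bch (f x) (f y) := by
  obtain ⟨s, hs, h⟩ := exists_finset_bch L
  rw [bch_eq_sum hs x y (h x y), bch_eq_sum hs (f x) (f y) ?_]
  · simp [map_nestedBracket, map_dynkinWord]
  · intro l hl hls
    rw [← map_dynkinWord, ← map_nestedBracket, h x y l hl hls, map_zero]

lemma bch_zero_zero [LieRing.IsNilpotent L] : bch (0 : L) 0 = 0 := by
  simpa using (map_bch (0 : L →ₗ⁅ℝ⁆ L) 0 0).symm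

end Map
end BCH

/-! ### Nilpotent Lie algebras with a semisimple action of the fundamental group -/

/-- A finite-dimensional nilpotent real Lie algebra with a semisimple action of `π₁(X, x)` by
Lie algebra automorphisms. -/
structure NilpRep {X : Type u} [TopologicalSpace X] (x : X) where
  carrier : Type u
  [lieRing : LieRing carrier]
  [lieAlgebra : LieAlgebra ℝ carrier]
  [finite : FiniteDimensional ℝ carrier]
  [nilpotent : LieRing.IsNilpotent carrier]
  rep : Representation ℝ (FundamentalGroup X x) carrier
  rep_lie : ∀ γ a b, rep γ ⁅a, b⁆ = ⁅rep γ a, rep γ b⁆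
  semisimple : rep.IsSemisimpleRepresentation

namespace NilpRep

variable {X : Type u} [TopologicalSpace X] {x : X}

instance : CoeSort (NilpRep x) (Type u) := ⟨carrier⟩

attribute [instance] lieRing lieAlgebra finite nilpotent

/-- An auxiliary norm (all norms on `𝔤` are equivalent), used to speak of derivatives. -/
instance instNorm (𝔤 : NilpRep x) : NormedAddCommGroup 𝔤 :=
  NormedAddCommGroup.induced 𝔤 (Fin (Module.finrank ℝ 𝔤) → ℝ) (Module.finBasis ℝ 𝔤).equivFun
    (Module.finBasis ℝ 𝔤).equivFun.injective

instance instNormedSpace (𝔤 : NilpRep x) : NormedSpace ℝ 𝔤 :=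
  NormedSpace.induced ℝ 𝔤 (Fin (Module.finrank ℝ 𝔤) → ℝ) (Module.finBasis ℝ 𝔤).equivFun

/-- The adjoint action `b ↦ [a, b]`, as a continuous linear map. -/
def ad (𝔤 : NilpRep x) (a : 𝔤) : 𝔤 →L[ℝ] 𝔤 :=
  LinearMap.toContinuousLinearMap (LieAlgebra.ad ℝ 𝔤 a : 𝔤 →ₗ[ℝ] 𝔤)

lemma ad_apply (𝔤 : NilpRep x) (a b : 𝔤) : 𝔤.ad a b = ⁅a, b⁆ := rfl

/-- `γ` acts as an endomorphism of the Lie algebra. -/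
def repLie (𝔤 : NilpRep x) (γ : FundamentalGroup X x) : 𝔤 →ₗ⁅ℝ⁆ 𝔤 :=
  { 𝔤.rep γ with map_lie' := fun {a b} => 𝔤.rep_lie γ a b }

lemma rep_bch (𝔤 : NilpRep x) (γ : FundamentalGroup X x) (a b : 𝔤) :
    𝔤.rep γ (bch a b) = bch (𝔤.rep γ a) (𝔤.rep γ b) :=
  map_bch (𝔤.repLie γ) a b

/-- A morphism: an equivariant homomorphism of Lie algebras. -/
@[ext]
structure Hom (𝔤 𝔥 : NilpRep x) where
  toLie : 𝔤 →ₗ⁅ℝ⁆ 𝔥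
  comm : ∀ γ a, toLie (𝔤.rep γ a) = 𝔥.rep γ (toLie a)

instance : Category (NilpRep x) where
  Hom := Hom
  id _ := ⟨LieHom.id, fun _ _ => rfl⟩
  comp θ θ' := ⟨θ'.toLie.comp θ.toLie, fun γ a => by simp [θ.comm, θ'.comm]⟩

/-- A morphism as a continuous linear map. -/
def Hom.toCLM {𝔤 𝔥 : NilpRep x} (θ : Hom 𝔤 𝔥) : 𝔤 →L[ℝ] 𝔥 :=
  LinearMap.toContinuousLinearMap (θ.toLie : 𝔤 →ₗ[ℝ] 𝔥)

lemma Hom.toCLM_apply {𝔤 𝔥 : NilpRep x} (θ : Hom 𝔤 𝔥) (a : 𝔤) : θ.toCLM a = θ.toLie a := rfl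

lemma contDiff_lie (𝔤 : NilpRep x) : ContDiff ℝ ∞ fun q : 𝔤 × 𝔤 => ⁅q.1, q.2⁆ :=
  ((LieModule.toEnd ℝ 𝔤 𝔤 : 𝔤 →ₗ[ℝ] (𝔤 →ₗ[ℝ] 𝔤)).toContinuousBilinearMap).isBoundedBilinearMap.contDiff

lemma contDiff_nestedBracket (𝔤 : NilpRep x) {F : Type*} [NormedAddCommGroup F] [NormedSpace ℝ F]
    (l : List (F → 𝔤)) (hl : ∀ f ∈ l, ContDiff ℝ ∞ f) :
    ContDiff ℝ ∞ fun z => nestedBracket (l.map fun f => f z) := by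
  induction l with
  | nil => exact contDiff_const
  | cons a l ih =>
    cases l with
    | nil => exact hl a (by simp)
    | cons b l =>
      exact 𝔤.contDiff_lie.comp
        ((hl a (by simp)).prodMk (ih fun f hf => hl f (List.mem_cons_of_mem _ hf)))

/-- The Campbell-Baker-Hausdorff product is a polynomial map. -/
lemma contDiff_bch (𝔤 : NilpRep x) : ContDiff ℝ ∞ fun q : 𝔤 × 𝔤 => bch q.1 q.2 := by
  obtain ⟨s, hs, h⟩ := exists_finset_bch 𝔤
  have : (fun q : 𝔤 × 𝔤 => bch q.1 q.2) = fun q =>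
      ∑ l ∈ s, dynkinCoeff l • nestedBracket (dynkinWord q.1 q.2 l) :=
    funext fun q => bch_eq_sum hs q.1 q.2 (h q.1 q.2)
  rw [this]
  refine ContDiff.sum fun l _ => contDiff_const.smul ?_
  have := 𝔤.contDiff_nestedBracket
    (dynkinWord (Prod.fst : 𝔤 × 𝔤 → 𝔤) Prod.snd l) (by
      intro f hf
      simp only [dynkinWord, List.mem_flatMap, List.mem_append, List.mem_replicate] at hf
      obtain ⟨rs, -, ⟨-, rfl⟩ | ⟨-, rfl⟩⟩ := hf
      · exact contDiff_fst
      · exact contDiff_snd)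
  simpa [dynkinWord, List.map_flatMap] using this

end NilpRep

/-! ### Functions and forms with values in a local system

The universal cover of `X` at `x` is the set of pairs `(y, p)`, `p` a homotopy class of paths from
`x` to `y`. For a representation `V` of `π₁(X, x)`, sections over `U` of the local system `𝕍`, and
of `𝕍` tensored with `k`-forms, are the equivariant locally constant functions, resp. `k`-forms,
with values in `V` on the preimage of `U` in the universal cover. -/

section Manifold

variable (n : ℕ) {X : Type u} [TopologicalSpace X] [ChartedSpace (EuclideanSpace ℝ (Fin n)) X]
  {x : X}

/-- Functions with values in `T` on the preimage of `U` in the universal cover. -/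
abbrev Raw (x : X) (U : Opens X) (T : Type*) :=
  ∀ y : U, (FundamentalGroupoid.mk x ⟶ FundamentalGroupoid.mk y.1) → T

/-- Restriction to a smaller open set. -/
def Raw.res {U V : Opens X} {T : Type*} (h : V ≤ U) (s : Raw x U T) : Raw x V T :=
  fun y p => s ⟨y.1, h y.2⟩ p

/-- The preferred chart at `y`. -/
abbrev chart (y : X) : OpenPartialHomeomorph X (EuclideanSpace ℝ (Fin n)) :=
  chartAt (EuclideanSpace ℝ (Fin n)) y

/-- The path from `y` to the point with coordinate `u` which is a straight segment in the chart
at `y`. -/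
def chartPath (y : X) (u : EuclideanSpace ℝ (Fin n))
    (h : segment ℝ (chart n y y) u ⊆ (chart n y).target) : Path y ((chart n y).symm u) where
  toFun t := (chart n y).symm (AffineMap.lineMap (chart n y y) u (t : ℝ))
  continuous_toFun := (chart n y).continuousOn_symm.comp_continuous
    (AffineMap.lineMap_continuous.comp continuous_subtype_val) fun t => h (by
      rw [segment_eq_image_lineMap]
      exact ⟨t, t.2, rfl⟩)
  source' := by simp [(chart n y).left_inv (mem_chart_source _ y)]
  target' := by simp

open Classical in
/-- The branch of `s` at the point `(y, p)` of the universal cover, read in the chart at `y`: a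
function near `chart n y y`, with the value `0` far away. -/
def branch {U : Opens X} {T : Type*} [Zero T] (s : Raw x U T) (y : U)
    (p : FundamentalGroupoid.mk x ⟶ FundamentalGroupoid.mk y.1) :
    EuclideanSpace ℝ (Fin n) → T := fun u =>
  if h : segment ℝ (chart n y.1 y.1) u ⊆ (chart n y.1).target ∧ (chart n y.1).symm u ∈ U then
    s ⟨(chart n y.1).symm u, h.2⟩ (p ≫ FundamentalGroupoid.fromPath ⟦chartPath n y.1 u h.1⟧)
  else 0

/-- The differential at `u` of the inverse of the chart at `y`. The tangent space of `X` at each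
point is `EuclideanSpace ℝ (Fin n)`, through the preferred chart there. -/
def chartDeriv (y : X) (u : EuclideanSpace ℝ (Fin n)) :
    EuclideanSpace ℝ (Fin n) →L[ℝ] EuclideanSpace ℝ (Fin n) :=
  mfderiv 𝓘(ℝ, EuclideanSpace ℝ (Fin n)) 𝓘(ℝ, EuclideanSpace ℝ (Fin n)) (chart n y).symm u

/-- The branch of a `V`-valued 1-form at `(y, p)`, read in the chart at `y`. -/
def branchForm {U : Opens X} {V : Type*} [NormedAddCommGroup V] [NormedSpace ℝ V]
    (s : Raw x U (EuclideanSpace ℝ (Fin n) →L[ℝ] V)) (y : U)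
    (p : FundamentalGroupoid.mk x ⟶ FundamentalGroupoid.mk y.1) :
    EuclideanSpace ℝ (Fin n) → EuclideanSpace ℝ (Fin n) →L[ℝ] V := fun u =>
  (branch n s y p u).comp (chartDeriv n y.1 u)

lemma branch_res {U V : Opens X} (h : V ≤ U) {T : Type*} [Zero T] (s : Raw x U T) (y : V)
    (p : FundamentalGroupoid.mk x ⟶ FundamentalGroupoid.mk y.1) :
    branch n (s.res h) y p =ᶠ[𝓝 (chart n y.1 y.1)] branch n s ⟨y.1, h y.2⟩ p := by
  have hc : ContinuousAt (chart n y.1).symm (chart n y.1 y.1) :=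
    (chart n y.1).continuousAt_symm ((chart n y.1).map_source (mem_chart_source _ _))
  have hm : (V : Set X) ∈ 𝓝 ((chart n y.1).symm (chart n y.1 y.1)) := by
    rw [(chart n y.1).left_inv (mem_chart_source _ _)]
    exact V.isOpen.mem_nhds y.2
  filter_upwards [hc hm] with u hu
  by_cases h1 : segment ℝ (chart n y.1 y.1) u ⊆ (chart n y.1).target
  · rw [branch, branch, dif_pos ⟨h1, hu⟩, dif_pos ⟨h1, h hu⟩]
    rfl
  · rw [branch, branch, dif_neg (fun h => h1 h.1), dif_neg (fun h => h1 h.1)]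

lemma branchForm_res {U V : Opens X} (h : V ≤ U) {W : Type*} [NormedAddCommGroup W]
    [NormedSpace ℝ W] (s : Raw x U (EuclideanSpace ℝ (Fin n) →L[ℝ] W)) (y : V)
    (p : FundamentalGroupoid.mk x ⟶ FundamentalGroupoid.mk y.1) :
    branchForm n (s.res h) y p =ᶠ[𝓝 (chart n y.1 y.1)] branchForm n s ⟨y.1, h y.2⟩ p := by
  filter_upwards [branch_res n h s y p] with u hu
  rw [branchForm, branchForm, hu]

/-- Branches commute with pointwise operations preserving zero. -/
lemma branch_map {U : Opens X} {T T' : Type*} [Zero T] [Zero T'] (f : T → T') (hf : f 0 = 0)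
    (s : Raw x U T) (y : U) (p : FundamentalGroupoid.mk x ⟶ FundamentalGroupoid.mk y.1)
    (u : EuclideanSpace ℝ (Fin n)) :
    branch n (fun y p => f (s y p)) y p u = f (branch n s y p u) := by
  rw [branch, branch]
  split_ifs with h
  · rfl
  · exact hf.symm

lemma branch_map₂ {U : Opens X} {T T' T'' : Type*} [Zero T] [Zero T'] [Zero T'']
    (f : T → T' → T'') (hf : f 0 0 = 0) (s : Raw x U T) (s' : Raw x U T') (y : U)
    (p : FundamentalGroupoid.mk x ⟶ FundamentalGroupoid.mk y.1) (u : EuclideanSpace ℝ (Fin n)) :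
    branch n (fun y p => f (s y p) (s' y p)) y p u = f (branch n s y p u) (branch n s' y p u) := by
  rw [branch, branch, branch]
  split_ifs with h
  · rfl
  · exact hf.symm

/-- Equivariance of functions on the universal cover, with values in `𝔤`. -/
def IsEquivariant (𝔤 : NilpRep x) {U : Opens X} (s : Raw x U 𝔤) : Prop :=
  ∀ (y : U) (γ : FundamentalGroup X x) (p : FundamentalGroupoid.mk x ⟶ FundamentalGroupoid.mk y.1),
    s y (γ.toArrow ≫ p) = 𝔤.rep γ⁻¹ (s y p)

/-- Equivariance of 1-forms. -/
def IsEquivariantForm (𝔤 : NilpRep x) {U : Opens X}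
    (s : Raw x U (EuclideanSpace ℝ (Fin n) →L[ℝ] 𝔤)) : Prop :=
  ∀ (y : U) (γ : FundamentalGroup X x) (p : FundamentalGroupoid.mk x ⟶ FundamentalGroupoid.mk y.1)
    (v : EuclideanSpace ℝ (Fin n)), s y (γ.toArrow ≫ p) v = 𝔤.rep γ⁻¹ (s y p v)

/-- Smooth functions on the universal cover. -/
def IsSmooth {𝔤 : NilpRep x} {U : Opens X} (s : Raw x U 𝔤) : Prop :=
  ∀ y p, ContDiffAt ℝ ∞ (branch n s y p) (chart n y.1 y.1)

/-- Smooth 1-forms on the universal cover. -/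
def IsSmoothForm {𝔤 : NilpRep x} {U : Opens X}
    (s : Raw x U (EuclideanSpace ℝ (Fin n) →L[ℝ] 𝔤)) : Prop :=
  ∀ y p, ContDiffAt ℝ ∞ (branchForm n s y p) (chart n y.1 y.1)

/-- Locally constant functions on the universal cover. -/
def IsLocConst {𝔤 : NilpRep x} {U : Opens X} (s : Raw x U 𝔤) : Prop :=
  ∀ y p, ∀ᶠ u in 𝓝 (chart n y.1 y.1), branch n s y p u = s y p

/-- The differential of a function, a 1-form. -/
def d {𝔤 : NilpRep x} {U : Opens X} (a : Raw x U 𝔤) :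
    Raw x U (EuclideanSpace ℝ (Fin n) →L[ℝ] 𝔤) :=
  fun y p => fderiv ℝ (branch n a y p) (chart n y.1 y.1)

/-- The exterior derivative `dη (v, w)` of a 1-form. -/
def extD {𝔤 : NilpRep x} {U : Opens X} (η : Raw x U (EuclideanSpace ℝ (Fin n) →L[ℝ] 𝔤)) (y : U)
    (p : FundamentalGroupoid.mk x ⟶ FundamentalGroupoid.mk y.1)
    (v w : EuclideanSpace ℝ (Fin n)) : 𝔤 :=
  fderiv ℝ (branchForm n η y p) (chart n y.1 y.1) v w
    - fderiv ℝ (branchForm n η y p) (chart n y.1 y.1) w v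

/-- `A⁰(𝔤)`: smooth sections over `U` of the local system of `𝔤` tensored with functions. -/
structure FunSec (𝔤 : NilpRep x) (U : Opens X) where
  val : Raw x U 𝔤
  equivariant : IsEquivariant 𝔤 val
  smooth : IsSmooth n val

/-- `MC(𝔤)`: smooth global 1-forms `η` with values in the local system of `𝔤` such that
`dη + ½[η, η] = 0`, where `½[η, η](v, w) = [η v, η w]`. -/
structure MC (𝔤 : NilpRep x) where
  form : Raw x ⊤ (EuclideanSpace ℝ (Fin n) →L[ℝ] 𝔤)
  equivariant : IsEquivariantForm n 𝔤 form
  smooth : IsSmoothForm n form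
  eqn : ∀ y p v w, extD n form y p v w + ⁅form y p v, form y p w⁆ = 0

/-! ### Gauge transformations -/

section Gauge

variable {𝔤 𝔥 : NilpRep x} {U V : Opens X}

/-- The operator `ad a` on `A¹(𝔤) ⊕ ℝ d`, where `[a, d] = -da` and `[d, d] = 0`. -/
def adExt (a : Raw x U 𝔤) :
    Module.End ℝ (Raw x U (EuclideanSpace ℝ (Fin n) →L[ℝ] 𝔤) × ℝ) where
  toFun q := (fun y p => (𝔤.ad (a y p)).comp (q.1 y p) - q.2 • d n a y p, 0)
  map_add' q q' := by
    refine Prod.ext (funext fun y => funext fun p => ?_) (by simp)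
    simp only [Prod.fst_add, Prod.snd_add, Pi.add_apply, ContinuousLinearMap.comp_add, add_smul]
    abel
  map_smul' c q := by
    refine Prod.ext (funext fun y => funext fun p => ?_) (by simp)
    simp [smul_sub, smul_smul]

/-- The gauge action `exp(ad a)(η + d) - d` of `exp(a)` on a 1-form `η`. -/
def gauge (a : Raw x U 𝔤) (η : Raw x U (EuclideanSpace ℝ (Fin n) →L[ℝ] 𝔤)) :
    Raw x U (EuclideanSpace ℝ (Fin n) →L[ℝ] 𝔤) :=
  (∑ᶠ k : ℕ, ((k ! : ℝ)⁻¹ • (adExt n a ^ k) (η, 1)) - (0, 1)).1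

/-- The logarithmic derivative `α⁻¹ dα` of `α = exp(a)`: the differential of `a`, moved to the
identity of the group `exp(𝔤)` by the differential of left translation by `α⁻¹ = exp(-a)`. -/
def logDeriv (a : Raw x U 𝔤) : Raw x U (EuclideanSpace ℝ (Fin n) →L[ℝ] 𝔤) :=
  fun y p => (fderiv ℝ (fun z => bch (-(a y p)) z) (a y p)).comp (d n a y p)

/-- The pointwise product in `exp(𝔤)`. -/
def Raw.mul (a b : Raw x U 𝔤) : Raw x U 𝔤 := fun y p => bch (a y p) (b y p)

/-- The pointwise inverse in `exp(𝔤)`. -/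
def Raw.inv (a : Raw x U 𝔤) : Raw x U 𝔤 := fun y p => -a y p

/-- Composition with a morphism. -/
def Raw.map (θ : 𝔤 ⟶ 𝔥) (a : Raw x U 𝔤) : Raw x U 𝔥 := fun y p => θ.toLie (a y p)

/-- Composition of a 1-form with a morphism. -/
def Raw.mapForm (θ : 𝔤 ⟶ 𝔥) (η : Raw x U (EuclideanSpace ℝ (Fin n) →L[ℝ] 𝔤)) :
    Raw x U (EuclideanSpace ℝ (Fin n) →L[ℝ] 𝔥) := fun y p => (θ.toCLM).comp (η y p)

lemma IsEquivariant.mul {a b : Raw x U 𝔤} (ha : IsEquivariant 𝔤 a) (hb : IsEquivariant 𝔤 b) :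
    IsEquivariant 𝔤 (a.mul b) := fun y γ p => by
  simp only [Raw.mul, ha y γ p, hb y γ p, 𝔤.rep_bch]

lemma IsEquivariant.inv {a : Raw x U 𝔤} (ha : IsEquivariant 𝔤 a) : IsEquivariant 𝔤 a.inv :=
  fun y γ p => by simp only [Raw.inv, ha y γ p, map_neg]

lemma IsEquivariant.map (θ : 𝔤 ⟶ 𝔥) {a : Raw x U 𝔤} (ha : IsEquivariant 𝔤 a) :
    IsEquivariant 𝔥 (a.map θ) := fun y γ p => by simp only [Raw.map, ha y γ p, θ.comm]

lemma IsEquivariant.res (h : V ≤ U) {a : Raw x U 𝔤} (ha : IsEquivariant 𝔤 a) :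
    IsEquivariant 𝔤 (a.res h) := fun y γ p => ha ⟨y.1, h y.2⟩ γ p

lemma branch_map_hom (θ : 𝔤 ⟶ 𝔥) (a : Raw x U 𝔤) (y : U)
    (p : FundamentalGroupoid.mk x ⟶ FundamentalGroupoid.mk y.1) :
    branch n (a.map θ) y p = θ.toCLM ∘ branch n a y p :=
  funext fun u => branch_map n (fun z => θ.toLie z) (map_zero _) a y p u

lemma branchForm_map_hom (θ : 𝔤 ⟶ 𝔥) (η : Raw x U (EuclideanSpace ℝ (Fin n) →L[ℝ] 𝔤)) (y : U)
    (p : FundamentalGroupoid.mk x ⟶ FundamentalGroupoid.mk y.1) :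
    branchForm n (η.mapForm n θ) y p =
      (ContinuousLinearMap.compL ℝ (EuclideanSpace ℝ (Fin n)) 𝔤 𝔥 θ.toCLM) ∘ branchForm n η y p := by
  funext u
  have := branch_map n (fun z : EuclideanSpace ℝ (Fin n) →L[ℝ] 𝔤 => θ.toCLM.comp z)
    (by simp) η y p u
  exact congrArg (fun z : EuclideanSpace ℝ (Fin n) →L[ℝ] 𝔥 => z.comp (chartDeriv n y.1 u)) this

lemma IsSmooth.mul {a b : Raw x U 𝔤} (ha : IsSmooth n a) (hb : IsSmooth n b) :
    IsSmooth n (a.mul b) := fun y p => by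
  have : branch n (a.mul b) y p = fun u => bch (branch n a y p u) (branch n b y p u) :=
    funext fun u => branch_map₂ n bch bch_zero_zero a b y p u
  rw [this]
  exact 𝔤.contDiff_bch.contDiffAt.comp _ ((ha y p).prodMk (hb y p))

lemma IsSmooth.inv {a : Raw x U 𝔤} (ha : IsSmooth n a) : IsSmooth n a.inv := fun y p => by
  have : branch n a.inv y p = fun u => -branch n a y p u :=
    funext fun u => branch_map n (fun z : 𝔤 => -z) neg_zero a y p u
  rw [this]
  exact (ha y p).neg

lemma IsSmooth.map (θ : 𝔤 ⟶ 𝔥) {a : Raw x U 𝔤} (ha : IsSmooth n a) :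
    IsSmooth n (a.map θ) := fun y p => by
  rw [branch_map_hom]
  exact θ.toCLM.contDiff.contDiffAt.comp _ (ha y p)

lemma IsSmooth.res (h : V ≤ U) {a : Raw x U 𝔤} (ha : IsSmooth n a) :
    IsSmooth n (a.res h) := fun y p =>
  (ha ⟨y.1, h y.2⟩ p).congr_of_eventuallyEq (branch_res n h a y p)

lemma IsLocConst.mul {a b : Raw x U 𝔤} (ha : IsLocConst n a) (hb : IsLocConst n b) :
    IsLocConst n (a.mul b) := fun y p => by
  filter_upwards [ha y p, hb y p] with u h1 h2
  rw [Raw.mul, ← h1, ← h2]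
  exact branch_map₂ n bch bch_zero_zero a b y p u

lemma IsLocConst.map (θ : 𝔤 ⟶ 𝔥) {a : Raw x U 𝔤} (ha : IsLocConst n a) :
    IsLocConst n (a.map θ) := fun y p => by
  filter_upwards [ha y p] with u h1
  rw [branch_map_hom, Function.comp, h1]
  rfl

lemma IsLocConst.res (h : V ≤ U) {a : Raw x U 𝔤} (ha : IsLocConst n a) :
    IsLocConst n (a.res h) := fun y p => by
  filter_upwards [ha ⟨y.1, h y.2⟩ p, branch_res n h a y p] with u h1 h2
  rw [h2, h1]
  rfl

lemma d_res (h : V ≤ U) (a : Raw x U 𝔤) : d n (a.res h) = (d n a).res h :=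
  funext fun y => funext fun p => (branch_res n h a y p).fderiv_eq

lemma logDeriv_res (h : V ≤ U) (a : Raw x U 𝔤) :
    logDeriv n (a.res h) = (logDeriv n a).res h :=
  funext fun y => funext fun p => by
    simp only [logDeriv, d_res]
    rfl

lemma d_map (θ : 𝔤 ⟶ 𝔥) {a : Raw x U 𝔤} (ha : IsSmooth n a) :
    d n (a.map θ) = (d n a).mapForm n θ :=
  funext fun y => funext fun p => by
    simp only [d, branch_map_hom, Raw.mapForm]
    exact (θ.toCLM.hasFDerivAt.comp _ ((ha y p).differentiableAt (by simp)).hasFDerivAt).fderiv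

lemma logDeriv_map (θ : 𝔤 ⟶ 𝔥) {a : Raw x U 𝔤} (ha : IsSmooth n a) :
    logDeriv n (a.map θ) = (logDeriv n a).mapForm n θ :=
  funext fun y => funext fun p => by
    have hd : ∀ (𝔨 : NilpRep x) (b c : 𝔨), DifferentiableAt ℝ (fun z => bch b z) c :=
      fun 𝔨 b c => ((𝔨.contDiff_bch.comp (contDiff_const.prodMk contDiff_id)).differentiable
        (by simp)) c
    have h1 := θ.toCLM.hasFDerivAt.comp _ (hd 𝔤 (-(a y p)) (a y p)).hasFDerivAt
    have h2 := (hd 𝔥 (-(θ.toCLM (a y p))) (θ.toCLM (a y p))).hasFDerivAt.comp (a y p)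
      θ.toCLM.hasFDerivAt
    have h3 : (θ.toCLM : 𝔤 → 𝔥) ∘ (fun z => bch (-(a y p)) z) =
        (fun z => bch (-(θ.toCLM (a y p))) z) ∘ θ.toCLM := funext fun z => by
      simpa [NilpRep.Hom.toCLM_apply] using map_bch θ.toLie (-(a y p)) z
    rw [h3] at h1
    have h4 := h1.unique h2
    simp only [logDeriv, d_map n θ ha, Raw.mapForm]
    rw [← ContinuousLinearMap.comp_assoc, ← ContinuousLinearMap.comp_assoc, h4]
    rfl

lemma adExt_pow (a : Raw x U 𝔤) (k : ℕ) (η : Raw x U (EuclideanSpace ℝ (Fin n) →L[ℝ] 𝔤)) (y : U)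
    (p : FundamentalGroupoid.mk x ⟶ FundamentalGroupoid.mk y.1) (v : EuclideanSpace ℝ (Fin n)) :
    ((adExt n a ^ k) (η, 0)).1 y p v = (LieModule.toEnd ℝ 𝔤 𝔤 (a y p) ^ k) (η y p v) ∧
      ((adExt n a ^ k) (η, 0)).2 = 0 := by
  induction k with
  | zero => simp
  | succ k ih =>
    rw [pow_succ', pow_succ', Module.End.mul_apply, Module.End.mul_apply, ← ih.1]
    refine ⟨?_, rfl⟩
    generalize (adExt n a ^ k) (η, 0) = q at ih ⊢
    simp [adExt, ih.2, NilpRep.ad_apply]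

lemma exists_adExt_pow_eq_zero (a : Raw x U 𝔤) : ∃ k, adExt n a ^ k = 0 := by
  obtain ⟨k, hk⟩ := LieModule.exists_forall_pow_toEnd_eq_zero ℝ 𝔤 𝔤
  refine ⟨k + 1, LinearMap.ext fun q => ?_⟩
  refine Prod.ext (funext fun y => funext fun p => ContinuousLinearMap.ext fun v => ?_) ?_
  · rw [pow_succ, Module.End.mul_apply]
    exact ((adExt_pow n a k _ y p v).1).trans (by rw [hk]; rfl)
  · rw [pow_succ', Module.End.mul_apply]
    rfl

/-- Composition with a morphism, on `A¹ ⊕ ℝ d`. -/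
def mapExt (θ : 𝔤 ⟶ 𝔥) : (Raw x U (EuclideanSpace ℝ (Fin n) →L[ℝ] 𝔤) × ℝ) →ₗ[ℝ]
    (Raw x U (EuclideanSpace ℝ (Fin n) →L[ℝ] 𝔥) × ℝ) where
  toFun q := (q.1.mapForm n θ, q.2)
  map_add' q q' := by
    refine Prod.ext (funext fun y => funext fun p => ?_) rfl
    simp [Raw.mapForm]
  map_smul' c q := by
    refine Prod.ext (funext fun y => funext fun p => ?_) rfl
    simp [Raw.mapForm]

lemma mapExt_adExt_pow (θ : 𝔤 ⟶ 𝔥) {a : Raw x U 𝔤} (ha : IsSmooth n a) (k : ℕ)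
    (q : Raw x U (EuclideanSpace ℝ (Fin n) →L[ℝ] 𝔤) × ℝ) :
    mapExt n θ ((adExt n a ^ k) q) = (adExt n (a.map θ) ^ k) (mapExt n θ q) := by
  induction k with
  | zero => simp
  | succ k ih =>
    rw [pow_succ', pow_succ', Module.End.mul_apply, Module.End.mul_apply, ← ih]
    generalize (adExt n a ^ k) q = r
    refine Prod.ext (funext fun y => funext fun p => ContinuousLinearMap.ext fun v => ?_) rfl
    simp [adExt, mapExt, d_map n θ ha, Raw.mapForm, Raw.map, NilpRep.ad_apply,
      NilpRep.Hom.toCLM_apply]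

lemma gauge_map (θ : 𝔤 ⟶ 𝔥) {a : Raw x U 𝔤} (ha : IsSmooth n a)
    (η : Raw x U (EuclideanSpace ℝ (Fin n) →L[ℝ] 𝔤)) :
    gauge n (a.map θ) (η.mapForm n θ) = (gauge n a η).mapForm n θ := by
  obtain ⟨m, hm⟩ := exists_adExt_pow_eq_zero n a
  have hfin : (Function.support fun k : ℕ => (k ! : ℝ)⁻¹ • (adExt n a ^ k) (η, 1)).Finite := by
    refine (Set.finite_lt_nat m).subset fun k hk => ?_
    by_contra hc
    refine hk ?_
    simp only [pow_eq_zero_of_le (not_lt.1 hc) hm, LinearMap.zero_apply, smul_zero]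
  have h := (mapExt n θ).toAddMonoidHom.map_finsum hfin
  simp only [LinearMap.toAddMonoidHom_coe, map_smul, mapExt_adExt_pow n θ ha] at h
  have h1 : mapExt n θ (η, 1) = (η.mapForm n θ, 1) := rfl
  have h2 : mapExt n θ ((0, 1) : Raw x U (EuclideanSpace ℝ (Fin n) →L[ℝ] 𝔤) × ℝ) = (0, 1) :=
    Prod.ext (funext fun y => funext fun p => by simp [mapExt, Raw.mapForm]) rfl
  rw [h1] at h
  rw [gauge, gauge, ← h, ← h2, ← map_sub]
  rfl

end Gauge

/-! ### The deformation groupoid -/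

section Def

variable {n} {𝔤 𝔥 : NilpRep x} {U : Opens X}

attribute [ext] FunSec MC

/-- The product in `exp(A⁰(𝔤))`. -/
def FunSec.mul (a b : FunSec n 𝔤 U) : FunSec n 𝔤 U :=
  ⟨a.val.mul b.val, a.equivariant.mul b.equivariant, a.smooth.mul n b.smooth⟩

/-- The inverse in `exp(A⁰(𝔤))`. -/
def FunSec.inv (a : FunSec n 𝔤 U) : FunSec n 𝔤 U :=
  ⟨a.val.inv, a.equivariant.inv, a.smooth.inv n⟩

/-- The identity of `exp(A⁰(𝔤))`. -/
def FunSec.one : FunSec n 𝔤 U where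
  val := fun _ _ => 0
  equivariant := fun _ _ _ => (map_zero _).symm
  smooth := fun y p => by
    have : branch n (fun _ _ => 0 : Raw x U 𝔤) y p = fun _ => 0 := by
      funext u
      simp [branch]
    rw [this]
    exact contDiffAt_const

/-- Composition with a morphism. -/
def FunSec.map (θ : 𝔤 ⟶ 𝔥) (a : FunSec n 𝔤 U) : FunSec n 𝔥 U :=
  ⟨a.val.map θ, a.equivariant.map θ, a.smooth.map n θ⟩

/-- Composition of a Maurer-Cartan element with a morphism. -/
def MC.map (θ : 𝔤 ⟶ 𝔥) (η : MC n 𝔤) : MC n 𝔥 where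
  form := η.form.mapForm n θ
  equivariant := fun y γ p v => by
    change θ.toLie (η.form y (γ.toArrow ≫ p) v) = _
    rw [η.equivariant y γ p v, θ.comm]
    rfl
  smooth := fun y p => by
    rw [branchForm_map_hom]
    exact (ContinuousLinearMap.contDiff _).contDiffAt.comp _ (η.smooth y p)
  eqn := fun y p v w => by
    have h := congrArg θ.toLie (η.eqn y p v w)
    have hd := (ContinuousLinearMap.hasFDerivAt
      (ContinuousLinearMap.compL ℝ (EuclideanSpace ℝ (Fin n)) 𝔤 𝔥 θ.toCLM)).comp _
      ((η.smooth y p).differentiableAt (by simp)).hasFDerivAt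
    rw [← branchForm_map_hom] at hd
    rw [map_add, LieHom.map_lie, map_zero] at h
    rw [← h]
    simp only [extD, hd.fderiv, map_sub]
    rfl

variable (n 𝔤) in
/-- The assertion that the Campbell-Baker-Hausdorff product makes `𝔤` a group, and that the gauge
action is an action of `exp(A⁰(𝔤))` on `MC(𝔤)`. -/
structure IsGaugeGroupoid : Prop where
  mul_assoc : ∀ a b c : 𝔤, bch (bch a b) c = bch a (bch b c)
  one_mul : ∀ a : 𝔤, bch 0 a = a
  mul_one : ∀ a : 𝔤, bch a 0 = a
  inv_mul : ∀ a : 𝔤, bch (-a) a = 0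
  gauge_mem : ∀ (a : FunSec n 𝔤 ⊤) (η : MC n 𝔤), ∃ η' : MC n 𝔤, gauge n a.val η.form = η'.form
  gauge_one : ∀ η : MC n 𝔤, gauge n (FunSec.one : FunSec n 𝔤 ⊤).val η.form = η.form
  gauge_mul : ∀ (a b : FunSec n 𝔤 ⊤) (η : MC n 𝔤),
    gauge n (a.mul b).val η.form = gauge n a.val (gauge n b.val η.form)

/-- The objects of the deformation groupoid: Maurer-Cartan elements. -/
structure Def (hG : IsGaugeGroupoid n 𝔤) where
  mc : MC n 𝔤

/-- The morphisms `η ⟶ η'` of the deformation groupoid: the elements `a` of `exp(A⁰(𝔤))` whose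
gauge action takes `η` to `η'`. -/
@[ext]
structure Def.Hom {hG : IsGaugeGroupoid n 𝔤} (η η' : Def hG) where
  elt : FunSec n 𝔤 ⊤
  gauge_eq : gauge n elt.val η.mc.form = η'.mc.form

lemma IsGaugeGroupoid.mul_inv (hG : IsGaugeGroupoid n 𝔤) (a : 𝔤) : bch a (-a) = 0 := by
  simpa using hG.inv_mul (-a)

lemma IsGaugeGroupoid.neg_bch (hG : IsGaugeGroupoid n 𝔤) (a b : 𝔤) :
    -bch a b = bch (-b) (-a) := by
  have h : bch (bch (-b) (-a)) (bch a b) = 0 := by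
    rw [hG.mul_assoc, ← hG.mul_assoc (-a), hG.inv_mul, hG.one_mul, hG.inv_mul]
  calc -bch a b = bch (bch (bch (-b) (-a)) (bch a b)) (-bch a b) := by rw [h, hG.one_mul]
    _ = bch (-b) (-a) := by rw [hG.mul_assoc, hG.mul_inv, hG.mul_one]

/-- The deformation groupoid of `𝔤`. -/
instance (hG : IsGaugeGroupoid n 𝔤) : Groupoid (Def hG) where
  Hom := Def.Hom
  id η := ⟨FunSec.one, hG.gauge_one η.mc⟩
  comp f g := ⟨g.elt.mul f.elt, by rw [hG.gauge_mul, f.gauge_eq, g.gauge_eq]⟩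
  id_comp f := Def.Hom.ext (FunSec.ext (funext fun y => funext fun p => hG.mul_one _))
  comp_id f := Def.Hom.ext (FunSec.ext (funext fun y => funext fun p => hG.one_mul _))
  assoc f g h := Def.Hom.ext (FunSec.ext (funext fun y => funext fun p =>
    (hG.mul_assoc _ _ _).symm))
  inv {η η'} f := ⟨f.elt.inv, by
    have h : f.elt.inv.mul f.elt = FunSec.one :=
      FunSec.ext (funext fun y => funext fun p => hG.inv_mul _)
    rw [← f.gauge_eq, ← hG.gauge_mul, h, hG.gauge_one]⟩
  inv_comp f := Def.Hom.ext (FunSec.ext (funext fun y => funext fun p => hG.mul_inv _))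
  comp_inv f := Def.Hom.ext (FunSec.ext (funext fun y => funext fun p => hG.inv_mul _))

/-- The functor of deformation groupoids induced by a morphism. -/
def Def.map (θ : 𝔤 ⟶ 𝔥) (hG : IsGaugeGroupoid n 𝔤) (hH : IsGaugeGroupoid n 𝔥) :
    Def hG ⥤ Def hH where
  obj η := ⟨η.mc.map θ⟩
  map {η _} f := ⟨f.elt.map θ, (gauge_map n θ f.elt.smooth η.mc.form).trans
    (congrArg (Raw.mapForm n θ) f.gauge_eq)⟩
  map_id _ := Def.Hom.ext (FunSec.ext (funext fun _ => funext fun _ => map_zero θ.toLie))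
  map_comp _ _ := Def.Hom.ext (FunSec.ext (funext fun _ => funext fun _ =>
    map_bch θ.toLie _ _))

end Def

/-! ### Torsors -/

section Torsor

variable {𝔤 𝔥 : NilpRep x}

variable (𝔤) in
/-- Sections of the local system of `𝔤`. -/
def flatPredicate :
    TopCat.LocalPredicate (X := TopCat.of X)
      (fun y : X => (FundamentalGroupoid.mk x ⟶ FundamentalGroupoid.mk y) → 𝔤) where
  pred {U} s := IsEquivariant (U := U) 𝔤 s ∧ IsLocConst (U := U) n s
  res {V U} i s h := ⟨h.1.res i.le, h.2.res n i.le⟩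
  locality {U} s h := by
    refine ⟨fun y γ p => ?_, fun y p => ?_⟩
    · obtain ⟨V, hy, i, h1, -⟩ := h y
      exact h1 ⟨y.1, hy⟩ γ p
    · obtain ⟨V, hy, i, -, h2⟩ := h y
      filter_upwards [h2 ⟨y.1, hy⟩ p, branch_res (V := V) (U := U) n i.le s ⟨y.1, hy⟩ p] with u h3 h4
      exact h4.symm.trans h3

variable (𝔤) in
/-- The locally constant sheaf `exp(𝔤)` on `X`. -/
def expSheaf : TopCat.Sheaf (Type u) (TopCat.of X) :=
  TopCat.subsheafToTypes (flatPredicate n 𝔤)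

variable (𝔤) in
/-- Sections of the sheaf `exp(𝔤)`. -/
abbrev ExpSec (U : Opens X) : Type u := (expSheaf n 𝔤).presheaf.obj (op U)

variable {n}

/-- The product of sections of `exp(𝔤)`. -/
def ExpSec.mul {U : Opens X} (g h : ExpSec n 𝔤 U) : ExpSec n 𝔤 U :=
  ⟨Raw.mul (U := U) g.1 h.1, IsEquivariant.mul (U := U) g.2.1 h.2.1,
    IsLocConst.mul (U := U) n g.2.2 h.2.2⟩

/-- Composition with a morphism. -/
def ExpSec.map (θ : 𝔤 ⟶ 𝔥) {U : Opens X} (g : ExpSec n 𝔤 U) : ExpSec n 𝔥 U :=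
  ⟨Raw.map (U := U) θ g.1, IsEquivariant.map (U := U) θ g.2.1, IsLocConst.map (U := U) n θ g.2.2⟩

/-- Restriction of sections of a sheaf. -/
abbrev resSec (F : TopCat.Sheaf (Type u) (TopCat.of X)) {U V : Opens X} (h : V ≤ U)
    (s : F.presheaf.obj (op U)) : F.presheaf.obj (op V) :=
  F.presheaf.map (homOfLE h).op s

/-- For each point `y`, the stalk at `y` of a sheaf `F` with an action of `exp(𝔤)` is isomorphic to
the stalk of `exp(𝔤)`, as a set with an action of the latter. -/
def IsStalkwiseTrivial (F : TopCat.Sheaf (Type u) (TopCat.of X))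
    (act : ∀ {U : Opens X}, ExpSec n 𝔤 U → F.presheaf.obj (op U) → F.presheaf.obj (op U)) : Prop :=
  ∀ y : X, ∃ e : (expSheaf n 𝔤).presheaf.stalk y ≃ F.presheaf.stalk y,
    ∀ (U : Opens X) (hy : y ∈ U) (g h : ExpSec n 𝔤 U) (b : F.presheaf.obj (op U)),
      e ((expSheaf n 𝔤).presheaf.germ U y hy h) = F.presheaf.germ U y hy b →
      e ((expSheaf n 𝔤).presheaf.germ U y hy (g.mul h)) = F.presheaf.germ U y hy (act g b)

variable (n 𝔤) in
/-- An `exp(𝔤)`-torsor on `X`. -/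
structure Torsor where
  sheaf : TopCat.Sheaf (Type u) (TopCat.of X)
  act : ∀ {U : Opens X}, ExpSec n 𝔤 U → sheaf.presheaf.obj (op U) → sheaf.presheaf.obj (op U)
  act_res : ∀ {U V : Opens X} (h : V ≤ U) (g : ExpSec n 𝔤 U) (b : sheaf.presheaf.obj (op U)),
    resSec sheaf h (act g b) = act (resSec (expSheaf n 𝔤) h g) (resSec sheaf h b)
  mul_act : ∀ {U : Opens X} (g h : ExpSec n 𝔤 U) (b : sheaf.presheaf.obj (op U)),
    act g (act h b) = act (g.mul h) b
  stalk : IsStalkwiseTrivial sheaf act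

/-- A morphism of sheaves from an `exp(𝔤)`-torsor to an `exp(𝔥)`-torsor which is equivariant along
a morphism `θ : 𝔤 ⟶ 𝔥`. -/
@[ext]
structure Torsor.HomOver (θ : 𝔤 ⟶ 𝔥) (P : Torsor n 𝔤) (Q : Torsor n 𝔥) where
  hom : P.sheaf.presheaf ⟶ Q.sheaf.presheaf
  equivariant : ∀ {U : Opens X} (g : ExpSec n 𝔤 U) (b : P.sheaf.presheaf.obj (op U)),
    hom.app (op U) (P.act g b) = Q.act (g.map θ) (hom.app (op U) b)

/-- A morphism of `exp(𝔤)`-torsors. -/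
@[ext]
structure Torsor.Hom (P Q : Torsor n 𝔤) where
  hom : P.sheaf.presheaf ⟶ Q.sheaf.presheaf
  equivariant : ∀ {U : Opens X} (g : ExpSec n 𝔤 U) (b : P.sheaf.presheaf.obj (op U)),
    hom.app (op U) (P.act g b) = Q.act g (hom.app (op U) b)

/-- The category of `exp(𝔤)`-torsors. -/
instance : Category (Torsor n 𝔤) where
  Hom := Torsor.Hom
  id P := ⟨𝟙 _, fun _ _ => rfl⟩
  comp f g := ⟨f.hom ≫ g.hom, fun s b => by simp [f.equivariant, g.equivariant]⟩

/-- Composition of an equivariant morphism along `θ` with a morphism of torsors. -/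
def Torsor.HomOver.comp {θ : 𝔤 ⟶ 𝔥} {P : Torsor n 𝔤} {Q R : Torsor n 𝔥} (f : HomOver θ P Q)
    (g : Q ⟶ R) : HomOver θ P R :=
  ⟨f.hom ≫ g.hom, fun s b => by simp [f.equivariant, Torsor.Hom.equivariant g]⟩

/-- Composition of a morphism of torsors with an equivariant morphism along `θ`. -/
def Torsor.HomOver.precomp {θ : 𝔤 ⟶ 𝔥} {P Q : Torsor n 𝔤} {R : Torsor n 𝔥} (f : P ⟶ Q)
    (g : HomOver θ Q R) : HomOver θ P R :=
  ⟨f.hom ≫ g.hom, fun s b => by simp [g.equivariant, Torsor.Hom.equivariant f]⟩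

/-- An equivariant morphism `f : P → Q` along `θ` exhibits `Q` as the torsor obtained from `P` by
change of structure group along `exp(θ)`, by the universal property of the latter. -/
def Torsor.HomOver.IsPushforward {θ : 𝔤 ⟶ 𝔥} {P : Torsor n 𝔤} {Q : Torsor n 𝔥}
    (f : HomOver θ P Q) : Prop :=
  ∀ (R : Torsor n 𝔥) (h : HomOver θ P R), ∃! k : Q ⟶ R, f.comp k = h

/-- Sections of `𝔹_η`: smooth sections `α` of `exp(𝔤 ⊗ 𝒜⁰)` with `α⁻¹ dα = η`. -/
def mcPredicate (η : MC n 𝔤) :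
    TopCat.LocalPredicate (X := TopCat.of X)
      (fun y : X => (FundamentalGroupoid.mk x ⟶ FundamentalGroupoid.mk y) → 𝔤) where
  pred {U} s := IsEquivariant (U := U) 𝔤 s ∧ IsSmooth (U := U) n s ∧
    logDeriv (U := U) n s = η.form.res le_top
  res {V U} i s h := ⟨h.1.res i.le, h.2.1.res n i.le, by
    have := logDeriv_res (U := U) (V := V) n i.le s
    rw [h.2.2] at this
    exact this⟩
  locality {U} s h := by
    refine ⟨fun y γ p => ?_, fun y p => ?_, funext fun y => funext fun p => ?_⟩
    · obtain ⟨V, hy, i, h1, -⟩ := h y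
      exact h1 ⟨y.1, hy⟩ γ p
    · obtain ⟨V, hy, i, -, h2, -⟩ := h y
      exact (h2 ⟨y.1, hy⟩ p).congr_of_eventuallyEq
        (branch_res (V := V) (U := U) n i.le s ⟨y.1, hy⟩ p).symm
    · obtain ⟨V, hy, i, -, -, h3⟩ := h y
      have := logDeriv_res (U := U) (V := V) n i.le s
      exact (congrFun (congrFun (this.symm.trans h3) ⟨y.1, hy⟩) p)

/-- The sheaf `𝔹_η`. -/
def mcSheaf (η : MC n 𝔤) : TopCat.Sheaf (Type u) (TopCat.of X) :=
  TopCat.subsheafToTypes (mcPredicate η)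

/-- The assertion that `𝔹_η` is a torsor: it is stable under left multiplication by sections of `exp(𝔤)`, and its stalks are
isomorphic to those of `exp(𝔤)`. -/
structure IsMCTorsor (η : MC n 𝔤) : Prop where
  mul_mem : ∀ (U : Opens X) (g : ExpSec n 𝔤 U) (α : (mcSheaf η).presheaf.obj (op U)),
    (mcPredicate η).pred (U := U) (Raw.mul (U := U) g.1 α.1)
  stalk : IsStalkwiseTrivial (mcSheaf η) fun {U} g α => ⟨Raw.mul (U := U) g.1 α.1, mul_mem U g α⟩

variable (n 𝔤) in
/-- The assertion that the sheaves `𝔹_η` are torsors, and that right multiplication by the inverse of a gauge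
transformation from `η` to `η'` takes `𝔹_η` to `𝔹_η'`. -/
structure IsTorsorFunctor : Prop where
  torsor : ∀ η : MC n 𝔤, IsMCTorsor η
  map_mem : ∀ (η η' : MC n 𝔤) (a : FunSec n 𝔤 ⊤), gauge n a.val η.form = η'.form →
    ∀ (U : Opens X) (α : (mcSheaf η).presheaf.obj (op U)),
      (mcPredicate η').pred (U := U) (Raw.mul (U := U) α.1 (a.val.res le_top).inv)

/-- The torsor `𝔹_η`, on which `exp(𝔤)` acts by left multiplication. -/
def torsorOf (hG : IsGaugeGroupoid n 𝔤) (hB : IsTorsorFunctor n 𝔤) (η : MC n 𝔤) : Torsor n 𝔤 where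
  sheaf := mcSheaf η
  act {U} g α := ⟨Raw.mul (U := U) g.1 α.1, (hB.torsor η).mul_mem U g α⟩
  act_res _ _ _ := rfl
  mul_act _ _ _ := Subtype.ext (funext fun _ => funext fun _ => (hG.mul_assoc _ _ _).symm)
  stalk := (hB.torsor η).stalk

/-- The functor `η ↦ 𝔹_η`, which takes a gauge transformation `a : η ⟶ η'` to the morphism
`α ↦ α a⁻¹` from `𝔹_η` to `𝔹_η'`. -/
def torsorFunctor (hG : IsGaugeGroupoid n 𝔤) (hB : IsTorsorFunctor n 𝔤) :
    Def hG ⥤ Torsor n 𝔤 where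
  obj η := torsorOf hG hB η.mc
  map {η η'} f :=
    { hom :=
        { app := fun U => ↾fun α => ⟨Raw.mul (U := U.unop) α.1 (f.elt.val.res le_top).inv,
            hB.map_mem η.mc η'.mc f.elt f.gauge_eq U.unop α⟩
          naturality := fun _ _ _ => rfl }
      equivariant := fun _ _ => Subtype.ext (funext fun _ => funext fun _ => hG.mul_assoc _ _ _) }
  map_id η := Torsor.Hom.ext (NatTrans.ext (funext fun U => by
    ext α
    refine Subtype.ext (funext fun y => funext fun p => ?_)
    change bch (α.1 y p) (-0) = α.1 y p
    rw [neg_zero, hG.mul_one]))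
  map_comp f g := Torsor.Hom.ext (NatTrans.ext (funext fun U => by
    ext α
    refine Subtype.ext (funext fun y => funext fun p => ?_)
    change bch (α.1 y p) (-bch _ _) = bch (bch (α.1 y p) (-_)) (-_)
    rw [hG.neg_bch, hG.mul_assoc]
    rfl))

/-- The morphism `α ↦ θ(α)` from `𝔹_η` to `𝔹_θ(η)`, equivariant along `exp(θ)`. -/
def torsorMap (θ : 𝔤 ⟶ 𝔥) {hG : IsGaugeGroupoid n 𝔤} {hH : IsGaugeGroupoid n 𝔥}
    (hB : IsTorsorFunctor n 𝔤) (hC : IsTorsorFunctor n 𝔥) (η : Def hG) :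
    Torsor.HomOver θ ((torsorFunctor hG hB).obj η)
      ((torsorFunctor hH hC).obj ((Def.map θ hG hH).obj η)) where
  hom :=
    { app := fun U => ↾fun α => ⟨Raw.map (U := U.unop) θ α.1, α.2.1.map θ, α.2.2.1.map n θ, by
        have h := logDeriv_map (U := U.unop) n θ α.2.2.1
        rw [α.2.2.2] at h
        exact h⟩
      naturality := fun _ _ _ => rfl }
  equivariant := fun _ _ => Subtype.ext (funext fun _ => funext fun _ => map_bch θ.toLie _ _)

end Torsor

end Manifold
end
end FlatTorsor

open FlatTorsor

/-!
A section of `exp(𝔤) ⊗ 𝒜⁰`, or a form with values in the local system, is encoded by a function on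
the universal cover which is equivariant under the fundamental group. In a chart such a function has
smooth branches with values in the nilpotent Lie algebra, and the differential equations below are
equations between these branches.

**The group law.** Every finite-dimensional nilpotent real Lie algebra is a quotient of a Lie algebra
of nilpotent matrices, namely of one which acts on a truncated tensor algebra; the quotient map is
Dynkin's projection, which replaces a word of length `m` by `1 / m` times its iterated bracket
(`exists_assocCover`). For nilpotent elements of an associative algebra, the logarithm of
`exp(ta) exp(tb)` has a derivative in `t` which is a power series in `e^(ad ta) e^(ad tb) - 1`, and the
derivative of Dynkin's series has the same closed form (`sum_dynkin_smul_length`). Therefore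
`exp (bch a b) = exp a * exp b` (`exp_bch`). Associativity of `bch`, the cocycle rule for the form
`α⁻¹ dα` (`mcForm_bch`) and the transformation rule for the curvature (`curvature_gaugeForm`) follow
by lifting to matrices, where they are identities between products and derivatives. The gauge action
is `a * η = exp(ad a) η + a da⁻¹` (`gauge_apply`), so that it is an action by the cocycle rule, and
`α a⁻¹` solves the equation of `a * η` if `α` solves that of `η` (`logDeriv_mul_inv`).

**The torsor of a Maurer-Cartan element.** Two solutions of `α⁻¹ dα = η` differ by a left factor with
vanishing logarithmic derivative, which is locally constant (`isLocConst_mul_inv`). On a ball in a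
chart there is a solution (`exists_mcForm_eq`): if `η` has values in a term of the lower central
series, it is closed modulo the next term by the Maurer-Cartan equation, and the Poincaré lemma gives
a gauge transformation into the next term. Hence the solutions form a torsor (`isMCTorsor`).

**Morphisms.** A torsor has local sections, on which the structure group acts freely and
transitively. Thus every morphism of torsors is an isomorphism, and an equivariant morphism along
`θ` is a change of structure group, because the induced morphism has to take `g · f(b)` to `g · h(b)`
(`Torsor.HomOver.isPushforward`). For a morphism `k` between torsors of Maurer-Cartan elements,
`k(α)⁻¹ α` is independent of the local solution `α`. These elements define a gauge transformation
which induces `k` (`full_torsorFunctor`).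

**Essential surjectivity.** A torsor with sections `b₀ᵢ` over a cover, and a partition of unity `ρᵢ`
subordinate to it, are given. A section `b` has coordinates `gᵢ` with `b = gᵢ · b₀ᵢ`. The group
`exp(𝔤)` has weighted means which are smooth in the weights and equivariant under left translations:
the step `m ↦ m · ∑ ρᵢ (m⁻¹ gᵢ)` contracts the filtration by the lower central series
(`meanStep_contract`), so that its iterates become independent of the starting point
(`meanIter_bch_zero`). The mean of the `gᵢ` with weights `ρᵢ` is a smooth function `Torsor.triv b`, and
`b ↦ Torsor.triv b` is equivariant. Sections of the torsor differ by locally constant factors, whence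
the logarithmic derivative of `Torsor.triv b` does not depend on `b`; it is a global Maurer-Cartan
element, and `Torsor.triv` identifies the torsor with the sheaf of its solutions
(`essSurj_torsorFunctor`).
-/

namespace FlatTorsor

noncomputable section

/-! ### Exponential and logarithm of nilpotent elements -/

section Truncated

open Polynomial

/-- The Taylor polynomial of `exp X`, up to degree `M`. -/
def expPoly (M : ℕ) : ℝ[X] := ∑ k ∈ Finset.range (M + 1), C ((k ! : ℝ)⁻¹) * X ^ k

/-- The Taylor polynomial of `(exp X - 1) / X`. -/
def expDivPoly (M : ℕ) : ℝ[X] := ∑ k ∈ Finset.range M, C (((k + 1)! : ℝ)⁻¹) * X ^ k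

/-- The Taylor polynomial of `log (1 + X) / X`. -/
def logDivPoly (M : ℕ) : ℝ[X] := ∑ k ∈ Finset.range M, C ((-1) ^ k / (k + 1 : ℝ)) * X ^ k

lemma X_mul_expDivPoly (M : ℕ) : X * expDivPoly M = expPoly M - 1 := by
  rw [expPoly, Finset.sum_range_succ', expDivPoly, Finset.mul_sum]
  simp only [Nat.factorial_zero, Nat.cast_one, inv_one, map_one, pow_zero, mul_one,
    add_sub_cancel_right]
  exact Finset.sum_congr rfl fun k _ => by rw [pow_succ]; ring

lemma derivative_expPoly (M : ℕ) :
    derivative (expPoly M) = expPoly M - C ((M ! : ℝ)⁻¹) * X ^ M := by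
  conv_lhs => rw [expPoly, Finset.sum_range_succ']
  conv_rhs => rw [expPoly, Finset.sum_range_succ, add_sub_cancel_right]
  simp only [derivative_add, derivative_sum, pow_zero, mul_one, derivative_C, add_zero]
  refine Finset.sum_congr rfl fun k _ => ?_
  rw [derivative_C_mul_X_pow, Nat.add_sub_cancel, Nat.factorial_succ]
  congr 2
  push_cast
  field_simp

lemma derivative_X_mul_logDivPoly (M : ℕ) :
    derivative (X * logDivPoly M) = ∑ k ∈ Finset.range M, (-X) ^ k := by
  rw [logDivPoly, Finset.mul_sum, derivative_sum]
  refine Finset.sum_congr rfl fun k _ => ?_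
  have h : X * (C ((-1) ^ k / (k + 1 : ℝ)) * X ^ k) = C ((-1) ^ k / (k + 1 : ℝ)) * X ^ (k + 1) := by
    ring
  rw [h, derivative_C_mul_X_pow, Nat.add_sub_cancel, neg_pow (X : ℝ[X])]
  push_cast
  rw [div_mul_cancel₀ _ (by positivity : (k + 1 : ℝ) ≠ 0), map_pow, map_neg, map_one]

lemma one_add_mul_geom_neg {R : Type*} [CommRing R] (v : R) (M : ℕ) :
    (1 + v) * ∑ k ∈ Finset.range M, (-v) ^ k = 1 - (-v) ^ M := by
  have := mul_neg_geom_sum (-v) M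
  rwa [sub_neg_eq_add] at this

/-- A polynomial without constant term whose derivative is divisible by `X ^ M` is divisible by
`X ^ (M + 1)`. -/
lemma X_pow_succ_dvd_of_derivative {p : ℝ[X]} {M : ℕ} (h0 : p.coeff 0 = 0)
    (h : X ^ M ∣ derivative p) : X ^ (M + 1) ∣ p := by
  rw [X_pow_dvd_iff] at h ⊢
  intro d hd
  cases d with
  | zero => exact h0
  | succ d =>
    have := h d (by omega)
    rw [coeff_derivative] at this
    exact (mul_eq_zero.1 this).resolve_right (by positivity)

/-- The truncated form of `log (exp X) = X`, divided by `X`. The derivatives of both sides agree up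
to order `M`, because the derivative of `log (1 + X)` is a geometric series. -/
lemma X_pow_dvd_logDiv_comp_mul_expDiv (M : ℕ) :
    X ^ M ∣ (logDivPoly M).comp (expPoly M - 1) * expDivPoly M - 1 := by
  have hX : X ∣ expPoly M - 1 := ⟨_, (X_mul_expDivPoly M).symm⟩
  have key : X ^ (M + 1) ∣ (X * logDivPoly M).comp (expPoly M - 1) - X := by
    refine X_pow_succ_dvd_of_derivative ?_ ?_
    · have h1 : X ∣ (X * logDivPoly M).comp (expPoly M - 1) - X := by
        rw [mul_comp, X_comp]
        exact dvd_sub (hX.mul_right _) dvd_rfl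
      exact X_dvd_iff.1 h1
    · rw [derivative_sub, derivative_comp, derivative_X_mul_logDivPoly, derivative_X,
        derivative_sub, derivative_one, sub_zero, derivative_expPoly]
      have h2 := one_add_mul_geom_neg (expPoly M - 1) M
      rw [add_sub_cancel] at h2
      simp only [Polynomial.sum_comp, pow_comp, neg_comp, X_comp]
      rw [sub_mul, h2]
      have h3 : X ^ M ∣ (-(expPoly M - 1)) ^ M := pow_dvd_pow_of_dvd (hX.neg_right) M
      have h4 : X ^ M ∣ C ((M ! : ℝ)⁻¹) * X ^ M *
          ∑ i ∈ Finset.range M, (-(expPoly M - 1)) ^ i := (dvd_mul_left _ _).mul_right _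
      convert dvd_sub (h3.neg_right) h4 using 1
      ring
  rw [mul_comp, X_comp, ← X_mul_expDivPoly] at key
  have h5 : X ^ (M + 1) ∣ X *
      ((logDivPoly M).comp (X * expDivPoly M) * expDivPoly M - 1) := by
    convert key using 1
    ring
  rw [pow_succ'] at h5
  rw [← X_mul_expDivPoly]
  exact (mul_dvd_mul_iff_left X_ne_zero).1 h5

/-- The truncated form of `exp (log (1 + X)) = 1 + X`. -/
lemma X_pow_dvd_exp_comp_log (M : ℕ) :
    X ^ (M + 1) ∣ (expPoly M).comp (X * logDivPoly M) - (1 + X) := by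
  set G := (expPoly M).comp (X * logDivPoly M) - (1 + X) with hG
  have hX : X ∣ X * logDivPoly M := dvd_mul_right _ _
  have h0 : G.coeff 0 = 0 := by
    have : X ∣ (expPoly M - 1).comp (X * logDivPoly M) - X := by
      rw [← X_mul_expDivPoly, mul_comp, X_comp]
      exact dvd_sub (hX.mul_right _) dvd_rfl
    have h1 := X_dvd_iff.1 this
    rw [sub_comp, one_comp] at h1
    rw [hG, ← sub_sub]
    exact h1
  have hd : X ^ M ∣ (1 + X) * derivative G - G := by
    rw [hG, derivative_sub, derivative_comp, derivative_expPoly, derivative_X_mul_logDivPoly,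
      derivative_add, derivative_X, derivative_one, zero_add]
    have h2 := one_add_mul_geom_neg (X : ℝ[X]) M
    have h3 : X ^ M ∣ (-X : ℝ[X]) ^ M := pow_dvd_pow_of_dvd (dvd_rfl.neg_right) M
    have h4 : X ^ M ∣ (C ((M ! : ℝ)⁻¹) * X ^ M).comp (X * logDivPoly M) := by
      rw [mul_comp, pow_comp, X_comp]
      exact (pow_dvd_pow_of_dvd hX M).mul_left _
    have h5 := dvd_add (h3.mul_right ((expPoly M).comp (X * logDivPoly M)))
      (h4.mul_right (1 - (-X) ^ M))
    rw [← dvd_neg] at h5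
    convert h5 using 1
    rw [sub_comp]
    linear_combination ((expPoly M).comp (X * logDivPoly M) -
      (C ((M ! : ℝ)⁻¹) * X ^ M).comp (X * logDivPoly M)) * h2
  have hind : ∀ j ≤ M, X ^ (j + 1) ∣ G := by
    intro j
    induction j with
    | zero => intro _; simpa using X_dvd_iff.2 h0
    | succ j ih =>
      intro hj
      refine X_pow_succ_dvd_of_derivative h0 ?_
      have h6 : X ^ (j + 1) ∣ (1 + X) * derivative G := by
        have := dvd_add ((pow_dvd_pow X hj).trans hd) (ih (by omega))
        simpa using this
      have hc : IsCoprime ((X : ℝ[X]) ^ (j + 1)) (1 + X) :=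
        IsCoprime.pow_left ⟨-1, 1, by ring⟩
      exact hc.dvd_of_dvd_mul_left h6
  exact hind M le_rfl

end Truncated

section NilpotentSeries

open Polynomial

variable {B : Type*} [Ring B] [Algebra ℝ B]

/-- The logarithm `log (1 + v)` of a nilpotent `v`, to order `M`. -/
def logSum (M : ℕ) (v : B) : B :=
  ∑ k ∈ Finset.range M, ((-1) ^ k / (k + 1 : ℝ)) • v ^ (k + 1)

lemma aeval_expPoly (M : ℕ) (w : B) :
    aeval w (expPoly M) = ∑ k ∈ Finset.range (M + 1), (k ! : ℝ)⁻¹ • w ^ k := by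
  simp [expPoly, Algebra.smul_def]

lemma aeval_expDivPoly (M : ℕ) (w : B) :
    aeval w (expDivPoly M) = ∑ k ∈ Finset.range M, ((k + 1)! : ℝ)⁻¹ • w ^ k := by
  simp [expDivPoly, Algebra.smul_def]

lemma aeval_logDivPoly (M : ℕ) (w : B) :
    aeval w (logDivPoly M) = ∑ k ∈ Finset.range M, ((-1) ^ k / (k + 1 : ℝ)) • w ^ k := by
  simp only [logDivPoly, Algebra.smul_def, map_sum, map_mul, aeval_C, aeval_X, map_pow]

lemma aeval_eq_of_X_pow_dvd {p q : ℝ[X]} {M : ℕ} (h : X ^ M ∣ p - q) {w : B} (hw : w ^ M = 0) :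
    aeval w p = aeval w q := by
  obtain ⟨r, hr⟩ := h
  have := congrArg (aeval w) hr
  rwa [map_sub, map_mul, map_pow, aeval_X, hw, zero_mul, sub_eq_zero] at this

/-- `log u / (u - 1) * ((exp w - 1) / w) = 1` for `u = exp w`. -/
lemma logDiv_mul_expDiv {M : ℕ} {w u : B} (hw : w ^ M = 0)
    (hu : u = ∑ k ∈ Finset.range (M + 1), (k ! : ℝ)⁻¹ • w ^ k) :
    (∑ k ∈ Finset.range M, ((-1) ^ k / (k + 1 : ℝ)) • (u - 1) ^ k) *
      ∑ k ∈ Finset.range M, ((k + 1)! : ℝ)⁻¹ • w ^ k = 1 := by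
  have h := aeval_eq_of_X_pow_dvd (X_pow_dvd_logDiv_comp_mul_expDiv M) hw
  rw [map_mul, aeval_comp, map_sub, aeval_expPoly, ← hu, map_one, aeval_logDivPoly,
    aeval_expDivPoly] at h
  exact h

lemma mul_expDiv {M : ℕ} {w u : B}
    (hu : u = ∑ k ∈ Finset.range (M + 1), (k ! : ℝ)⁻¹ • w ^ k) :
    w * ∑ k ∈ Finset.range M, ((k + 1)! : ℝ)⁻¹ • w ^ k = u - 1 := by
  have h := congrArg (aeval w) (X_mul_expDivPoly M)
  rw [map_mul, map_sub, aeval_X, aeval_expPoly, ← hu, map_one, aeval_expDivPoly] at h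
  exact h

/-- `log (exp w) = w`. -/
lemma logSum_exp_sub_one {M : ℕ} {w u : B} (hw : w ^ M = 0)
    (hu : u = ∑ k ∈ Finset.range (M + 1), (k ! : ℝ)⁻¹ • w ^ k) :
    logSum M (u - 1) = w := by
  have h1 : logSum M (u - 1) =
      (∑ k ∈ Finset.range M, ((-1) ^ k / (k + 1 : ℝ)) • (u - 1) ^ k) * (u - 1) := by
    rw [logSum, Finset.sum_mul]
    exact Finset.sum_congr rfl fun k _ => by rw [pow_succ, smul_mul_assoc]
  have hc : Commute w (∑ k ∈ Finset.range M, ((k + 1)! : ℝ)⁻¹ • w ^ k) :=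
    Commute.sum_right _ _ _ fun k _ => ((Commute.refl w).pow_right k).smul_right _
  have h2 : u - 1 = (∑ k ∈ Finset.range M, ((k + 1)! : ℝ)⁻¹ • w ^ k) * w := by
    rw [← hc.eq, mul_expDiv hu]
  rw [h1]
  conv_lhs => enter [2]; rw [h2]
  rw [← mul_assoc, logDiv_mul_expDiv hw hu, one_mul]

/-- `exp (log (1 + v)) = 1 + v`. -/
lemma exp_logSum {M : ℕ} {v : B} (hv : v ^ (M + 1) = 0) :
    ∑ k ∈ Finset.range (M + 1), (k ! : ℝ)⁻¹ • (logSum M v) ^ k = 1 + v := by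
  have h := aeval_eq_of_X_pow_dvd (X_pow_dvd_exp_comp_log M) hv
  rw [aeval_comp, map_mul, aeval_X, aeval_logDivPoly, aeval_expPoly, map_add, map_one,
    aeval_X] at h
  rw [← h]
  congr 1
  ext k
  congr 2
  rw [logSum, Finset.mul_sum]
  exact Finset.sum_congr rfl fun k _ => by rw [pow_succ', mul_smul_comm]

end NilpotentSeries

/-! ### The differential of the exponential map -/

section DExp

open NormedSpace

attribute [local instance 100] LieRing.ofAssociativeRing

variable {A : Type*} [NormedRing A] [NormedAlgebra ℝ A]

lemma exp_eq_sum_of_pow_eq_zero {w : A} {M : ℕ} (hw : w ^ M = 0) :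
    exp w = ∑ k ∈ Finset.range M, (k ! : ℝ)⁻¹ • w ^ k := by
  rw [exp_eq_tsum ℝ]
  refine tsum_eq_sum fun k hk => ?_
  rw [Finset.mem_range, not_lt] at hk
  rw [pow_eq_zero_of_le hk hw, smul_zero]

section

variable [CompleteSpace A]

lemma exp_mul_exp_neg (a : A) : exp a * exp (-a) = 1 := by
  let : NormedAlgebra ℚ A := NormedAlgebra.restrictScalars ℚ ℝ A
  rw [← exp_add_of_commute (Commute.neg_right (Commute.refl a)), add_neg_cancel, exp_zero]

lemma exp_neg_mul_exp (a : A) : exp (-a) * exp a = 1 := by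
  simpa using exp_mul_exp_neg (-a)

lemma contDiff_exp : ContDiff ℝ ∞ (exp : A → A) :=
  contDiff_iff_contDiffAt.2 fun x => (exp_analytic (𝕂 := ℝ) x).contDiffAt

lemma hasFDerivAt_exp (W : A) : HasFDerivAt (exp : A → A) (fderiv ℝ exp W) W :=
  (contDiff_exp.differentiable (by simp) W).hasFDerivAt

end

lemma hasDerivAt_eq_of_deriv_eq_zero {E : Type*} [NormedAddCommGroup E] [NormedSpace ℝ E]
    {f : ℝ → E} (hf : ∀ s, HasDerivAt f 0 s) (s t : ℝ) : f s = f t :=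
  is_const_of_deriv_eq_zero (fun s => (hf s).differentiableAt) (fun s => (hf s).deriv) s t

lemma hasDerivAt_pow_div_factorial (k : ℕ) (s : ℝ) :
    HasDerivAt (fun s : ℝ => s ^ (k + 1) * ((k + 1)! : ℝ)⁻¹) (s ^ k * (k ! : ℝ)⁻¹) s := by
  refine ((hasDerivAt_pow (k + 1) s).mul_const ((k + 1)! : ℝ)⁻¹).congr_deriv ?_
  rw [Nat.add_sub_cancel, Nat.factorial_succ]
  push_cast
  field_simp

variable (Z V : A)

/-- The series `exp (-s ad Z) V`, to order `K`. -/
def conjSum (K : ℕ) (s : ℝ) : A :=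
  ∑ k ∈ Finset.range K, (s ^ k * (k ! : ℝ)⁻¹) • (-1 : ℝ) ^ k • (LieAlgebra.ad ℝ A Z ^ k) V

variable {Z V}

lemma hasDerivAt_conjSum {K : ℕ} (hK : (LieAlgebra.ad ℝ A Z ^ K) V = 0) (s : ℝ) :
    HasDerivAt (conjSum Z V K) (-⁅Z, conjSum Z V K s⁆) s := by
  cases K with
  | zero =>
    have h0 : conjSum Z V 0 = fun _ => 0 := funext fun s => Finset.sum_range_zero _
    rw [h0, lie_zero, neg_zero]
    exact hasDerivAt_const s (0 : A)
  | succ K =>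
    have h1 : conjSum Z V (K + 1) = fun s => (∑ k ∈ Finset.range K,
        (s ^ (k + 1) * ((k + 1)! : ℝ)⁻¹) • (-1 : ℝ) ^ (k + 1) • (LieAlgebra.ad ℝ A Z ^ (k + 1)) V)
          + V := by
      funext s
      rw [conjSum, Finset.sum_range_succ']
      simp
    rw [h1]
    have h2 : -⁅Z, conjSum Z V (K + 1) s⁆ = ∑ k ∈ Finset.range K,
        (s ^ k * (k ! : ℝ)⁻¹) • (-1 : ℝ) ^ (k + 1) • (LieAlgebra.ad ℝ A Z ^ (k + 1)) V := by
      rw [conjSum, ← LieAlgebra.ad_apply (R := ℝ), map_sum, Finset.sum_range_succ]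
      simp only [map_smul]
      have hz : (LieAlgebra.ad ℝ A Z) ((LieAlgebra.ad ℝ A Z ^ K) V) = 0 := by
        rw [← hK, pow_succ']; rfl
      rw [hz, smul_zero, smul_zero, neg_add, neg_zero, add_zero, ← Finset.sum_neg_distrib]
      refine Finset.sum_congr rfl fun k _ => ?_
      rw [pow_succ' (LieAlgebra.ad ℝ A Z), Module.End.mul_apply, pow_succ (-1 : ℝ)]
      simp
    have h3 := (HasDerivAt.fun_sum (u := Finset.range K) fun k _ =>
      (hasDerivAt_pow_div_factorial k s).smul_const
        ((-1 : ℝ) ^ (k + 1) • (LieAlgebra.ad ℝ A Z ^ (k + 1)) V)).add_const V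
    rw [← h1, h2]
    rw [h1]
    exact h3

variable [CompleteSpace A]

/-- `exp (-s Z) V exp (s Z) = exp (-s ad Z) V`. -/
lemma exp_mul_conjSum {K : ℕ} (hK : (LieAlgebra.ad ℝ A Z ^ K) V = 0) (s : ℝ) :
    conjSum Z V K s = exp (s • (-Z)) * V * exp (s • Z) := by
  have h : ∀ s, HasDerivAt (fun s => exp (s • Z) * conjSum Z V K s * exp (s • (-Z))) 0 s := by
    intro s
    have := ((hasDerivAt_exp_smul_const (𝕂 := ℝ) Z s).mul (hasDerivAt_conjSum hK s)).mul
      (hasDerivAt_exp_smul_const' (𝕂 := ℝ) (-Z) s)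
    refine this.congr_deriv ?_
    rw [Ring.lie_def, Pi.mul_apply]
    noncomm_ring
  have h1 := hasDerivAt_eq_of_deriv_eq_zero h s 0
  have h0 : conjSum Z V K 0 = V := by
    cases K with
    | zero => simpa [conjSum] using hK.symm
    | succ K => rw [conjSum, Finset.sum_range_succ']; simp
  simp only [zero_smul, exp_zero, one_mul, mul_one, h0] at h1
  have e2 : exp (s • -Z) * exp (s • Z) = 1 := by rw [smul_neg]; exact exp_neg_mul_exp _
  calc conjSum Z V K s = (exp (s • -Z) * exp (s • Z)) * conjSum Z V K s *
      (exp (s • -Z) * exp (s • Z)) := by rw [e2, one_mul, mul_one]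
    _ = exp (s • -Z) * (exp (s • Z) * conjSum Z V K s * exp (s • -Z)) * exp (s • Z) := by
      simp only [mul_assoc]
    _ = _ := by rw [h1]

/-- The conjugate of `V` by `exp Z`, as a series in `ad Z`. -/
lemma exp_conj {K : ℕ} (hK : (LieAlgebra.ad ℝ A Z ^ K) V = 0) :
    exp Z * V * exp (-Z) =
      ∑ k ∈ Finset.range K, (k ! : ℝ)⁻¹ • (LieAlgebra.ad ℝ A Z ^ k) V := by
  have h := exp_mul_conjSum hK (-1)
  rw [neg_one_smul, neg_neg, neg_one_smul] at h
  rw [← h, conjSum]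
  refine Finset.sum_congr rfl fun k _ => ?_
  rw [smul_smul, mul_right_comm, ← mul_pow]
  simp

/-- The differential of the exponential map: `d exp_Z (V) = exp Z ((1 - exp (-ad Z)) / ad Z) V`. -/
lemma fderiv_exp_apply {K : ℕ} (hK : (LieAlgebra.ad ℝ A Z ^ K) V = 0) :
    fderiv ℝ (exp : A → A) Z V = exp Z *
      ∑ k ∈ Finset.range K, ((-1) ^ k * ((k + 1)! : ℝ)⁻¹) • (LieAlgebra.ad ℝ A Z ^ k) V := by
  let : NormedAlgebra ℚ A := NormedAlgebra.restrictScalars ℚ ℝ A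
  -- `P s` is the derivative at `t = 0` of `exp (s (Z + t V))`.
  let P : ℝ → A := fun s => s • fderiv ℝ exp (s • Z) V
  have hP : ∀ s, HasDerivAt (fun t : ℝ => exp (s • (Z + t • V))) (P s) 0 := by
    intro s
    have h1 : HasDerivAt (fun t : ℝ => s • (Z + t • V)) (s • V) 0 := by
      have := (((hasDerivAt_id (0 : ℝ)).smul_const V).const_add Z).const_smul s
      rw [one_smul] at this
      exact this
    have h2 := (hasFDerivAt_exp (s • (Z + (0 : ℝ) • V))).comp_hasDerivAt (0 : ℝ) h1
    simpa [P, Function.comp_def] using h2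
  have hadd : ∀ s r, P (s + r) = P r * exp (s • Z) + exp (r • Z) * P s := by
    intro s r
    have h1 := (hP r).mul (hP s)
    have h2 : ((fun t : ℝ => exp (r • (Z + t • V))) * fun t : ℝ => exp (s • (Z + t • V))) =
        fun t : ℝ => exp ((s + r) • (Z + t • V)) := by
      funext t
      rw [Pi.mul_apply, add_comm s r, add_smul, exp_add_of_commute]
      exact ((Commute.refl (Z + t • V)).smul_left r).smul_right s
    rw [h2] at h1
    simpa using (hP (s + r)).unique h1
  have hP0 : HasDerivAt P V 0 := by
    have hc : Continuous fun s : ℝ => fderiv ℝ (exp : A → A) (s • Z) V :=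
      ((contDiff_exp.continuous_fderiv (by simp)).comp
        (continuous_id.smul continuous_const)).clm_apply continuous_const
    have h0 : fderiv ℝ (exp : A → A) ((0 : ℝ) • Z) V = V := by
      rw [zero_smul, (hasFDerivAt_exp_zero (𝕂 := ℝ)).fderiv]
      rfl
    rw [hasDerivAt_iff_tendsto_slope]
    refine ((hc.tendsto 0).mono_left nhdsWithin_le_nhds).congr' ?_ |>.trans (by rw [h0])
    filter_upwards [self_mem_nhdsWithin] with s hs
    simp only [slope, P, vsub_eq_sub, sub_zero, zero_smul, smul_smul]
    rw [inv_mul_cancel₀ hs, one_smul]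
  have hPs : ∀ s, HasDerivAt P (V * exp (s • Z) + Z * P s) s := by
    intro s
    have h1 : HasDerivAt (fun r => P (s + r)) (V * exp (s • Z) + Z * P s) 0 := by
      simp only [hadd]
      have h2 := hasDerivAt_exp_smul_const (𝕂 := ℝ) Z 0
      rw [zero_smul, exp_zero, one_mul] at h2
      exact (hP0.mul_const _).add (h2.mul_const _)
    have h3 := HasDerivAt.comp_sub_const (f := fun r => P (s + r)) s s (by simpa using h1)
    simpa using h3
  let Q : ℝ → A := fun s => ∑ k ∈ Finset.range K,
    (s ^ (k + 1) * ((k + 1)! : ℝ)⁻¹) • (-1 : ℝ) ^ k • (LieAlgebra.ad ℝ A Z ^ k) V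
  have hQ : ∀ s, HasDerivAt Q (conjSum Z V K s) s := fun s =>
    HasDerivAt.fun_sum fun k _ => (hasDerivAt_pow_div_factorial k s).smul_const _
  have hR : ∀ s, HasDerivAt (fun s => exp (s • (-Z)) * P s - Q s) 0 s := by
    intro s
    have h1 := ((hasDerivAt_exp_smul_const (𝕂 := ℝ) (-Z) s).mul (hPs s)).sub (hQ s)
    refine h1.congr_deriv ?_
    rw [exp_mul_conjSum hK]
    noncomm_ring
  have h1 := hasDerivAt_eq_of_deriv_eq_zero hR 1 0
  have hQ1 : Q 1 = ∑ k ∈ Finset.range K,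
      ((-1) ^ k * ((k + 1)! : ℝ)⁻¹) • (LieAlgebra.ad ℝ A Z ^ k) V :=
    Finset.sum_congr rfl fun k _ => by rw [one_pow, one_mul, smul_smul, mul_comm]
  have hQ0 : Q 0 = 0 := Finset.sum_eq_zero fun k _ => by simp
  simp only [P, one_smul, zero_smul, mul_zero, hQ0, sub_zero, sub_eq_zero] at h1
  rw [← hQ1, ← h1, ← mul_assoc, exp_mul_exp_neg, one_mul]

/-- The differential of the exponential map: `d exp_Z (V) = ((exp (ad Z) - 1) / ad Z) V exp Z`. -/
lemma fderiv_exp_apply' {K : ℕ} (hK : (LieAlgebra.ad ℝ A Z ^ K) V = 0) :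
    fderiv ℝ (exp : A → A) Z V =
      (∑ k ∈ Finset.range K, ((k + 1)! : ℝ)⁻¹ • (LieAlgebra.ad ℝ A Z ^ k) V) * exp Z := by
  have hpow : ∀ k, (LieAlgebra.ad ℝ A (-Z) ^ k) V = (-1 : ℝ) ^ k • (LieAlgebra.ad ℝ A Z ^ k) V := by
    intro k
    rw [map_neg, ← neg_one_smul ℝ (LieAlgebra.ad ℝ A Z), smul_pow]
    rfl
  have h1 := (hasFDerivAt_exp Z).mul' ((hasFDerivAt_exp (-Z)).comp Z (hasFDerivAt_id Z).neg)
  have h2 : ((exp : A → A) * (exp ∘ fun z : A => -z)) = fun _ => (1 : A) :=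
    funext fun z => exp_mul_exp_neg z
  have h3 := congrArg (fun T : A →L[ℝ] A => T V)
    ((h2 ▸ h1).unique (hasFDerivAt_const (1 : A) Z))
  have h4 : exp Z * -(fderiv ℝ (exp : A → A) (-Z) V) + fderiv ℝ (exp : A → A) Z V * exp (-Z) = 0 := by
    simpa using h3
  rw [fderiv_exp_apply (Z := -Z) (K := K) (by rw [hpow, hK, smul_zero]), ← mul_neg, ← mul_assoc,
    exp_mul_exp_neg, one_mul, neg_add_eq_zero] at h4
  have h5 : fderiv ℝ (exp : A → A) Z V = fderiv ℝ (exp : A → A) Z V * exp (-Z) * exp Z := by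
    rw [mul_assoc, exp_neg_mul_exp, mul_one]
  rw [h5, ← h4]
  congr 1
  refine Finset.sum_congr rfl fun k _ => ?_
  rw [hpow, smul_smul, mul_right_comm, ← mul_pow]
  simp

end DExp

/-! ### Power series in the adjoint action -/

section AdSeries

variable {L : Type*} [LieRing L] [LieAlgebra ℝ L]

/-- The endomorphism `∑ cₖ (ad x)ᵏ` of a nilpotent Lie algebra. -/
def adSeries (c : ℕ → ℝ) (x : L) : Module.End ℝ L := ∑ᶠ k, c k • LieAlgebra.ad ℝ L x ^ k

/-- The automorphism `exp (ad x)`. -/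
abbrev expAd (x : L) : Module.End ℝ L := adSeries (fun k => (k ! : ℝ)⁻¹) x

/-- The endomorphism `(1 - exp (-ad x)) / ad x`. -/
abbrev dexpAd (x : L) : Module.End ℝ L := adSeries (fun k => (-1) ^ k * ((k + 1)! : ℝ)⁻¹) x

lemma adSeries_eq_sum (c : ℕ → ℝ) {x : L} {K : ℕ} (hK : LieAlgebra.ad ℝ L x ^ K = 0) :
    adSeries c x = ∑ k ∈ Finset.range K, c k • LieAlgebra.ad ℝ L x ^ k := by
  refine finsum_eq_sum_of_support_subset _ fun k hk => ?_
  rw [Finset.coe_range, Set.mem_Iio]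
  by_contra h
  exact hk (by simp only [pow_eq_zero_of_le (not_lt.1 h) hK, smul_zero])

variable (L) in
lemma exists_ad_pow_eq_zero [LieRing.IsNilpotent L] :
    ∃ K : ℕ, ∀ x : L, LieAlgebra.ad ℝ L x ^ K = 0 :=
  LieModule.exists_forall_pow_toEnd_eq_zero ℝ L L

lemma adSeries_apply (c : ℕ → ℝ) {x : L} {K : ℕ} (hK : LieAlgebra.ad ℝ L x ^ K = 0) (v : L) :
    adSeries c x v = ∑ k ∈ Finset.range K, c k • (LieAlgebra.ad ℝ L x ^ k) v := by
  rw [adSeries_eq_sum c hK]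
  simp [LinearMap.sum_apply]

lemma adSeries_zero (c : ℕ → ℝ) (v : L) : adSeries c (0 : L) v = c 0 • v := by
  rw [adSeries_apply c (K := 1) (by simp)]
  simp

lemma map_ad_pow {L' : Type*} [LieRing L'] [LieAlgebra ℝ L'] (f : L →ₗ⁅ℝ⁆ L') (x v : L) (k : ℕ) :
    f ((LieAlgebra.ad ℝ L x ^ k) v) = (LieAlgebra.ad ℝ L' (f x) ^ k) (f v) := by
  induction k with
  | zero => rfl
  | succ k ih =>
    rw [pow_succ', pow_succ', Module.End.mul_apply, Module.End.mul_apply, ← ih]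
    exact f.map_lie _ _

lemma map_adSeries {L' : Type*} [LieRing L'] [LieAlgebra ℝ L'] [LieRing.IsNilpotent L]
    [LieRing.IsNilpotent L'] (f : L →ₗ⁅ℝ⁆ L') (c : ℕ → ℝ) (x v : L) :
    f (adSeries c x v) = adSeries c (f x) (f v) := by
  obtain ⟨K, hK⟩ := exists_ad_pow_eq_zero L
  obtain ⟨K', hK'⟩ := exists_ad_pow_eq_zero L'
  rw [adSeries_apply c (pow_eq_zero_of_le (le_max_left K K') (hK x)),
    adSeries_apply c (pow_eq_zero_of_le (le_max_right K K') (hK' (f x))), map_sum]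
  exact Finset.sum_congr rfl fun k _ => by rw [map_smul, map_ad_pow]

end AdSeries

/-! ### Summation of the Dynkin series -/

section Dynkin

variable {L : Type*} [LieRing L] [LieAlgebra ℝ L]

/-- The pairs `(r, s) ≠ (0, 0)` with `r, s ≤ N`. -/
def dynkinPairs (N : ℕ) : Finset (ℕ × ℕ) :=
  (Finset.range (N + 1) ×ˢ Finset.range (N + 1)).erase (0, 0)

/-- The lists of `k` pairs `(r, s) ≠ (0, 0)` with `r, s ≤ N`. -/
def dynkinLists (N : ℕ) : ℕ → Finset (List (ℕ × ℕ))
  | 0 => {[]}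
  | k + 1 => (dynkinPairs N ×ˢ dynkinLists N k).image fun q => q.1 :: q.2

/-- The nonempty lists of at most `N` pairs `(r, s) ≠ (0, 0)` with `r, s ≤ N`. -/
def dynkinFinset (N : ℕ) : Finset (List (ℕ × ℕ)) :=
  (Finset.range N).biUnion fun k => dynkinLists N (k + 1)

lemma mem_dynkinPairs {N : ℕ} {q : ℕ × ℕ} :
    q ∈ dynkinPairs N ↔ q ≠ (0, 0) ∧ q.1 ≤ N ∧ q.2 ≤ N := by
  simp [dynkinPairs]

lemma mem_dynkinLists {N k : ℕ} {l : List (ℕ × ℕ)} :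
    l ∈ dynkinLists N k ↔ l.length = k ∧ ∀ q ∈ l, q ∈ dynkinPairs N := by
  induction k generalizing l with
  | zero =>
    rw [dynkinLists, Finset.mem_singleton, List.length_eq_zero_iff]
    exact ⟨fun h => ⟨h, by simp [h]⟩, fun h => h.1⟩
  | succ k ih =>
    simp only [dynkinLists, Finset.mem_image, Finset.mem_product]
    constructor
    · rintro ⟨⟨a, b⟩, ⟨h1, h2⟩, rfl⟩
      obtain ⟨h3, h4⟩ := ih.1 h2
      exact ⟨by simp [h3], List.forall_mem_cons.2 ⟨h1, h4⟩⟩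
    · rintro ⟨h1, h2⟩
      cases l with
      | nil => simp at h1
      | cons a l =>
        exact ⟨(a, l), ⟨h2 a (by simp), ih.2 ⟨by simpa using h1,
          fun q hq => h2 q (List.mem_cons_of_mem _ hq)⟩⟩, rfl⟩

lemma sum_dynkinLists_succ {M : Type*} [AddCommMonoid M] (N k : ℕ) (g : List (ℕ × ℕ) → M) :
    ∑ l ∈ dynkinLists N (k + 1), g l = ∑ q ∈ dynkinPairs N, ∑ l ∈ dynkinLists N k, g (q :: l) := by
  rw [dynkinLists, Finset.sum_image (by
    rintro ⟨a, b⟩ _ ⟨c, d⟩ _ h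
    simpa using h), Finset.sum_product]

lemma sum_dynkinFinset {M : Type*} [AddCommMonoid M] (N : ℕ) (g : List (ℕ × ℕ) → M) :
    ∑ l ∈ dynkinFinset N, g l = ∑ k ∈ Finset.range N, ∑ l ∈ dynkinLists N (k + 1), g l := by
  refine Finset.sum_biUnion fun i _ j _ hij => Finset.disjoint_left.2 fun l h1 h2 => hij ?_
  have := (mem_dynkinLists.1 h1).1.symm.trans (mem_dynkinLists.1 h2).1
  omega

lemma dynkinFinset_subset (N : ℕ) : ↑(dynkinFinset N) ⊆ dynkinIndex := by
  intro l hl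
  obtain ⟨k, -, h⟩ := Finset.mem_biUnion.1 (Finset.mem_coe.1 hl)
  obtain ⟨h1, h2⟩ := mem_dynkinLists.1 h
  refine ⟨fun h => by simp [h] at h1, fun q hq => (mem_dynkinPairs.1 (h2 q hq)).1⟩

lemma one_le_sum_of_mem {l : List (ℕ × ℕ)} (hl : l ∈ dynkinIndex) :
    l.length ≤ (l.map fun rs => rs.1 + rs.2).sum := by
  have := List.length_le_sum_of_one_le (l.map fun rs : ℕ × ℕ => rs.1 + rs.2) (by
    intro i hi
    obtain ⟨⟨a, b⟩, hrs, rfl⟩ := List.mem_map.1 hi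
    have := hl.2 _ hrs
    simp only [ne_eq, Prod.mk.injEq, not_and] at this
    simp only
    omega)
  simpa using this

lemma nestedBracket_eq_zero_of_notMem {N : ℕ} (hN : LieModule.lowerCentralSeries ℝ L L N = ⊥)
    (x y : L) {l : List (ℕ × ℕ)} (hl : l ∈ dynkinIndex) (hlN : l ∉ dynkinFinset N) :
    nestedBracket (dynkinWord x y l) = 0 := by
  have h : N + 1 ≤ (dynkinWord x y l).length := by
    rw [length_dynkinWord]
    by_contra hc
    have h1 := one_le_sum_of_mem hl
    have h2 : 1 ≤ l.length := List.length_pos_iff.2 hl.1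
    refine hlN (Finset.mem_biUnion.2 ⟨l.length - 1, Finset.mem_range.2 (by omega),
      mem_dynkinLists.2 ⟨by omega, fun q hq => mem_dynkinPairs.2 ⟨hl.2 q hq, ?_⟩⟩⟩)
    have h3 : q.1 + q.2 ≤ (l.map fun rs => rs.1 + rs.2).sum :=
      List.le_sum_of_mem (List.mem_map.2 ⟨q, hq, rfl⟩)
    omega
  have := nestedBracket_mem _ N h
  rwa [hN, LieSubmodule.mem_bot] at this

lemma bch_eq_sum_dynkinFinset {N : ℕ} (hN : LieModule.lowerCentralSeries ℝ L L N = ⊥) (x y : L) :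
    bch x y = ∑ l ∈ dynkinFinset N, dynkinCoeff l • nestedBracket (dynkinWord x y l) :=
  bch_eq_sum (dynkinFinset_subset N) x y fun _ h1 h2 => nestedBracket_eq_zero_of_notMem hN x y h1 h2

lemma nestedBracket_cons {T : Type*} [LieRing T] (a : T) {l : List T} (hl : l ≠ []) :
    nestedBracket (a :: l) = ⁅a, nestedBracket l⁆ := by
  cases l with
  | nil => exact absurd rfl hl
  | cons b l => rfl

lemma nestedBracket_replicate_append (r : ℕ) (a : L) {l : List L} (hl : l ≠ []) :
    nestedBracket (List.replicate r a ++ l) = (LieAlgebra.ad ℝ L a ^ r) (nestedBracket l) := by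
  induction r with
  | zero => simp
  | succ r ih =>
    rw [List.replicate_succ, List.cons_append, nestedBracket_cons a (by simp [hl]), ih, pow_succ']
    rfl

lemma nestedBracket_replicate {T : Type*} [LieRing T] (r : ℕ) (a : T) :
    nestedBracket (List.replicate r a) = if r = 1 then a else 0 := by
  induction r with
  | zero => simp [nestedBracket]
  | succ r ih =>
    cases r with
    | zero => simp [nestedBracket]
    | succ r =>
      rw [List.replicate_succ, nestedBracket_cons a (by simp), ih]
      split_ifs <;> first | omega | simp

lemma dynkinWord_ne_nil {T : Type*} (x y : T) {l : List (ℕ × ℕ)} (hl : l ∈ dynkinIndex) :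
    dynkinWord x y l ≠ [] := by
  intro h
  have h1 := length_dynkinWord x y l
  have h2 := one_le_sum_of_mem hl
  have h3 : 1 ≤ l.length := List.length_pos_iff.2 hl.1
  rw [h, List.length_nil] at h1
  omega

variable (x y : L)

/-- The part of the series with `k + 1` pairs, without the coefficient depending on the total
degree. -/
def dynkinTerm (N k : ℕ) : L :=
  ∑ l ∈ dynkinLists N (k + 1),
    (((l.map fun rs => rs.1 ! * rs.2 !).prod : ℕ) : ℝ)⁻¹ • nestedBracket (dynkinWord x y l)

lemma expAd_mul_expAd {N : ℕ} (hN : ∀ z : L, LieAlgebra.ad ℝ L z ^ (N + 1) = 0) :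
    expAd x * expAd y - 1 = ∑ q ∈ dynkinPairs N, ((q.1 ! * q.2 ! : ℕ) : ℝ)⁻¹ •
      (LieAlgebra.ad ℝ L x ^ q.1 * LieAlgebra.ad ℝ L y ^ q.2) := by
  rw [dynkinPairs, Finset.sum_erase_eq_sub (by simp), expAd, expAd, adSeries_eq_sum _ (hN x),
    adSeries_eq_sum _ (hN y), Finset.sum_mul_sum, Finset.sum_product]
  congr 1
  · refine Finset.sum_congr rfl fun i _ => Finset.sum_congr rfl fun j _ => ?_
    rw [smul_mul_smul_comm, Nat.cast_mul, mul_inv]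
  · simp

/-- Prepending all possible pairs `(r, s)` to the words is an application of `e^(ad x) e^(ad y) - 1`
to the sum of their brackets. -/
lemma dynkinTerm_succ {N : ℕ} (hN : ∀ z : L, LieAlgebra.ad ℝ L z ^ (N + 1) = 0) (k : ℕ) :
    dynkinTerm x y N (k + 1) = (expAd x * expAd y - 1) (dynkinTerm x y N k) := by
  rw [dynkinTerm, sum_dynkinLists_succ, expAd_mul_expAd x y hN, LinearMap.sum_apply]
  refine Finset.sum_congr rfl fun q _ => ?_
  rw [dynkinTerm, map_sum]
  refine Finset.sum_congr rfl fun l hl => ?_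
  have hl' : l ∈ dynkinIndex := by
    obtain ⟨h1, h2⟩ := mem_dynkinLists.1 hl
    exact ⟨fun h => by simp [h] at h1, fun q hq => (mem_dynkinPairs.1 (h2 q hq)).1⟩
  have hne := dynkinWord_ne_nil x y hl'
  have h1 : dynkinWord x y (q :: l) =
      List.replicate q.1 x ++ (List.replicate q.2 y ++ dynkinWord x y l) := by
    simp [dynkinWord]
  rw [h1, nestedBracket_replicate_append _ _ (by simp [hne]),
    nestedBracket_replicate_append _ _ hne, map_smul, LinearMap.smul_apply, smul_smul]
  simp only [List.map_cons, List.prod_cons, Nat.cast_mul, mul_inv, Module.End.mul_apply]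
  rw [mul_comm]

/-- A word `x ⋯ x y ⋯ y` has a nonzero bracket only if it is the letter `x` or contains exactly one
letter `y`. -/
lemma dynkinTerm_zero {N : ℕ} (hN : ∀ z : L, LieAlgebra.ad ℝ L z ^ (N + 1) = 0) (h1 : 1 ≤ N) :
    dynkinTerm x y N 0 = x + expAd x y := by
  have h0 : dynkinTerm x y N 0 = ∑ q ∈ Finset.range (N + 1) ×ˢ Finset.range (N + 1),
      ((q.1 ! * q.2 ! : ℕ) : ℝ)⁻¹ •
        nestedBracket (List.replicate q.1 x ++ List.replicate q.2 y) := by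
    rw [dynkinTerm, sum_dynkinLists_succ]
    simp only [dynkinLists, Finset.sum_singleton]
    rw [dynkinPairs, Finset.sum_erase _ (by simp [dynkinWord, nestedBracket])]
    refine Finset.sum_congr rfl fun q _ => ?_
    simp [dynkinWord]
  rw [h0, Finset.sum_product, expAd, adSeries_apply _ (hN x)]
  have h2 : ∀ r, ∑ s ∈ Finset.range (N + 1), ((r ! * s ! : ℕ) : ℝ)⁻¹ •
      nestedBracket (List.replicate r x ++ List.replicate s y) =
        (if r = 1 then x else 0) + (r ! : ℝ)⁻¹ • (LieAlgebra.ad ℝ L x ^ r) y := by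
    intro r
    rw [Finset.sum_range_succ']
    have h3 : ∀ s, nestedBracket (List.replicate r x ++ List.replicate (s + 1) y) =
        if s = 0 then (LieAlgebra.ad ℝ L x ^ r) y else 0 := by
      intro s
      rw [nestedBracket_replicate_append _ _ (by simp), nestedBracket_replicate]
      split_ifs <;> first | omega | simp
    simp only [h3, smul_ite, smul_zero]
    rw [Finset.sum_ite_eq', if_pos (Finset.mem_range.2 (by omega)), add_comm]
    simp only [List.replicate_zero, List.append_nil, nestedBracket_replicate]
    congr 1
    · split_ifs with h
      · simp [h]
      · simp
    · simp
  rw [Finset.sum_congr rfl fun r _ => h2 r, Finset.sum_add_distrib, Finset.sum_ite_eq',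
    if_pos (Finset.mem_range.2 (by omega))]

/-- The derivative along `t ↦ bch (t x) (t y)` of Dynkin's series, at `t = 1`, in closed form. -/
lemma sum_dynkin_smul_length {N : ℕ} (hN : ∀ z : L, LieAlgebra.ad ℝ L z ^ (N + 1) = 0)
    (h1 : 1 ≤ N) :
    ∑ l ∈ dynkinFinset N, (dynkinCoeff l * (dynkinWord x y l).length) •
        nestedBracket (dynkinWord x y l) =
      ∑ k ∈ Finset.range N, ((-1) ^ k / (k + 1 : ℝ)) •
        ((expAd x * expAd y - 1) ^ k) (x + expAd x y) := by
  have hk : ∀ k, dynkinTerm x y N k = ((expAd x * expAd y - 1) ^ k) (x + expAd x y) := by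
    intro k
    induction k with
    | zero => rw [dynkinTerm_zero x y hN h1]; rfl
    | succ k ih => rw [dynkinTerm_succ x y hN, ih, pow_succ']; rfl
  rw [sum_dynkinFinset]
  refine Finset.sum_congr rfl fun k hkN => ?_
  rw [← hk, dynkinTerm, Finset.smul_sum]
  refine Finset.sum_congr rfl fun l hl => ?_
  rw [smul_smul]
  congr 1
  have hl' : l ∈ dynkinIndex := dynkinFinset_subset N
    (Finset.mem_coe.2 (Finset.mem_biUnion.2 ⟨k, hkN, hl⟩))
  have h3 := one_le_sum_of_mem hl'
  obtain ⟨h4, -⟩ := mem_dynkinLists.1 hl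
  rw [dynkinCoeff, length_dynkinWord, h4, Nat.add_sub_cancel]
  have h5 : (((l.map fun rs => rs.1 + rs.2).sum : ℕ) : ℝ) ≠ 0 := by
    have : (l.map fun rs => rs.1 + rs.2).sum ≠ 0 := by omega
    exact_mod_cast this
  generalize (l.map fun rs => rs.1 + rs.2).sum = S at h5
  generalize (l.map fun rs => rs.1 ! * rs.2 !).prod = P
  push_cast
  field_simp

lemma nestedBracket_map_smul (t : ℝ) (l : List L) (hl : l ≠ []) :
    nestedBracket (l.map fun a => t • a) = t ^ l.length • nestedBracket l := by
  induction l with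
  | nil => exact absurd rfl hl
  | cons a l ih =>
    by_cases h : l = []
    · subst h
      simp [nestedBracket]
    · rw [List.map_cons, nestedBracket_cons _ (by simpa using h), ih h, nestedBracket_cons _ h,
        smul_lie, lie_smul, smul_smul, List.length_cons, pow_succ']

lemma nestedBracket_dynkinWord_smul (t : ℝ) {l : List (ℕ × ℕ)} (hl : l ∈ dynkinIndex) :
    nestedBracket (dynkinWord (t • x) (t • y) l) =
      t ^ (dynkinWord x y l).length • nestedBracket (dynkinWord x y l) := by
  rw [← nestedBracket_map_smul t _ (dynkinWord_ne_nil x y hl)]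
  congr 1
  simp [dynkinWord, List.map_flatMap]

end Dynkin

/-! ### The Campbell-Baker-Hausdorff theorem in an associative algebra -/

section Associative

open NormedSpace

attribute [local instance 100] LieRing.ofAssociativeRing

lemma ad_pow_eq_zero_of_pow_eq_zero {A : Type*} [Ring A] [Algebra ℝ A] {z : A} {M K : ℕ}
    (hz : z ^ M = 0) (hK : 2 * M ≤ K) : LieAlgebra.ad ℝ A z ^ K = 0 := by
  have h : LieAlgebra.ad ℝ A z = LinearMap.mulLeft ℝ z + -LinearMap.mulRight ℝ z := by
    ext v
    simp [Ring.lie_def, sub_eq_add_neg]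
  rw [h]
  refine Commute.add_pow_eq_zero_of_add_le_succ_of_pow_eq_zero (m := M) (n := M) ?_ ?_ ?_
    (by omega)
  · refine Commute.neg_right (LinearMap.ext fun v => ?_)
    simp [mul_assoc]
  · rw [LinearMap.pow_mulLeft, hz, LinearMap.mulLeft_zero_eq_zero]
  · rw [neg_pow, LinearMap.pow_mulRight, hz, LinearMap.mulRight_zero_eq_zero, mul_zero]

variable {A : Type*} [NormedRing A] [NormedAlgebra ℝ A]

lemma exp_sub_one_mem {I : Submodule ℝ A} (hmul : ∀ a ∈ I, ∀ b ∈ I, a * b ∈ I) {M : ℕ}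
    (hM : ∀ a ∈ I, a ^ M = 0) {a : A} (ha : a ∈ I) : exp a - 1 ∈ I := by
  have hpow : ∀ k, a ^ (k + 1) ∈ I := by
    intro k
    induction k with
    | zero => simpa using ha
    | succ k ih => rw [pow_succ]; exact hmul _ ih _ ha
  rw [exp_eq_sum_of_pow_eq_zero (M := M + 1) (by rw [pow_succ, hM a ha, zero_mul]),
    Finset.sum_range_succ']
  simp only [Nat.factorial_zero, Nat.cast_one, inv_one, pow_zero, one_smul, add_sub_cancel_right]
  exact I.sum_mem fun k _ => I.smul_mem _ (hpow k)

lemma exp_mul_exp_sub_one_mem {I : Submodule ℝ A} (hmul : ∀ a ∈ I, ∀ b ∈ I, a * b ∈ I) {M : ℕ}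
    (hM : ∀ a ∈ I, a ^ M = 0) {a b : A} (ha : a ∈ I) (hb : b ∈ I) : exp a * exp b - 1 ∈ I := by
  have h1 := exp_sub_one_mem hmul hM ha
  have h2 := exp_sub_one_mem hmul hM hb
  have : exp a * exp b - 1 = (exp a - 1) * (exp b - 1) + (exp a - 1) + (exp b - 1) := by
    noncomm_ring
  rw [this]
  exact I.add_mem (I.add_mem (hmul _ h1 _ h2) h1) h2

lemma logSum_mem {I : Submodule ℝ A} (hmul : ∀ a ∈ I, ∀ b ∈ I, a * b ∈ I) (M : ℕ) {a : A}
    (ha : a ∈ I) : logSum M a ∈ I := by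
  have hpow : ∀ k, a ^ (k + 1) ∈ I := by
    intro k
    induction k with
    | zero => simpa using ha
    | succ k ih => rw [pow_succ]; exact hmul _ ih _ ha
  exact I.sum_mem fun k _ => I.smul_mem _ (hpow k)

lemma exp_logSum_sub_one {I : Submodule ℝ A} (hmul : ∀ a ∈ I, ∀ b ∈ I, a * b ∈ I) {M : ℕ}
    (hM : ∀ a ∈ I, a ^ M = 0) {w : A} (hw : w - 1 ∈ I) : exp (logSum M (w - 1)) = w := by
  have h1 : (logSum M (w - 1)) ^ (M + 1) = 0 := by
    rw [pow_succ, hM _ (logSum_mem hmul M hw), zero_mul]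
  rw [exp_eq_sum_of_pow_eq_zero h1, exp_logSum (by rw [pow_succ, hM _ hw, zero_mul])]
  abel

/-- The exponential map is injective on nilpotent elements. -/
lemma exp_injOn_nilpotent {M : ℕ} {a b : A} (ha : a ^ M = 0) (hb : b ^ M = 0)
    (h : exp a = exp b) : a = b := by
  rw [← logSum_exp_sub_one ha (exp_eq_sum_of_pow_eq_zero (by rw [pow_succ, ha, zero_mul])),
    ← logSum_exp_sub_one hb (exp_eq_sum_of_pow_eq_zero (by rw [pow_succ, hb, zero_mul])), h]

variable [CompleteSpace A]

lemma coe_expAd (F : LieSubalgebra ℝ A) [LieRing.IsNilpotent F] (x v : F) :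
    ((expAd x v : F) : A) = exp (x : A) * v * exp (-(x : A)) := by
  obtain ⟨K, hK⟩ := exists_ad_pow_eq_zero F
  have h : ∀ k, (((LieAlgebra.ad ℝ F x ^ k) v : F) : A) = (LieAlgebra.ad ℝ A x ^ k) v :=
    fun k => map_ad_pow F.incl x v k
  rw [exp_conj (K := K) (by rw [← h, hK]; rfl), adSeries_apply _ (hK x)]
  rw [AddSubmonoidClass.coe_finsetSum]
  exact Finset.sum_congr rfl fun k _ => by rw [← h]; rfl

/-- The derivative of `Z (t) = log (exp (t a) exp (t b))`. -/
lemma deriv_log_exp_mul_exp {a b Z Z' : A} {f : ℝ → A} {t : ℝ} {K : ℕ}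
    (hf : HasDerivAt f Z' t) (hZ : f t = Z)
    (hexp : ∀ s, exp (f s) = exp (s • a) * exp (s • b))
    (hK : LieAlgebra.ad ℝ A Z ^ K = 0) {w : Module.End ℝ A}
    (hw : ∀ V, w V = exp Z * V * exp (-Z)) :
    Z' = ∑ k ∈ Finset.range K, ((-1) ^ k / (k + 1 : ℝ)) •
      ((w - 1) ^ k) (a + exp (t • a) * b * exp (-(t • a))) := by
  have hw' : w = ∑ k ∈ Finset.range (K + 1), (k ! : ℝ)⁻¹ • LieAlgebra.ad ℝ A Z ^ k := by
    ext V
    rw [hw, exp_conj (K := K + 1) (by rw [pow_succ, hK, zero_mul]; rfl)]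
    simp [LinearMap.sum_apply]
  have h1 := (hasFDerivAt_exp (f t)).comp_hasDerivAt t hf
  have h2 := (hasDerivAt_exp_smul_const' (𝕂 := ℝ) a t).mul (hasDerivAt_exp_smul_const (𝕂 := ℝ) b t)
  have h3 : (exp ∘ f) = (fun s : ℝ => exp (s • a)) * fun s : ℝ => exp (s • b) := funext hexp
  rw [h3] at h1
  have h4 := h1.unique h2
  rw [hZ, fderiv_exp_apply' (K := K) (by rw [hK]; rfl)] at h4
  -- Both sides are multiplied by `exp (-Z)` on the right.
  have h5 : (∑ k ∈ Finset.range K, ((k + 1)! : ℝ)⁻¹ • (LieAlgebra.ad ℝ A Z ^ k) Z') =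
      a + exp (t • a) * b * exp (-(t • a)) := by
    have h6 : exp Z = exp (t • a) * exp (t • b) := by rw [← hZ, hexp]
    have h7 : exp (t • a) = exp Z * exp (-(t • b)) := by
      rw [h6, mul_assoc, exp_mul_exp_neg, mul_one]
    have hcomm : Commute (exp (t • b)) b :=
      ((Commute.refl b).smul_left t).exp_left
    calc _ = (∑ k ∈ Finset.range K, ((k + 1)! : ℝ)⁻¹ • (LieAlgebra.ad ℝ A Z ^ k) Z') *
          exp Z * exp (-Z) := by rw [mul_assoc, exp_mul_exp_neg, mul_one]
      _ = (a * (exp (t • a) * exp (t • b)) + exp (t • a) * (exp (t • b) * b)) * exp (-Z) := by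
        rw [h4]; noncomm_ring
      _ = a * (exp Z * exp (-Z)) + exp (t • a) * b * (exp (t • b) * exp (-Z)) := by
        rw [hcomm.eq, h6]; noncomm_ring
      _ = _ := by
        rw [exp_mul_exp_neg, mul_one]
        congr 2
        calc exp (t • b) * exp (-Z) =
            (exp (-(t • a)) * exp (t • a)) * exp (t • b) * exp (-Z) := by
              rw [exp_neg_mul_exp, one_mul]
          _ = exp (-(t • a)) * (exp Z * exp (-Z)) := by rw [h6]; noncomm_ring
          _ = _ := by rw [exp_mul_exp_neg, mul_one]
  rw [← h5]
  have h8 := congrArg (fun T : Module.End ℝ A => T Z') (logDiv_mul_expDiv hK hw')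
  simp only [Module.End.mul_apply, LinearMap.sum_apply, LinearMap.smul_apply,
    Module.End.one_apply] at h8
  exact h8.symm

/-- The Campbell-Baker-Hausdorff theorem for a Lie algebra of nilpotent elements of an associative
algebra. -/
theorem exp_bch {I : Submodule ℝ A} (hmul : ∀ a ∈ I, ∀ b ∈ I, a * b ∈ I) {M : ℕ}
    (hM : ∀ a ∈ I, a ^ M = 0) (F : LieSubalgebra ℝ A) [LieRing.IsNilpotent F]
    (hF : ∀ a ∈ F, a ∈ I) (a b : F) :
    exp ((bch a b : F) : A) = exp (a : A) * exp (b : A) := by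
  obtain ⟨K₁, hK₁⟩ := exists_ad_pow_eq_zero F
  obtain ⟨K₂, hK₂⟩ := LieModule.IsNilpotent.nilpotent ℝ F F
  set N := K₁ + K₂ + 2 * M + 1 with hN
  have hN1 : ∀ z : F, LieAlgebra.ad ℝ F z ^ (N + 1) = 0 := fun z =>
    pow_eq_zero_of_le (by omega) (hK₁ z)
  have hN2 : LieModule.lowerCentralSeries ℝ F F N = ⊥ :=
    le_bot_iff.1 (hK₂ ▸ LieModule.antitone_lowerCentralSeries ℝ F F (by omega : K₂ ≤ N))
  let w : List (ℕ × ℕ) → A := fun l => (nestedBracket (dynkinWord a b l) : F)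
  let z : ℝ → A := fun t => ∑ l ∈ dynkinFinset N,
    (dynkinCoeff l * t ^ (dynkinWord a b l).length) • w l
  have hz : ∀ t : ℝ, z t = ((bch (t • a) (t • b) : F) : A) := by
    intro t
    rw [bch_eq_sum_dynkinFinset hN2, AddSubmonoidClass.coe_finsetSum]
    refine Finset.sum_congr rfl fun l hl => ?_
    rw [nestedBracket_dynkinWord_smul a b t (dynkinFinset_subset N (Finset.mem_coe.2 hl)),
      smul_smul]
    rfl
  let z' : ℝ → A := fun t => ∑ l ∈ dynkinFinset N, (dynkinCoeff l *
    ((dynkinWord a b l).length * t ^ ((dynkinWord a b l).length - 1))) • w l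
  have hz' : ∀ t, HasDerivAt z (z' t) t := fun t => HasDerivAt.fun_sum fun l _ =>
    ((hasDerivAt_pow _ t).const_mul _).smul_const _
  have htz' : ∀ t : ℝ, t • z' t = ((∑ l ∈ dynkinFinset N,
      (dynkinCoeff l * (dynkinWord (t • a) (t • b) l).length) •
        nestedBracket (dynkinWord (t • a) (t • b) l) : F) : A) := by
    intro t
    rw [Finset.smul_sum, AddSubmonoidClass.coe_finsetSum]
    refine Finset.sum_congr rfl fun l hl => ?_
    have hl' : l ∈ dynkinIndex := dynkinFinset_subset N (Finset.mem_coe.2 hl)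
    rw [nestedBracket_dynkinWord_smul a b t hl', length_dynkinWord, length_dynkinWord]
    have h1 := one_le_sum_of_mem hl'
    have h2 : 1 ≤ l.length := List.length_pos_iff.2 hl'.1
    generalize (l.map fun rs => rs.1 + rs.2).sum = S at h1 ⊢
    obtain ⟨S, rfl⟩ : ∃ S', S = S' + 1 := ⟨S - 1, by omega⟩
    rw [smul_smul]
    change _ = (dynkinCoeff l * ((S + 1 : ℕ) : ℝ)) • t ^ (S + 1) • w l
    rw [smul_smul, Nat.add_sub_cancel]
    congr 1
    ring
  let Z : ℝ → A := fun t => logSum M (exp (t • (a : A)) * exp (t • (b : A)) - 1)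
  have hI : ∀ t : ℝ, exp (t • (a : A)) * exp (t • (b : A)) - 1 ∈ I := fun t =>
    exp_mul_exp_sub_one_mem hmul hM (I.smul_mem t (hF _ a.2)) (I.smul_mem t (hF _ b.2))
  have hexpZ : ∀ t, exp (Z t) = exp (t • (a : A)) * exp (t • (b : A)) := fun t =>
    exp_logSum_sub_one hmul hM (hI t)
  have hZdiff : ContDiff ℝ ∞ Z := by
    have h : ContDiff ℝ ∞ fun t : ℝ => exp (t • (a : A)) * exp (t • (b : A)) - 1 :=
      ((contDiff_exp.comp (contDiff_id.smul contDiff_const)).mul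
        (contDiff_exp.comp (contDiff_id.smul contDiff_const))).sub contDiff_const
    exact ContDiff.sum fun k _ => (h.pow (k + 1)).const_smul _
  have hzdiff : ContDiff ℝ ∞ z := ContDiff.sum fun l _ =>
    (contDiff_const.mul (contDiff_id.pow _)).smul contDiff_const
  -- The two curves have the same derivative for `t ≠ 0`.
  have hderiv : ∀ t : ℝ, t ≠ 0 → deriv Z t = z' t := by
    intro t ht
    have hZt : Z t ∈ I := logSum_mem hmul M (hI t)
    have hK : LieAlgebra.ad ℝ A (Z t) ^ N = 0 :=
      ad_pow_eq_zero_of_pow_eq_zero (hM _ hZt) (by omega)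
    let u : Module.End ℝ A := LinearMap.mulLeft ℝ (exp (Z t)) * LinearMap.mulRight ℝ (exp (-Z t))
    have hu : ∀ V, u V = exp (Z t) * V * exp (-Z t) := fun V => by
      simp [u, mul_assoc]
    have h1 := deriv_log_exp_mul_exp (hZdiff.differentiable (by simp) t).hasDerivAt rfl hexpZ hK hu
    have hneg : exp (-Z t) = exp (-(t • (b : A))) * exp (-(t • (a : A))) := by
      calc exp (-Z t) = exp (-Z t) * (exp (t • (a : A)) * (exp (t • (b : A)) *
            exp (-(t • (b : A)))) * exp (-(t • (a : A)))) := by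
              rw [exp_mul_exp_neg, mul_one, exp_mul_exp_neg, mul_one]
        _ = exp (-Z t) * (exp (t • (a : A)) * exp (t • (b : A))) *
            (exp (-(t • (b : A))) * exp (-(t • (a : A)))) := by simp only [mul_assoc]
        _ = _ := by rw [← hexpZ, exp_neg_mul_exp, one_mul]
    have hcoe : ∀ (k : ℕ) (v : F),
        ((((expAd (t • a) * expAd (t • b) - 1) ^ k) v : F) : A) = ((u - 1) ^ k) v := by
      intro k
      induction k with
      | zero => intro v; rfl
      | succ k ih =>
        intro v
        rw [pow_succ, pow_succ, Module.End.mul_apply, Module.End.mul_apply, ih]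
        congr 1
        rw [LinearMap.sub_apply, LinearMap.sub_apply, hu, hexpZ, hneg, Module.End.mul_apply,
          AddSubgroupClass.coe_sub, coe_expAd, coe_expAd]
        simp only [Module.End.one_apply, mul_assoc]
        rfl
    have h2 : t • z' t = t • deriv Z t := by
      rw [htz' t, sum_dynkin_smul_length _ _ hN1 (by omega), AddSubmonoidClass.coe_finsetSum, h1,
        Finset.smul_sum]
      refine Finset.sum_congr rfl fun k _ => ?_
      rw [smul_comm t, ← map_smul ((u - 1) ^ k)]
      change _ • ((((expAd (t • a) * expAd (t • b) - 1) ^ k) (t • a + expAd (t • a) (t • b)) : F) : A)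
        = _
      rw [hcoe, map_smul (expAd (t • a))]
      congr 2
      change t • (a : A) + t • ((expAd (t • a) b : F) : A) = _
      rw [coe_expAd, smul_add]
      rfl
    exact (smul_right_injective A ht h2).symm
  have hderiv0 : ∀ t, deriv Z t = deriv z t := by
    have h := Continuous.ext_on (dense_compl_singleton (0 : ℝ))
      (hZdiff.continuous_deriv (by simp)) (hzdiff.continuous_deriv (by simp))
      (fun t ht => (hderiv t ht).trans (hz' t).deriv.symm)
    exact congrFun h
  have hconst := hasDerivAt_eq_of_deriv_eq_zero (f := fun t => Z t - z t) (fun t => by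
    have := (hZdiff.differentiable (by simp) t).hasDerivAt.sub (hz' t)
    rwa [hderiv0, (hz' t).deriv, sub_self] at this) 1 0
  have hZ0 : Z 0 = 0 := by
    simp [Z, logSum]
  have hz0 : z 0 = 0 := by
    rw [hz, zero_smul, zero_smul, bch_zero_zero]
    rfl
  simp only [hZ0, hz0, sub_self] at hconst
  have h1 := hexpZ 1
  rw [sub_eq_zero.1 hconst, hz] at h1
  simpa using h1

end Associative

/-! ### Nilpotent Lie algebras as quotients of Lie algebras of nilpotent matrices -/

section Cover

attribute [local instance 100] LieRing.ofAssociativeRing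

/-- A presentation of a Lie algebra `L` as a quotient of a Lie algebra `F` of nilpotent elements of
a finite-dimensional associative algebra `A`. The projection `F → L` is given as the restriction of
a linear map on `A`, together with a linear section. -/
structure AssocCover (L : Type*) [LieRing L] [LieAlgebra ℝ L] where
  A : Type
  [ring : NormedRing A]
  [algebra : NormedAlgebra ℝ A]
  [finite : FiniteDimensional ℝ A]
  ideal : Submodule ℝ A
  mul_mem : ∀ a ∈ ideal, ∀ b ∈ ideal, a * b ∈ ideal
  index : ℕ
  pow_index : ∀ a ∈ ideal, a ^ index = 0
  F : LieSubalgebra ℝ A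
  F_le : ∀ a ∈ F, a ∈ ideal
  proj : A →ₗ[ℝ] L
  proj_lie : ∀ a ∈ F, ∀ b ∈ F, proj ⁅a, b⁆ = ⁅proj a, proj b⁆
  lift : L →ₗ[ℝ] A
  lift_mem : ∀ v, lift v ∈ F
  proj_lift : ∀ v, proj (lift v) = v

variable {L : Type*} [LieRing L] [LieAlgebra ℝ L] {ι : Type} (e : ι → L) (N : ℕ)

/-- The words of length at most `N` in the alphabet `ι`. -/
abbrev Words (ι : Type) (N : ℕ) : Type := {l : List ι // l.length ≤ N}

instance [Finite ι] : Fintype (Words ι N) :=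
  have : Finite (Words ι N) := List.finite_length_le ι N
  Fintype.ofFinite _

instance : DecidableEq (Words ι N) := Classical.decEq _

/-- The iterated bracket of a word in the generators `e i`. -/
def wordBracket (l : List ι) : L := nestedBracket (l.map e)

lemma wordBracket_cons {T : Type*} [LieRing T] (e : ι → T) (i : ι) {l : List ι} (hl : l ≠ []) :
    wordBracket e (i :: l) = ⁅e i, wordBracket e l⁆ := by
  rw [wordBracket, List.map_cons, nestedBracket_cons _ (by simpa using hl)]
  rfl

lemma wordBracket_eq_zero {N : ℕ} (hN : LieModule.lowerCentralSeries ℝ L L N = ⊥) {l : List ι}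
    (hl : N < l.length) : wordBracket e l = 0 := by
  have := nestedBracket_mem (l.map e) N (by simpa using hl)
  rwa [hN, LieSubmodule.mem_bot] at this

variable [Finite ι]

/-- Matrices acting on the truncated tensor algebra which increase the length by `m`. -/
def IsHomogeneousMatrix {N : ℕ} (m : ℕ) (a : Matrix (Words ι N) (Words ι N) ℝ) : Prop :=
  ∀ l' l, a l' l ≠ 0 → l'.1.length = l.1.length + m

/-- The iterated bracket of the image of a word under a matrix. -/
def matrixBracket {N : ℕ} (a : Matrix (Words ι N) (Words ι N) ℝ) (l : Words ι N) : L :=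
  ∑ l', a l' l • wordBracket e l'.1

/-- Dynkin's projection: the image of the empty word under the matrix, where each word of length `m`
is replaced by its iterated bracket divided by `m`. -/
def matrixProj : Matrix (Words ι N) (Words ι N) ℝ →ₗ[ℝ] L where
  toFun a := ∑ l', (a l' ⟨[], Nat.zero_le N⟩ * (l'.1.length : ℝ)⁻¹) • wordBracket e l'.1
  map_add' a b := by
    rw [← Finset.sum_add_distrib]
    exact Finset.sum_congr rfl fun l' _ => by rw [Matrix.add_apply, add_mul, add_smul]
  map_smul' c a := by
    rw [RingHom.id_apply, Finset.smul_sum]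
    exact Finset.sum_congr rfl fun l' _ => by
      rw [Matrix.smul_apply, smul_eq_mul, mul_assoc, mul_smul]

/-- The homogeneous matrices which act on brackets of words as the adjoint action of their
projection. These matrices span a Lie algebra on which the projection is a homomorphism. -/
def IsAdMatrix {N : ℕ} (a : Matrix (Words ι N) (Words ι N) ℝ) : Prop :=
  ∃ m : ℕ, 1 ≤ m ∧ IsHomogeneousMatrix m a ∧
    ∀ l : Words ι N, l.1 ≠ [] → matrixBracket e a l = ⁅matrixProj e N a, wordBracket e l.1⁆

variable {e N} {a b : Matrix (Words ι N) (Words ι N) ℝ}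

/-- All words which occur in the image of the empty word have length `m`, so that the divisor in
Dynkin's projection is `m`. -/
lemma matrixBracket_nil {m : ℕ} (hm : 1 ≤ m) (ha : IsHomogeneousMatrix m a) :
    matrixBracket e a ⟨[], Nat.zero_le N⟩ = (m : ℝ) • matrixProj e N a := by
  change _ = (m : ℝ) • ∑ l' : Words ι N, _
  rw [matrixBracket, Finset.smul_sum]
  refine Finset.sum_congr rfl fun l' _ => ?_
  by_cases h : a l' ⟨[], Nat.zero_le N⟩ = 0
  · simp [h]
  · have h1 := ha _ _ h
    rw [List.length_nil, zero_add] at h1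
    have h2 : (m : ℝ) ≠ 0 := by positivity
    rw [h1, smul_smul]
    congr 1
    field_simp

/-- Words in the image of `b` are not empty, so that `a` acts on them through its projection. -/
lemma matrixBracket_mul
    (ha : ∀ l : Words ι N, l.1 ≠ [] → matrixBracket e a l = ⁅matrixProj e N a, wordBracket e l.1⁆)
    {m : ℕ} (hm : 1 ≤ m) (hb : IsHomogeneousMatrix m b) (l : Words ι N) :
    matrixBracket e (a * b) l = ⁅matrixProj e N a, matrixBracket e b l⁆ := by
  have h1 : matrixBracket e (a * b) l = ∑ l'', b l'' l • matrixBracket e a l'' := by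
    simp only [matrixBracket, Matrix.mul_apply, Finset.sum_smul, Finset.smul_sum]
    rw [Finset.sum_comm]
    exact Finset.sum_congr rfl fun _ _ => Finset.sum_congr rfl fun _ _ => by
      rw [smul_smul, mul_comm]
  rw [h1, matrixBracket, lie_sum]
  refine Finset.sum_congr rfl fun l'' _ => ?_
  rw [lie_smul]
  by_cases h : b l'' l = 0
  · simp [h]
  · have h2 := hb _ _ h
    rw [ha l'' (fun h3 => by rw [h3, List.length_nil] at h2; omega)]

lemma IsHomogeneousMatrix.mul {m k : ℕ} (ha : IsHomogeneousMatrix m a)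
    (hb : IsHomogeneousMatrix k b) : IsHomogeneousMatrix (m + k) (a * b) := by
  intro l' l h
  rw [Matrix.mul_apply] at h
  obtain ⟨l'', -, h1⟩ := Finset.exists_ne_zero_of_sum_ne_zero h
  have h2 := ha _ _ (left_ne_zero_of_mul h1)
  have h3 := hb _ _ (right_ne_zero_of_mul h1)
  omega

lemma IsHomogeneousMatrix.lie {m k : ℕ} (ha : IsHomogeneousMatrix m a)
    (hb : IsHomogeneousMatrix k b) : IsHomogeneousMatrix (m + k) ⁅a, b⁆ := by
  intro l' l h
  rw [Ring.lie_def, Matrix.sub_apply] at h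
  by_cases h1 : (a * b) l' l = 0
  · rw [h1, zero_sub, neg_ne_zero] at h
    rw [hb.mul ha l' l h, add_comm m k]
  · exact ha.mul hb l' l h1

lemma matrixBracket_sub (a b : Matrix (Words ι N) (Words ι N) ℝ) (l : Words ι N) :
    matrixBracket e (a - b) l = matrixBracket e a l - matrixBracket e b l := by
  simp only [matrixBracket, Matrix.sub_apply, sub_smul, Finset.sum_sub_distrib]

/-- The condition is stable under commutators by the Jacobi identity. On the empty word it gives
`(m + k) P[a, b] = [P a, k P b] - [P b, m P a]` for matrices of degrees `m` and `k`, whence the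
projection `P` is a homomorphism. -/
lemma IsAdMatrix.lie (ha : IsAdMatrix e a) (hb : IsAdMatrix e b) :
    IsAdMatrix e ⁅a, b⁆ ∧ matrixProj e N ⁅a, b⁆ = ⁅matrixProj e N a, matrixProj e N b⁆ := by
  obtain ⟨m, hm, ha1, ha2⟩ := ha
  obtain ⟨k, hk, hb1, hb2⟩ := hb
  have h1 : ∀ l, matrixBracket e ⁅a, b⁆ l =
      ⁅matrixProj e N a, matrixBracket e b l⁆ - ⁅matrixProj e N b, matrixBracket e a l⁆ := fun l => by
    rw [Ring.lie_def, matrixBracket_sub, matrixBracket_mul ha2 hk hb1,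
      matrixBracket_mul hb2 hm ha1]
  have hlie := ha1.lie hb1
  have h2 : matrixProj e N ⁅a, b⁆ = ⁅matrixProj e N a, matrixProj e N b⁆ := by
    have h3 := matrixBracket_nil (e := e) (by omega) hlie
    rw [h1, matrixBracket_nil hk hb1, matrixBracket_nil hm ha1, lie_smul, lie_smul,
      ← lie_skew (matrixProj e N b), smul_neg, sub_neg_eq_add, ← add_smul] at h3
    have h4 : ((m + k : ℕ) : ℝ) ≠ 0 := by
      have : m + k ≠ 0 := by omega
      exact_mod_cast this
    refine (smul_right_injective L h4 ?_).symm
    rw [add_comm (k : ℝ), ← Nat.cast_add] at h3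
    exact h3
  refine ⟨⟨m + k, by omega, hlie, fun l hl => ?_⟩, h2⟩
  rw [h1, h2, ha2 l hl, hb2 l hl, lie_lie]

variable (e N) in
/-- The Lie algebra of matrices spanned by those which act on brackets of words as the adjoint
action of their projection. -/
def adMatrices : LieSubalgebra ℝ (Matrix (Words ι N) (Words ι N) ℝ) where
  toSubmodule := Submodule.span ℝ {a | IsAdMatrix e a}
  lie_mem' := by
    intro a b ha hb
    refine Submodule.span_induction₂ (p := fun a b _ _ => ⁅a, b⁆ ∈ Submodule.span ℝ _) ?_ ?_ ?_ ?_ ?_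
      ?_ ?_ ha hb
    · exact fun x y hx hy => Submodule.subset_span (hx.lie hy).1
    · intro y _; rw [zero_lie]; exact Submodule.zero_mem _
    · intro y _; rw [lie_zero]; exact Submodule.zero_mem _
    · intro x y z _ _ _ h1 h2; rw [add_lie]; exact Submodule.add_mem _ h1 h2
    · intro x y z _ _ _ h1 h2; rw [lie_add]; exact Submodule.add_mem _ h1 h2
    · intro r x y _ _ h; rw [smul_lie]; exact Submodule.smul_mem _ _ h
    · intro r x y _ _ h; rw [lie_smul]; exact Submodule.smul_mem _ _ h

lemma matrixProj_lie (ha : a ∈ adMatrices e N) (hb : b ∈ adMatrices e N) :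
    matrixProj e N ⁅a, b⁆ = ⁅matrixProj e N a, matrixProj e N b⁆ := by
  refine Submodule.span_induction₂
    (p := fun a b _ _ => matrixProj e N ⁅a, b⁆ = ⁅matrixProj e N a, matrixProj e N b⁆) ?_ ?_ ?_ ?_ ?_
      ?_ ?_ ha hb
  · exact fun x y hx hy => (hx.lie hy).2
  · intro y _; simp
  · intro y _; simp
  · intro x y z _ _ _ h1 h2; rw [add_lie, map_add, h1, h2, map_add, add_lie]
  · intro x y z _ _ _ h1 h2; rw [lie_add, map_add, h1, h2, map_add, lie_add]
  · intro r x y _ _ h; rw [smul_lie, map_smul, h, map_smul, smul_lie]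
  · intro r x y _ _ h; rw [lie_smul, map_smul, h, map_smul, lie_smul]

variable (ι N) in
/-- The matrices which strictly increase the length of words. -/
def raisingMatrices : Submodule ℝ (Matrix (Words ι N) (Words ι N) ℝ) where
  carrier := {a | ∀ l' l, l'.1.length ≤ l.1.length → a l' l = 0}
  add_mem' ha hb := fun l' l h => by rw [Matrix.add_apply, ha l' l h, hb l' l h, add_zero]
  zero_mem' := fun _ _ _ => rfl
  smul_mem' c a ha := fun l' l h => by rw [Matrix.smul_apply, ha l' l h, smul_zero]

lemma mul_apply_of_mem_raisingMatrices (ha : a ∈ raisingMatrices ι N) {k : ℕ}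
    (hb : ∀ l' l, l'.1.length < l.1.length + k → b l' l = 0) (l' l : Words ι N)
    (h : l'.1.length < l.1.length + (k + 1)) : (a * b) l' l = 0 := by
  rw [Matrix.mul_apply]
  refine Finset.sum_eq_zero fun l'' _ => ?_
  by_cases h1 : l'.1.length ≤ l''.1.length
  · rw [ha _ _ h1, zero_mul]
  · rw [hb _ _ (by omega), mul_zero]

lemma mul_mem_raisingMatrices (ha : a ∈ raisingMatrices ι N) (hb : b ∈ raisingMatrices ι N) :
    a * b ∈ raisingMatrices ι N := fun l' l h =>
  mul_apply_of_mem_raisingMatrices ha (k := 1) (fun l' l h => hb l' l (by omega)) l' l (by omega)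

lemma pow_of_mem_raisingMatrices (ha : a ∈ raisingMatrices ι N) : a ^ (N + 1) = 0 := by
  have h : ∀ k : ℕ, ∀ l' l, l'.1.length < l.1.length + k → (a ^ k) l' l = 0 := by
    intro k
    induction k with
    | zero =>
      intro l' l h
      rw [pow_zero, Matrix.one_apply_ne]
      rintro rfl
      omega
    | succ k ih =>
      rw [pow_succ']
      exact mul_apply_of_mem_raisingMatrices ha ih
  ext l' l
  exact h _ l' l (by have := l'.2; omega)

lemma adMatrices_le (ha : a ∈ adMatrices e N) : a ∈ raisingMatrices ι N := by
  refine (Submodule.span_le (p := raisingMatrices ι N)).2 ?_ ha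
  rintro b ⟨m, hm, hb, -⟩ l' l h
  by_contra hc
  have := hb _ _ hc
  omega

open Classical in
variable (N) in
/-- Left multiplication by a letter, truncated. -/
def letterMatrix (i : ι) : Matrix (Words ι N) (Words ι N) ℝ :=
  fun l' l => if l'.1 = i :: l.1 then 1 else 0

lemma matrixProj_letterMatrix (hN : 1 ≤ N) (i : ι) : matrixProj e N (letterMatrix N i) = e i := by
  change ∑ l', _ = _
  rw [Finset.sum_eq_single ⟨[i], hN⟩]
  · simp [letterMatrix, wordBracket, nestedBracket]
  · intro l' _ h
    have h1 : l'.1 ≠ [i] := fun h2 => h (Subtype.ext h2)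
    simp [letterMatrix, h1]
  · simp

/-- Words of length `N` are killed by the truncation, which is harmless because the brackets of
length `N + 1` vanish. -/
lemma letterMatrix_mem (hN : 1 ≤ N) (hL : LieModule.lowerCentralSeries ℝ L L N = ⊥) (i : ι) :
    letterMatrix N i ∈ adMatrices e N := by
  refine Submodule.subset_span ⟨1, le_rfl, fun l' l h => ?_, fun l hl => ?_⟩
  · have h1 : l'.1 = i :: l.1 := by
      by_contra hc
      exact h (by simp [letterMatrix, hc])
    rw [h1, List.length_cons]
  · rw [matrixProj_letterMatrix hN, ← wordBracket_cons e i hl, matrixBracket]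
    by_cases h : l.1.length < N
    · rw [Finset.sum_eq_single ⟨i :: l.1, by simpa using h⟩]
      · simp [letterMatrix]
      · intro l' _ h
        have h1 : l'.1 ≠ i :: l.1 := fun h2 => h (Subtype.ext h2)
        simp [letterMatrix, h1]
      · simp
    · rw [wordBracket_eq_zero e hL (by rw [List.length_cons]; omega)]
      refine Finset.sum_eq_zero fun l' _ => ?_
      have h1 : l'.1 ≠ i :: l.1 := fun h2 => by
        have := l'.2
        rw [h2, List.length_cons] at this
        omega
      simp [letterMatrix, h1]

/-- Every finite-dimensional nilpotent real Lie algebra is a quotient of a Lie algebra of nilpotent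
matrices: those acting on the truncated tensor algebra of the underlying vector space. -/
theorem exists_assocCover (L : Type*) [LieRing L] [LieAlgebra ℝ L] [FiniteDimensional ℝ L]
    [LieRing.IsNilpotent L] : Nonempty (AssocCover L) := by
  obtain ⟨N', hN'⟩ := LieModule.IsNilpotent.nilpotent ℝ L L
  have hL : LieModule.lowerCentralSeries ℝ L L (N' + 1) = ⊥ :=
    le_bot_iff.1 (hN' ▸ LieModule.antitone_lowerCentralSeries ℝ L L (Nat.le_succ N'))
  let B := Module.finBasis ℝ L
  let e : Fin (Module.finrank ℝ L) → L := B
  let lift : L →ₗ[ℝ] Matrix (Words (Fin (Module.finrank ℝ L)) (N' + 1))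
    (Words (Fin (Module.finrank ℝ L)) (N' + 1)) ℝ := B.constr ℝ (letterMatrix (N' + 1))
  let := Matrix.linftyOpNormedRing (n := Words (Fin (Module.finrank ℝ L)) (N' + 1)) (α := ℝ)
  let := Matrix.linftyOpNormedAlgebra (n := Words (Fin (Module.finrank ℝ L)) (N' + 1)) (R := ℝ)
    (α := ℝ)
  refine ⟨{ A := Matrix (Words (Fin (Module.finrank ℝ L)) (N' + 1))
              (Words (Fin (Module.finrank ℝ L)) (N' + 1)) ℝ
            finite := inferInstanceAs (FiniteDimensional ℝ (Matrix _ _ ℝ))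
            ideal := raisingMatrices _ (N' + 1)
            mul_mem := fun a ha b hb => mul_mem_raisingMatrices ha hb
            index := N' + 2
            pow_index := fun a ha => pow_of_mem_raisingMatrices ha
            F := adMatrices e (N' + 1)
            F_le := fun a ha => adMatrices_le ha
            proj := matrixProj e (N' + 1)
            proj_lie := fun a ha b hb => matrixProj_lie ha hb
            lift := lift
            lift_mem := fun v => ?_
            proj_lift := fun v => ?_ }⟩
  · rw [← B.sum_repr v, map_sum]
    refine (adMatrices e (N' + 1)).toSubmodule.sum_mem fun i _ => ?_
    rw [map_smul]
    refine (adMatrices e (N' + 1)).toSubmodule.smul_mem _ ?_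
    rw [B.constr_basis]
    exact letterMatrix_mem (by omega) hL i
  · have h : matrixProj e (N' + 1) ∘ₗ lift = LinearMap.id := by
      refine B.ext fun i => ?_
      rw [LinearMap.comp_apply, B.constr_basis, matrixProj_letterMatrix (by omega)]
      rfl
    exact congrArg (fun T : L →ₗ[ℝ] L => T v) h

end Cover

/-! ### The group `exp(L)` -/

section GroupLaw

open NormedSpace

attribute [local instance 100] LieRing.ofAssociativeRing

namespace AssocCover

variable {L : Type*} [LieRing L] [LieAlgebra ℝ L] (C : AssocCover L)

attribute [instance] ring algebra finite

instance : CompleteSpace C.A := FiniteDimensional.complete ℝ C.A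

instance : LieRing.IsNilpotent C.F := by
  have : IsNoetherian ℝ C.F := inferInstanceAs (IsNoetherian ℝ C.F.toSubmodule)
  refine (LieAlgebra.isNilpotent_iff_forall (R := ℝ)).2 fun x => ⟨2 * C.index, ?_⟩
  ext v
  have h := map_ad_pow C.F.incl x v (2 * C.index)
  rw [show C.F.incl x = (x : C.A) from rfl,
    ad_pow_eq_zero_of_pow_eq_zero (C.pow_index _ (C.F_le _ x.2)) le_rfl] at h
  exact h

/-- The projection as a homomorphism of Lie algebras. -/
def projLie : C.F →ₗ⁅ℝ⁆ L :=
  { C.proj ∘ₗ C.F.toSubmodule.subtype with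
    map_lie' := fun {a b} => C.proj_lie a a.2 b b.2 }

/-- The lift of an element of `L`. -/
def liftF (v : L) : C.F := ⟨C.lift v, C.lift_mem v⟩

lemma projLie_liftF (v : L) : C.projLie (C.liftF v) = v := C.proj_lift v

lemma exp_bch (a b : C.F) : exp ((bch a b : C.F) : C.A) = exp (a : C.A) * exp (b : C.A) :=
  FlatTorsor.exp_bch C.mul_mem C.pow_index C.F C.F_le a b

lemma exp_injective {a b : C.F} (h : exp (a : C.A) = exp (b : C.A)) : a = b :=
  Subtype.ext (exp_injOn_nilpotent (C.pow_index _ (C.F_le _ a.2)) (C.pow_index _ (C.F_le _ b.2)) h)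

end AssocCover

variable {L : Type*} [LieRing L] [LieAlgebra ℝ L] [LieRing.IsNilpotent L]

section

variable [FiniteDimensional ℝ L]

theorem bch_assoc (a b c : L) : bch (bch a b) c = bch a (bch b c) := by
  obtain ⟨C⟩ := exists_assocCover L
  have h : bch (bch (C.liftF a) (C.liftF b)) (C.liftF c) =
      bch (C.liftF a) (bch (C.liftF b) (C.liftF c)) :=
    C.exp_injective (by simp only [C.exp_bch, mul_assoc])
  simpa [map_bch, C.projLie_liftF] using congrArg C.projLie h

theorem bch_zero_left (a : L) : bch 0 a = a := by
  obtain ⟨C⟩ := exists_assocCover L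
  have h : bch 0 (C.liftF a) = C.liftF a := C.exp_injective (by simp [C.exp_bch])
  simpa [map_bch, C.projLie_liftF] using congrArg C.projLie h

theorem bch_zero_right (a : L) : bch a 0 = a := by
  obtain ⟨C⟩ := exists_assocCover L
  have h : bch (C.liftF a) 0 = C.liftF a := C.exp_injective (by simp [C.exp_bch])
  simpa [map_bch, C.projLie_liftF] using congrArg C.projLie h

theorem bch_neg_left (a : L) : bch (-a) a = 0 := by
  obtain ⟨C⟩ := exists_assocCover L
  have h : bch (-C.liftF a) (C.liftF a) = 0 :=
    C.exp_injective (by rw [C.exp_bch]; simpa using exp_neg_mul_exp (C.liftF a : C.A))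
  simpa [map_bch, C.projLie_liftF] using congrArg C.projLie h

theorem bch_neg_right (a : L) : bch a (-a) = 0 := by
  simpa using bch_neg_left (-a)

lemma bch_neg_cancel_left (a b : L) : bch (-a) (bch a b) = b := by
  rw [← bch_assoc, bch_neg_left, bch_zero_left]

lemma bch_cancel_neg_left (a b : L) : bch a (bch (-a) b) = b := by
  rw [← bch_assoc, bch_neg_right, bch_zero_left]

lemma bch_cancel_neg_right (a b : L) : bch (bch a b) (-b) = a := by
  rw [bch_assoc, bch_neg_right, bch_zero_right]

lemma bch_neg_cancel_right (a b : L) : bch (bch a (-b)) b = a := by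
  rw [bch_assoc, bch_neg_left, bch_zero_right]

lemma neg_bch (a b : L) : -bch a b = bch (-b) (-a) := by
  have h : bch (bch (-b) (-a)) (bch a b) = 0 := by
    rw [bch_assoc, bch_neg_cancel_left, bch_neg_left]
  calc -bch a b = bch (bch (bch (-b) (-a)) (bch a b)) (-bch a b) := by rw [h, bch_zero_left]
    _ = bch (-b) (-a) := by rw [bch_cancel_neg_right]

/-- `exp (ad (a b)) = exp (ad a) exp (ad b)` for the group law `a b`. -/
theorem expAd_bch (a b v : L) : expAd (bch a b) v = expAd a (expAd b v) := by
  obtain ⟨C⟩ := exists_assocCover L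
  have h : expAd (bch (C.liftF a) (C.liftF b)) (C.liftF v) =
      expAd (C.liftF a) (expAd (C.liftF b) (C.liftF v)) := by
    refine Subtype.ext ?_
    have hneg : exp (-((bch (C.liftF a) (C.liftF b) : C.F) : C.A)) =
        exp (-(C.liftF b : C.A)) * exp (-(C.liftF a : C.A)) := by
      have h1 : -bch (C.liftF a) (C.liftF b) = bch (-C.liftF b) (-C.liftF a) := by
        refine C.exp_injective ?_
        have h2 := exp_mul_exp_neg ((bch (C.liftF a) (C.liftF b) : C.F) : C.A)
        have h3 : exp ((bch (-C.liftF b) (-C.liftF a) : C.F) : C.A) *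
            exp ((bch (C.liftF a) (C.liftF b) : C.F) : C.A) = 1 := by
          rw [C.exp_bch, C.exp_bch, mul_assoc, ← mul_assoc (exp _) (exp (C.liftF a : C.A))]
          have h4 := exp_neg_mul_exp (C.liftF a : C.A)
          have h5 := exp_neg_mul_exp (C.liftF b : C.A)
          simpa [h4] using h5
        exact (left_inv_eq_right_inv h3 h2).symm
      have h6 := congrArg (fun z : C.F => exp (z : C.A)) h1
      simpa [C.exp_bch] using h6
    rw [coe_expAd, coe_expAd, coe_expAd, hneg, C.exp_bch]
    simp only [mul_assoc]
  have h1 := congrArg C.projLie h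
  simpa [map_adSeries, map_bch, C.projLie_liftF] using h1

end

end GroupLaw

/-! ### Congruences modulo the lower central series -/

section LowerCentral

variable {L : Type*} [LieRing L] [LieAlgebra ℝ L]

variable (L) in
/-- The lower central series of `L`. -/
abbrev lcs (j : ℕ) : LieSubmodule ℝ L L := LieModule.lowerCentralSeries ℝ L L j

lemma lie_mem_lcs_succ {j : ℕ} {v : L} (a : L) (hv : v ∈ lcs L j) : ⁅a, v⁆ ∈ lcs L (j + 1) := by
  rw [lcs, LieModule.lowerCentralSeries_succ]
  exact LieSubmodule.lie_mem_lie (LieSubmodule.mem_top a) hv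

lemma lie_mem_lcs_succ' {j : ℕ} {a : L} (ha : a ∈ lcs L j) (v : L) : ⁅a, v⁆ ∈ lcs L (j + 1) := by
  rw [← lie_skew]
  exact neg_mem (lie_mem_lcs_succ v ha)

lemma lcs_succ_le (j : ℕ) : lcs L (j + 1) ≤ lcs L j :=
  LieModule.antitone_lowerCentralSeries ℝ L L (Nat.le_succ j)

variable [LieRing.IsNilpotent L]

/-- Modulo a term of the lower central series into which `ad a` maps `v`, only the constant
coefficient of the series contributes. -/
lemma adSeries_sub_mem (c : ℕ → ℝ) {j : ℕ} (a v : L) (h : ∀ w, w = v ∨ w ∈ lcs L (j + 1) →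
    ⁅a, w⁆ ∈ lcs L (j + 1)) : adSeries c a v - c 0 • v ∈ lcs L (j + 1) := by
  obtain ⟨K, hK⟩ := exists_ad_pow_eq_zero L
  rw [adSeries_apply c (K := K + 1) (pow_eq_zero_of_le (by omega) (hK a)), Finset.sum_range_succ']
  simp only [pow_zero, Module.End.one_apply, add_sub_cancel_right]
  refine sum_mem fun k hk => (lcs L (j + 1)).smul_mem _ ?_
  clear hk
  induction k with
  | zero => simpa using h v (Or.inl rfl)
  | succ k ih =>
    rw [pow_succ', Module.End.mul_apply]
    exact h _ (Or.inr ih)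

lemma adSeries_sub_mem_of_left (c : ℕ → ℝ) {j : ℕ} {a : L} (ha : a ∈ lcs L j) (v : L) :
    adSeries c a v - c 0 • v ∈ lcs L (j + 1) :=
  adSeries_sub_mem c a v fun w _ => lie_mem_lcs_succ' ha w

lemma adSeries_sub_mem_of_right (c : ℕ → ℝ) {j : ℕ} (a : L) {v : L} (hv : v ∈ lcs L j) :
    adSeries c a v - c 0 • v ∈ lcs L (j + 1) :=
  adSeries_sub_mem c a v fun w hw => lie_mem_lcs_succ a (by
    rcases hw with rfl | hw
    · exact hv
    · exact lcs_succ_le j hw)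

lemma eq_zero_of_forall_mem_lcs {v : L} (h : ∀ j, v ∈ lcs L j → v ∈ lcs L (j + 1)) : v = 0 := by
  obtain ⟨N, hN⟩ := LieModule.IsNilpotent.nilpotent ℝ L L
  have : ∀ j, v ∈ lcs L j := by
    intro j
    induction j with
    | zero => simp [lcs]
    | succ j ih => exact h j ih
  have h1 := this N
  rwa [lcs, hN, LieSubmodule.mem_bot] at h1

lemma eq_zero_of_dexpAd_eq_zero {a v : L} (h : dexpAd a v = 0) : v = 0 := by
  refine eq_zero_of_forall_mem_lcs fun j hj => ?_
  have h1 := adSeries_sub_mem_of_right (fun k => (-1) ^ k * ((k + 1)! : ℝ)⁻¹) a hj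
  rw [h] at h1
  simpa using h1

end LowerCentral

/-! ### The Maurer-Cartan form of a group-valued function -/

section Calculus

open NormedSpace

attribute [local instance 100] LieRing.ofAssociativeRing

variable {X : Type u} [TopologicalSpace X] {x : X} {𝔤 : NilpRep x}
variable {E : Type*} [NormedAddCommGroup E] [NormedSpace ℝ E]

/-- A power series in `ad a`, as a continuous linear map. -/
def adCLM (c : ℕ → ℝ) (a : 𝔤) : 𝔤 →L[ℝ] 𝔤 := LinearMap.toContinuousLinearMap (adSeries c a)

lemma adCLM_apply (c : ℕ → ℝ) (a v : 𝔤) : adCLM c a v = adSeries c a v := rfl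

lemma contDiff_adCLM (c : ℕ → ℝ) : ContDiff ℝ ∞ (adCLM c : 𝔤 → 𝔤 →L[ℝ] 𝔤) := by
  obtain ⟨K, hK⟩ := exists_ad_pow_eq_zero 𝔤
  have h : (adCLM c : 𝔤 → 𝔤 →L[ℝ] 𝔤) = fun a => ∑ k ∈ Finset.range K, c k • 𝔤.ad a ^ k := by
    funext a
    ext v
    have hk : ∀ k, (𝔤.ad a ^ k) v = (LieAlgebra.ad ℝ 𝔤 a ^ k) v := by
      intro k
      induction k with
      | zero => rfl
      | succ k ih =>
        rw [pow_succ', pow_succ', mul_apply_eq_comp, ih]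
        rfl
    rw [adCLM_apply, adSeries_apply c (hK a)]
    simp [hk]
  have had : ContDiff ℝ ∞ (𝔤.ad : 𝔤 → 𝔤 →L[ℝ] 𝔤) :=
    ((LinearMap.toContinuousLinearMap.toLinearMap.comp
      (LieAlgebra.ad ℝ 𝔤 : 𝔤 →ₗ[ℝ] Module.End ℝ 𝔤)).toContinuousLinearMap).contDiff
  rw [h]
  exact ContDiff.sum fun k _ => (had.pow k).const_smul _

/-- The form `α⁻¹ dα` of a function `α` with values in `exp(𝔤)`. -/
def mcForm (α : E → 𝔤) (u : E) : E →L[ℝ] 𝔤 :=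
  (adCLM (fun k => (-1) ^ k * ((k + 1)! : ℝ)⁻¹) (α u)).comp (fderiv ℝ α u)

lemma mcForm_apply (α : E → 𝔤) (u w : E) : mcForm α u w = dexpAd (α u) (fderiv ℝ α u w) := rfl

namespace AssocCover

variable (C : AssocCover 𝔤)

/-- The projection as a continuous linear map. -/
def projCLM : C.A →L[ℝ] 𝔤 := LinearMap.toContinuousLinearMap C.proj

/-- The lift as a continuous linear map. -/
def liftCLM : 𝔤 →L[ℝ] C.A := LinearMap.toContinuousLinearMap C.lift

/-- Subspaces of finite dimension are closed, hence contain the derivatives of the functions with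
values in them. -/
lemma hasFDerivAt_mem {g : E → C.A} {g' : E →L[ℝ] C.A} {u : E} (hg : HasFDerivAt g g' u)
    (hF : ∀ v, g v ∈ C.F) (w : E) : g' w ∈ C.F := by
  obtain ⟨p, hp⟩ := C.F.toSubmodule.subtype.exists_leftInverse_of_injective
    (Submodule.ker_subtype _)
  let P : C.A →L[ℝ] C.A := LinearMap.toContinuousLinearMap (C.F.toSubmodule.subtype ∘ₗ p)
  have hP : ∀ a ∈ C.F, P a = a := fun a ha =>
    congrArg Subtype.val (congrArg (fun T => T ⟨a, ha⟩) hp)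
  have h1 : P ∘ g = g := funext fun v => hP _ (hF v)
  have h2 := P.hasFDerivAt.comp u hg
  rw [h1] at h2
  rw [hg.unique h2]
  exact (p (g' w)).2

/-- The differential of the exponential, `exp(-a) d exp(a) v = ∑ (-ad a)^k v / (k + 1)!`, projected
to the nilpotent Lie algebra. -/
lemma proj_exp_neg_mul_fderiv {a v : C.A} (ha : a ∈ C.F) (hv : v ∈ C.F) :
    exp (-a) * fderiv ℝ (exp : C.A → C.A) a v ∈ C.F ∧
      C.proj (exp (-a) * fderiv ℝ (exp : C.A → C.A) a v) = dexpAd (C.proj a) (C.proj v) := by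
  obtain ⟨K, hK⟩ := exists_ad_pow_eq_zero C.F
  let a' : C.F := ⟨a, ha⟩
  let v' : C.F := ⟨v, hv⟩
  have h : ∀ k, (((LieAlgebra.ad ℝ C.F a' ^ k) v' : C.F) : C.A) = (LieAlgebra.ad ℝ C.A a ^ k) v :=
    fun k => map_ad_pow C.F.incl a' v' k
  have h1 : exp (-a) * fderiv ℝ (exp : C.A → C.A) a v = (dexpAd a' v' : C.F) := by
    rw [fderiv_exp_apply (K := K) (by rw [← h, hK]; rfl), ← mul_assoc, exp_neg_mul_exp, one_mul,
      adSeries_apply _ (hK a'), AddSubmonoidClass.coe_finsetSum]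
    exact Finset.sum_congr rfl fun k _ => by rw [← h]; rfl
  rw [h1]
  exact ⟨(dexpAd a' v').2, map_adSeries C.projLie _ a' v'⟩

lemma proj_conj {a v : C.A} (ha : a ∈ C.F) (hv : v ∈ C.F) :
    exp a * v * exp (-a) ∈ C.F ∧
      C.proj (exp a * v * exp (-a)) = expAd (C.proj a) (C.proj v) := by
  have h1 := coe_expAd C.F ⟨a, ha⟩ ⟨v, hv⟩
  rw [← h1]
  exact ⟨(expAd (⟨a, ha⟩ : C.F) ⟨v, hv⟩).2, map_adSeries C.projLie _ ⟨a, ha⟩ ⟨v, hv⟩⟩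

end AssocCover

/-- The form `α⁻¹ dα` of a product. -/
theorem mcForm_bch {α β : E → 𝔤} {u : E} (hα : DifferentiableAt ℝ α u)
    (hβ : DifferentiableAt ℝ β u) (w : E) :
    mcForm (fun v => bch (α v) (β v)) u w = expAd (-β u) (mcForm α u w) + mcForm β u w := by
  obtain ⟨C⟩ := exists_assocCover 𝔤
  let a : E → C.A := fun v => C.liftCLM (α v)
  let b : E → C.A := fun v => C.liftCLM (β v)
  let c : E → C.A := fun v => (bch (C.liftF (α v)) (C.liftF (β v)) : C.F)
  have haF : ∀ v, a v ∈ C.F := fun v => C.lift_mem _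
  have hbF : ∀ v, b v ∈ C.F := fun v => C.lift_mem _
  have hcF : ∀ v, c v ∈ C.F := fun v => (bch (C.liftF (α v)) (C.liftF (β v))).2
  have hexp : ∀ v, exp (c v) = exp (a v) * exp (b v) := fun v => C.exp_bch _ _
  have hc : c = fun v => logSum C.index (exp (a v) * exp (b v) - 1) := by
    funext v
    have hn := C.pow_index _ (C.F_le _ (hcF v))
    rw [← hexp, logSum_exp_sub_one hn
      (exp_eq_sum_of_pow_eq_zero (by rw [pow_succ, hn, zero_mul]))]
  have ha := C.liftCLM.hasFDerivAt.comp u hα.hasFDerivAt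
  have hb := C.liftCLM.hasFDerivAt.comp u hβ.hasFDerivAt
  have hea := (hasFDerivAt_exp (a u)).comp u ha
  have heb := (hasFDerivAt_exp (b u)).comp u hb
  have hcd : DifferentiableAt ℝ c u := by
    rw [hc]
    have h : DifferentiableAt ℝ (fun v => exp (a v) * exp (b v) - 1) u :=
      (hea.mul' heb).differentiableAt.sub_const (1 : C.A)
    exact DifferentiableAt.fun_sum fun k _ => (h.fun_pow (k + 1)).fun_const_smul _
  have hec := (hasFDerivAt_exp (c u)).comp u hcd.hasFDerivAt
  have hprod : (exp ∘ c) = (exp ∘ a) * (exp ∘ b) := funext hexp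
  rw [hprod] at hec
  have h1 := congrArg (fun T : E →L[ℝ] C.A => exp (-c u) * T w) (hec.unique (hea.mul' heb))
  have hneg : exp (-c u) = exp (-b u) * exp (-a u) := by
    calc exp (-c u) = exp (-c u) * (exp (a u) * (exp (b u) * exp (-b u)) * exp (-a u)) := by
          rw [exp_mul_exp_neg, mul_one, exp_mul_exp_neg, mul_one]
      _ = exp (-c u) * (exp (a u) * exp (b u)) * (exp (-b u) * exp (-a u)) := by
          simp only [mul_assoc]
      _ = _ := by rw [← hexp, exp_neg_mul_exp, one_mul]
  have h2 : exp (-c u) * fderiv ℝ (exp : C.A → C.A) (c u) (fderiv ℝ c u w) =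
      exp (-b u) * (exp (-a u) * fderiv ℝ (exp : C.A → C.A) (a u) (C.liftCLM (fderiv ℝ α u w))) *
        exp (-(-b u)) +
      exp (-b u) * fderiv ℝ (exp : C.A → C.A) (b u) (C.liftCLM (fderiv ℝ β u w)) := by
    have h3 : exp (-c u) * fderiv ℝ (exp : C.A → C.A) (c u) (fderiv ℝ c u w) =
        exp (-c u) * (exp (a u) * fderiv ℝ (exp : C.A → C.A) (b u) (C.liftCLM (fderiv ℝ β u w)) +
          fderiv ℝ (exp : C.A → C.A) (a u) (C.liftCLM (fderiv ℝ α u w)) * exp (b u)) := h1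
    rw [h3, hneg, neg_neg, add_comm (exp (a u) * _), mul_add]
    congr 1
    · simp only [mul_assoc]
    · rw [mul_assoc, ← mul_assoc (exp (-a u)), exp_neg_mul_exp, one_mul]
  have hcw := C.hasFDerivAt_mem hcd.hasFDerivAt hcF w
  obtain ⟨ha1, ha2⟩ := C.proj_exp_neg_mul_fderiv (haF u) (C.lift_mem (fderiv ℝ α u w))
  obtain ⟨hb1, hb2⟩ := C.proj_exp_neg_mul_fderiv (hbF u) (C.lift_mem (fderiv ℝ β u w))
  obtain ⟨hc1, hc2⟩ := C.proj_exp_neg_mul_fderiv (hcF u) hcw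
  obtain ⟨hd1, hd2⟩ := C.proj_conj (neg_mem (hbF u)) ha1
  have hpc : ∀ v, C.projCLM (c v) = bch (α v) (β v) := fun v => by
    have := map_bch C.projLie (C.liftF (α v)) (C.liftF (β v))
    rwa [C.projLie_liftF, C.projLie_liftF] at this
  have hpd : fderiv ℝ (fun v => bch (α v) (β v)) u w = C.proj (fderiv ℝ c u w) := by
    have h4 := C.projCLM.hasFDerivAt.comp u hcd.hasFDerivAt
    have h5 : C.projCLM ∘ c = fun v => bch (α v) (β v) := funext hpc
    rw [h5] at h4
    rw [h4.fderiv]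
    rfl
  have h6 := congrArg C.proj h2
  rw [map_add] at h6
  have h7 : C.proj (c u) = bch (α u) (β u) := hpc u
  rw [mcForm_apply, mcForm_apply, mcForm_apply, hpd, ← h7, ← hc2, h6]
  congr 1
  · refine hd2.trans ?_
    have e1 : C.proj (-b u) = -β u := by rw [map_neg]; exact congrArg _ (C.proj_lift _)
    rw [e1]
    congr 1
    refine ha2.trans ?_
    rw [C.proj_lift]
    exact congrArg (fun z => dexpAd z _) (C.proj_lift _)
  · refine hb2.trans ?_
    rw [C.proj_lift]
    exact congrArg (fun z => dexpAd z _) (C.proj_lift _)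

/-- The differential at `a` of left translation by `a⁻¹`. -/
lemma fderiv_bch_neg (a v : 𝔤) : fderiv ℝ (fun z => bch (-a) z) a v = dexpAd a v := by
  have h := mcForm_bch (α := fun _ : 𝔤 => -a) (β := id) (u := a) (differentiableAt_const _)
    differentiableAt_id v
  rw [mcForm_apply, mcForm_apply, mcForm_apply] at h
  simp only [id, bch_neg_left] at h
  rw [adSeries_zero] at h
  simpa using h

lemma mcForm_const (a : 𝔤) (u : E) : mcForm (fun _ : E => a) u = 0 := by
  ext w
  rw [mcForm_apply]
  simp

lemma fderiv_eq_zero_of_mcForm_eq_zero {α : E → 𝔤} {u : E} (h : mcForm α u = 0) :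
    fderiv ℝ α u = 0 := by
  ext w
  exact eq_zero_of_dexpAd_eq_zero (congrArg (fun T : E →L[ℝ] 𝔤 => T w) h)

/-- `α (-α) = 1` at the level of forms. -/
lemma expAd_mcForm_neg {α : E → 𝔤} {u : E} (hα : DifferentiableAt ℝ α u) (w : E) :
    expAd (-α u) (mcForm (fun v => -α v) u w) = -mcForm α u w := by
  have h := mcForm_bch (α := fun v => -α v) (β := α) hα.neg hα w
  simp only [bch_neg_left, mcForm_const] at h
  exact eq_neg_of_add_eq_zero_left h.symm

lemma expAd_neg_cancel (a v : 𝔤) : expAd (-a) (expAd a v) = v := by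
  rw [← expAd_bch, bch_neg_left, adSeries_zero]
  simp

lemma expAd_cancel_neg (a v : 𝔤) : expAd a (expAd (-a) v) = v := by
  simpa using expAd_neg_cancel (-a) v

/-- The gauge transform of a form `η` by a function `a` with values in `exp(𝔤)`. -/
def gaugeForm (a : E → 𝔤) (η : E → E →L[ℝ] 𝔤) (u : E) : E →L[ℝ] 𝔤 :=
  (adCLM (fun k => (k ! : ℝ)⁻¹) (a u)).comp (η u) + mcForm (fun v => -a v) u

lemma gaugeForm_apply (a : E → 𝔤) (η : E → E →L[ℝ] 𝔤) (u w : E) :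
    gaugeForm a η u w = expAd (a u) (η u w) + mcForm (fun v => -a v) u w := rfl

/-- The curvature `dη + ½[η, η]`. -/
def curvature (η : E → E →L[ℝ] 𝔤) (u v w : E) : 𝔤 :=
  fderiv ℝ η u v w - fderiv ℝ η u w v + ⁅η u v, η u w⁆

/-- The computation behind the transformation rule of the curvature. With `V = U⁻¹`, the gauge
transform of a form with values `a`, `b` at two vectors takes there the values `U a V + U ra` and
`U b V + U rb`, where `ra`, `rb` are the derivatives of `V`. The first two lines are the derivatives
of these values, where `da`, `db` come from the form and `s` from the second derivative of `V`. -/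
lemma curvature_algebra {R : Type*} [Ring R] (U V a b ra rb da db s : R) (h : V * U = 1) :
    (-(U * ra * U) * b * V + U * da * V + U * b * ra - U * ra * U * rb + U * s) -
      (-(U * rb * U) * a * V + U * db * V + U * a * rb - U * rb * U * ra + U * s) +
      ((U * a * V + U * ra) * (U * b * V + U * rb) -
        (U * b * V + U * rb) * (U * a * V + U * ra)) =
      U * (da - db + (a * b - b * a)) * V := by
  have e1 : ∀ p q : R, U * p * V * (U * q * V) = U * (p * q) * V := fun p q => by
    calc U * p * V * (U * q * V) = U * p * (V * U) * q * V := by noncomm_ring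
      _ = _ := by rw [h]; noncomm_ring
  have e2 : ∀ p q : R, U * p * V * (U * q) = U * p * q := fun p q => by
    calc U * p * V * (U * q) = U * p * (V * U) * q := by noncomm_ring
      _ = _ := by rw [h]; noncomm_ring
  simp only [mul_add, add_mul, e1, e2]
  noncomm_ring

/-- The curvature of a gauge transform. -/
theorem curvature_gaugeForm {a : E → 𝔤} {η : E → E →L[ℝ] 𝔤} {u : E} (ha : ContDiffAt ℝ ∞ a u)
    (hη : DifferentiableAt ℝ η u) (hd : DifferentiableAt ℝ (gaugeForm a η) u) (v w : E) :
    curvature (gaugeForm a η) u v w = expAd (a u) (curvature η u v w) := by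
  obtain ⟨C⟩ := exists_assocCover 𝔤
  let U : E → C.A := fun v => exp (C.liftCLM (a v))
  let V : E → C.A := fun v => exp (-C.liftCLM (a v))
  have hVU : ∀ v, V v * U v = 1 := fun v => exp_neg_mul_exp _
  have hUV : ∀ v, U v * V v = 1 := fun v => exp_mul_exp_neg _
  have hUs : ContDiffAt ℝ ∞ U u := contDiff_exp.contDiffAt.comp u
    (C.liftCLM.contDiff.contDiffAt.comp u ha)
  have hVs : ContDiffAt ℝ ∞ V u := contDiff_exp.contDiffAt.comp u
    (C.liftCLM.contDiff.contDiffAt.comp u ha).neg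
  have hU := (hUs.differentiableAt (by simp)).hasFDerivAt
  have hV := (hVs.differentiableAt (by simp)).hasFDerivAt
  have hV2 : HasFDerivAt (fderiv ℝ V) (fderiv ℝ (fderiv ℝ V) u) u :=
    ((hVs.fderiv_right (m := ∞) (by simp)).differentiableAt (by simp)).hasFDerivAt
  have hsymm : ∀ p q, fderiv ℝ (fderiv ℝ V) u p q = fderiv ℝ (fderiv ℝ V) u q p := fun p q =>
    second_derivative_symmetric_of_eventually
      (((hVs.of_le (m := 1) (by simp)).eventually (by simp)).mono fun z hz =>
        (hz.differentiableAt (by simp)).hasFDerivAt) hV2 p q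
  have hU' : ∀ p, fderiv ℝ U u p = -(U u * fderiv ℝ V u p * U u) := by
    intro p
    have h1 := hU.mul' hV
    have h2 : U * V = fun _ => 1 := funext hUV
    rw [h2] at h1
    have h3 := congrArg (fun T : E →L[ℝ] C.A => T p) (h1.unique (hasFDerivAt_const _ _))
    have h4 : U u * fderiv ℝ V u p + fderiv ℝ U u p * V u = 0 := h3
    calc fderiv ℝ U u p = fderiv ℝ U u p * V u * U u := by rw [mul_assoc, hVU, mul_one]
      _ = _ := by rw [eq_neg_of_add_eq_zero_right h4, neg_mul]
  have hηl : ∀ q, HasFDerivAt (fun z => C.liftCLM (η z q))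
      (C.liftCLM.comp ((ContinuousLinearMap.apply ℝ 𝔤 q).comp (fderiv ℝ η u))) u := fun q =>
    C.liftCLM.hasFDerivAt.comp u ((ContinuousLinearMap.apply ℝ 𝔤 q).hasFDerivAt.comp u
      hη.hasFDerivAt)
  -- `B z q` is a lift of the gauge transform to the associative algebra.
  let B : E → E → C.A := fun z q => U z * C.liftCLM (η z q) * V z + U z * fderiv ℝ V z q
  have hB : ∀ z q, DifferentiableAt ℝ a z → B z q ∈ C.F ∧ C.proj (B z q) = gaugeForm a η z q := by
    intro z q hz
    obtain ⟨h1, h2⟩ := C.proj_conj (C.lift_mem (a z)) (C.lift_mem (η z q))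
    have h3 : fderiv ℝ V z q = fderiv ℝ (exp : C.A → C.A) (-C.lift (a z))
        (-C.lift (fderiv ℝ a z q)) := by
      have h4 := (hasFDerivAt_exp (-C.liftCLM (a z))).comp z
        (C.liftCLM.hasFDerivAt.comp z hz.hasFDerivAt).neg
      exact congrArg (fun T : E →L[ℝ] C.A => T q) h4.fderiv
    obtain ⟨h5, h6⟩ := C.proj_exp_neg_mul_fderiv (neg_mem (C.lift_mem (a z)))
      (neg_mem (C.lift_mem (fderiv ℝ a z q)))
    rw [neg_neg] at h5 h6
    refine ⟨add_mem h1 (by rw [h3]; exact h5), ?_⟩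
    rw [map_add, gaugeForm_apply, h3]
    congr 1
    · refine h2.trans ?_
      rw [C.proj_lift, C.proj_lift]
    · refine h6.trans ?_
      rw [mcForm_apply, fderiv_fun_neg, map_neg, map_neg, C.proj_lift, C.proj_lift]
      rfl
  have hBd : ∀ q, HasFDerivAt (fun z => B z q) (fderiv ℝ (fun z => B z q) u) u ∧
      ∀ p, fderiv ℝ (fun z => B z q) u p =
        -(U u * fderiv ℝ V u p * U u) * C.lift (η u q) * V u + U u * C.lift (fderiv ℝ η u p q) * V u
          + U u * C.lift (η u q) * fderiv ℝ V u p - U u * fderiv ℝ V u p * U u * fderiv ℝ V u q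
          + U u * fderiv ℝ (fderiv ℝ V) u p q := by
    intro q
    have h1 := ((hU.mul' (hηl q)).mul' hV).add
      (hU.mul' ((ContinuousLinearMap.apply ℝ C.A q).hasFDerivAt.comp u hV2))
    have h2 : HasFDerivAt (fun z => B z q) _ u := h1
    refine ⟨h2.differentiableAt.hasFDerivAt, fun p => ?_⟩
    rw [h2.fderiv]
    change (U u * C.lift (η u q)) * fderiv ℝ V u p +
      (U u * C.lift (fderiv ℝ η u p q) + fderiv ℝ U u p * C.lift (η u q)) * V u +
      (U u * fderiv ℝ (fderiv ℝ V) u p q + fderiv ℝ U u p * fderiv ℝ V u q) = _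
    rw [hU']
    noncomm_ring
  have hproj : ∀ p q, fderiv ℝ (gaugeForm a η) u p q = C.proj (fderiv ℝ (fun z => B z q) u p) := by
    intro p q
    have h1 := (ContinuousLinearMap.apply ℝ 𝔤 q).hasFDerivAt.comp u hd.hasFDerivAt
    have h2 := C.projCLM.hasFDerivAt.comp u (hBd q).1
    have h3 : (ContinuousLinearMap.apply ℝ 𝔤 q) ∘ gaugeForm a η =ᶠ[𝓝 u]
        C.projCLM ∘ fun z => B z q := by
      filter_upwards [(ha.of_le (m := 1) (by simp)).eventually (by simp)] with z hz
      exact (hB z q (hz.differentiableAt (by simp))).2.symm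
    exact congrArg (fun T : E →L[ℝ] 𝔤 => T p) ((h1.congr_of_eventuallyEq h3.symm).unique h2)
  have had := ha.differentiableAt (by simp)
  have hlie : ⁅gaugeForm a η u v, gaugeForm a η u w⁆ = C.proj ⁅B u v, B u w⁆ := by
    rw [C.proj_lie _ (hB u v had).1 _ (hB u w had).1, (hB u v had).2, (hB u w had).2]
  rw [curvature, hproj, hproj, hlie, ← map_sub, ← map_add, (hBd w).2, (hBd v).2, hsymm w v,
    Ring.lie_def]
  refine (congrArg C.proj (curvature_algebra _ _ _ _ _ _ _ _ _ (hVU u))).trans ?_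
  have hm : C.lift (fderiv ℝ η u v w) - C.lift (fderiv ℝ η u w v) +
      (C.lift (η u v) * C.lift (η u w) - C.lift (η u w) * C.lift (η u v)) ∈ C.F :=
    add_mem (sub_mem (C.lift_mem _) (C.lift_mem _)) (C.F.lie_mem (C.lift_mem _) (C.lift_mem _))
  refine (C.proj_conj (C.lift_mem (a u)) hm).2.trans ?_
  rw [C.proj_lift, map_add, map_sub, C.proj_lift, C.proj_lift]
  have h1 := C.proj_lie _ (C.lift_mem (η u v)) _ (C.lift_mem (η u w))
  rw [C.proj_lift, C.proj_lift, Ring.lie_def] at h1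
  rw [h1]
  rfl

end Calculus

/-! ### Local integrability of Maurer-Cartan forms -/

section Integrability

variable {X : Type u} [TopologicalSpace X] {x : X} {𝔤 : NilpRep x}
variable {E : Type*} [NormedAddCommGroup E] [NormedSpace ℝ E]
variable {E' : Type*} [NormedAddCommGroup E'] [NormedSpace ℝ E']

lemma contDiffAt_fderiv {F : Type*} [NormedAddCommGroup F] [NormedSpace ℝ F] {f : E → F} {u : E}
    (hf : ContDiffAt ℝ ∞ f u) : ContDiffAt ℝ ∞ (fderiv ℝ f) u :=
  hf.fderiv_right (m := ∞) (by simp)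

lemma ContDiffAt.mcForm {α : E → 𝔤} {u : E} (hα : ContDiffAt ℝ ∞ α u) :
    ContDiffAt ℝ ∞ (mcForm α) u :=
  ((contDiff_adCLM _).contDiffAt.comp u hα).clm_comp (contDiffAt_fderiv hα)

lemma ContDiffAt.gaugeForm {a : E → 𝔤} {η : E → E →L[ℝ] 𝔤} {u : E} (ha : ContDiffAt ℝ ∞ a u)
    (hη : ContDiffAt ℝ ∞ η u) : ContDiffAt ℝ ∞ (gaugeForm a η) u :=
  (((contDiff_adCLM _).contDiffAt.comp u ha).clm_comp hη).add (ContDiffAt.mcForm ha.neg)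

lemma mcForm_congr {α β : E → 𝔤} {u : E} (h : α =ᶠ[𝓝 u] β) : mcForm α u = mcForm β u := by
  rw [mcForm, mcForm, h.fderiv_eq, h.eq_of_nhds]

lemma mcForm_comp {α : E' → 𝔤} {τ : E → E'} {u : E} (hα : DifferentiableAt ℝ α (τ u))
    (hτ : DifferentiableAt ℝ τ u) :
    mcForm (α ∘ τ) u = (mcForm α (τ u)).comp (fderiv ℝ τ u) := by
  rw [mcForm, mcForm, fderiv_comp u hα hτ]
  rfl

/-- If `η` is the form of `α`, then the form of `α a` is obtained from `η`. -/
lemma mcForm_bch_of_eq_gaugeForm {β f : E → 𝔤} {η : E → E →L[ℝ] 𝔤} {u : E}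
    (hβ : DifferentiableAt ℝ β u) (hf : DifferentiableAt ℝ f u)
    (h : mcForm β u = gaugeForm f η u) : mcForm (fun v => bch (β v) (f v)) u = η u := by
  ext w
  rw [mcForm_bch hβ hf, h, gaugeForm_apply, map_add, expAd_neg_cancel, expAd_mcForm_neg hf]
  abel

lemma curvature_congr {η η' : E → E →L[ℝ] 𝔤} {u : E} (h : η =ᶠ[𝓝 u] η') (v w : E) :
    curvature η u v w = curvature η' u v w := by
  rw [curvature, curvature, h.fderiv_eq, h.eq_of_nhds]

/-- The form `α⁻¹ dα` is a Maurer-Cartan element. -/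
theorem curvature_mcForm {α : E → 𝔤} {u : E} (hα : ContDiffAt ℝ ∞ α u) (v w : E) :
    curvature (mcForm α) u v w = 0 := by
  have h : gaugeForm (fun z => -α z) (fun _ => (0 : E →L[ℝ] 𝔤)) = mcForm α := by
    funext z
    ext w
    simp [gaugeForm_apply]
  have h1 := curvature_gaugeForm (η := fun _ => (0 : E →L[ℝ] 𝔤)) hα.neg
    (differentiableAt_const _) (by rw [h]; exact (ContDiffAt.mcForm hα).differentiableAt (by simp))
    v w
  rw [h] at h1
  rw [h1]
  simp [curvature]

/-- The curvature of a pullback. -/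
theorem curvature_pullback {κ : E' → E' →L[ℝ] 𝔤} {τ : E → E'} {u : E} (hτ : ContDiffAt ℝ ∞ τ u)
    (hκ : DifferentiableAt ℝ κ (τ u)) (v w : E) :
    curvature (fun z => (κ (τ z)).comp (fderiv ℝ τ z)) u v w =
      curvature κ (τ u) (fderiv ℝ τ u v) (fderiv ℝ τ u w) := by
  have h1 := hκ.hasFDerivAt.comp u (hτ.differentiableAt (by simp)).hasFDerivAt
  have h2 : HasFDerivAt (fderiv ℝ τ) (fderiv ℝ (fderiv ℝ τ) u) u :=
    ((contDiffAt_fderiv hτ).differentiableAt (by simp)).hasFDerivAt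
  have hsymm : fderiv ℝ (fderiv ℝ τ) u v w = fderiv ℝ (fderiv ℝ τ) u w v :=
    second_derivative_symmetric_of_eventually
      (by
        have := ((hτ.of_le (m := 1) (by simp)).eventually (by simp)).mono fun z hz =>
          (hz.differentiableAt (by simp)).hasFDerivAt
        exact this) h2 v w
  have h3 : HasFDerivAt (fun z => (κ (τ z)).comp (fderiv ℝ τ z)) _ u := h1.clm_comp h2
  rw [curvature, curvature, h3.fderiv]
  simp [hsymm]

/-- A linear projection along `p`; it is the identity modulo `p`. -/
lemma exists_proj_mod (p : Submodule ℝ 𝔤) :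
    ∃ q : 𝔤 →L[ℝ] 𝔤, (∀ v ∈ p, q v = 0) ∧ ∀ v, v - q v ∈ p := by
  obtain ⟨r, hr⟩ := p.subtype.exists_leftInverse_of_injective (Submodule.ker_subtype _)
  refine ⟨LinearMap.toContinuousLinearMap (LinearMap.id - p.subtype ∘ₗ r), fun v hv => ?_,
    fun v => ?_⟩
  · have h : r v = ⟨v, hv⟩ := congrArg (fun T => T ⟨v, hv⟩) hr
    simp [h]
  · simp

/-- A gauge transformation which brings a Maurer-Cartan form with values in one term of the lower
central series into the next one. -/
lemma exists_gaugeForm_mem_lcs {S : Set E} (hS : Convex ℝ S) (hSo : IsOpen S)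
    {η : E → E →L[ℝ] 𝔤} (hη : ContDiffOn ℝ ∞ η S)
    (hc : ∀ u ∈ S, ∀ v w, curvature η u v w = 0) {j : ℕ}
    (hj : ∀ u ∈ S, ∀ v, η u v ∈ lcs 𝔤 j) :
    ∃ f : E → 𝔤, ContDiffOn ℝ ∞ f S ∧ ∀ u ∈ S, ∀ v, gaugeForm f η u v ∈ lcs 𝔤 (j + 1) := by
  obtain ⟨q, hq0, hq⟩ := exists_proj_mod (lcs 𝔤 (j + 1)).toSubmodule
  obtain ⟨r, hr0, hr⟩ := exists_proj_mod (𝔤 := 𝔤) (lcs 𝔤 j).toSubmodule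
  have hηd : ∀ u ∈ S, DifferentiableAt ℝ η u := fun u hu =>
    ((hη.contDiffAt (hSo.mem_nhds hu)).differentiableAt (by simp))
  have hqd : ∀ u ∈ S, HasFDerivAt (fun z => q.comp (η z))
      ((ContinuousLinearMap.compL ℝ E 𝔤 𝔤 q).comp (fderiv ℝ η u)) u := fun u hu =>
    (ContinuousLinearMap.compL ℝ E 𝔤 𝔤 q).hasFDerivAt.comp u (hηd u hu).hasFDerivAt
  -- The bracket of two elements of `lcs 𝔤 j` lies in `lcs 𝔤 (j + 1)`. Hence the Maurer-Cartan
  -- equation says that `q ∘ η` is closed, and it has a primitive `g` by the Poincaré lemma.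
  obtain ⟨g, hg⟩ := hS.exists_forall_hasFDerivAt_of_fderiv_symmetric hSo
    (show DifferentiableOn ℝ (fun z => q.comp (η z)) S from
      fun u hu => (hqd u hu).differentiableAt.differentiableWithinAt) (fun u hu v w => by
      rw [(hqd u hu).fderiv]
      change q (fderiv ℝ η u v w) = q (fderiv ℝ η u w v)
      have h1 := congrArg q (hc u hu v w)
      rw [curvature, map_add, map_sub, map_zero,
        hq0 _ (lie_mem_lcs_succ (η u v) (hj u hu w)), add_zero] at h1
      exact sub_eq_zero.1 h1)
  have hgs : ContDiffOn ℝ ∞ g S := by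
    rw [contDiffOn_infty_iff_fderiv_of_isOpen hSo]
    refine ⟨fun u hu => (hg u hu).differentiableAt.differentiableWithinAt, ?_⟩
    exact (contDiffOn_const.clm_comp hη).congr fun u hu => (hg u hu).fderiv
  -- The projection `s` to `lcs 𝔤 j` moves the values of `g` there without changing `dg = q ∘ η`.
  let s : 𝔤 →L[ℝ] 𝔤 := ContinuousLinearMap.id ℝ 𝔤 - r
  have hs : ∀ v, s v ∈ lcs 𝔤 j := hr
  have hsη : ∀ u ∈ S, ∀ v, s (q (η u v)) = q (η u v) := fun u hu v => by
    have h1 : q (η u v) ∈ lcs 𝔤 j := by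
      have := sub_mem (hj u hu v) (lcs_succ_le j (hq (η u v)))
      rwa [sub_sub_cancel] at this
    change q (η u v) - r (q (η u v)) = _
    rw [hr0 _ h1, sub_zero]
  refine ⟨fun z => s (g z), s.contDiff.comp_contDiffOn hgs, fun u hu v => ?_⟩
  have hd : ∀ v, fderiv ℝ (fun z => -s (g z)) u v = -q (η u v) := fun v => by
    have h : HasFDerivAt (fun z => -s (g z)) (-(s.comp (q.comp (η u)))) u :=
      (s.hasFDerivAt.comp u (hg u hu)).neg
    rw [h.fderiv, ← hsη u hu v]
    rfl
  have h1 := adSeries_sub_mem_of_left (fun k => (k ! : ℝ)⁻¹) (hs (g u)) (η u v)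
  have h2 := adSeries_sub_mem_of_left (fun k => (-1) ^ k * ((k + 1)! : ℝ)⁻¹)
    (neg_mem (hs (g u))) (-q (η u v))
  rw [gaugeForm_apply, mcForm_apply, hd]
  have h3 := add_mem (add_mem h1 h2) (hq (η u v))
  convert h3 using 1
  simp only [Nat.factorial_zero, Nat.cast_one, inv_one, one_smul, pow_zero, mul_one, zero_add,
    Nat.factorial_one]
  abel

/-- A Maurer-Cartan form on a convex open set is of the form `α⁻¹ dα`. -/
theorem exists_mcForm_eq {S : Set E} (hS : Convex ℝ S) (hSo : IsOpen S)
    {η : E → E →L[ℝ] 𝔤} (hη : ContDiffOn ℝ ∞ η S)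
    (hc : ∀ u ∈ S, ∀ v w, curvature η u v w = 0) :
    ∃ α : E → 𝔤, ContDiffOn ℝ ∞ α S ∧ ∀ u ∈ S, mcForm α u = η u := by
  obtain ⟨N, hN⟩ := LieModule.IsNilpotent.nilpotent ℝ 𝔤 𝔤
  -- Descending induction on the term of the lower central series which contains the values of `η`.
  suffices h : ∀ i j : ℕ, i + j = N → ∀ η : E → E →L[ℝ] 𝔤, ContDiffOn ℝ ∞ η S →
      (∀ u ∈ S, ∀ v w, curvature η u v w = 0) → (∀ u ∈ S, ∀ v, η u v ∈ lcs 𝔤 j) →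
      ∃ α : E → 𝔤, ContDiffOn ℝ ∞ α S ∧ ∀ u ∈ S, mcForm α u = η u from
    h N 0 (by omega) η hη hc fun u _ v => by simp [lcs]
  intro i
  induction i with
  | zero =>
    intro j hj η _ _ hηj
    refine ⟨fun _ => 0, contDiffOn_const, fun u hu => ?_⟩
    rw [mcForm_const]
    ext v
    have := hηj u hu v
    rw [show j = N by omega, lcs, hN, LieSubmodule.mem_bot] at this
    rw [this]
    rfl
  | succ i ih =>
    intro j hj η hη hc hηj
    obtain ⟨f, hf, hfj⟩ := exists_gaugeForm_mem_lcs hS hSo hη hc hηj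
    have hnhds : ∀ u ∈ S, S ∈ 𝓝 u := fun u hu => hSo.mem_nhds hu
    have hg : ∀ u ∈ S, ContDiffAt ℝ ∞ (gaugeForm f η) u := fun u hu =>
      ContDiffAt.gaugeForm (hf.contDiffAt (hnhds u hu)) (hη.contDiffAt (hnhds u hu))
    obtain ⟨β, hβ, hβη⟩ := ih (j + 1) (by omega) (gaugeForm f η)
      (fun u hu => (hg u hu).contDiffWithinAt)
      (fun u hu v w => by
        rw [curvature_gaugeForm (hf.contDiffAt (hnhds u hu))
          ((hη.contDiffAt (hnhds u hu)).differentiableAt (by simp))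
          ((hg u hu).differentiableAt (by simp)), hc u hu, map_zero]) hfj
    refine ⟨fun u => bch (β u) (f u), 𝔤.contDiff_bch.comp_contDiffOn (hβ.prodMk hf),
      fun u hu => ?_⟩
    exact mcForm_bch_of_eq_gaugeForm ((hβ.contDiffAt (hnhds u hu)).differentiableAt (by simp))
      ((hf.contDiffAt (hnhds u hu)).differentiableAt (by simp)) (hβη u hu)

end Integrability

/-! ### Branches at different points of a chart -/

section Geometry

variable {n : ℕ} {X : Type u} [TopologicalSpace X] [ChartedSpace (EuclideanSpace ℝ (Fin n)) X]
  {x : X}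

local notation "𝓔" => EuclideanSpace ℝ (Fin n)

omit [ChartedSpace 𝓔 X] in
/-- Two paths with the same endpoints in a convex part of a chart are homotopic. -/
lemma homotopic_of_mem_chart {e : OpenPartialHomeomorph X 𝓔} {B : Set 𝓔} (hB : Convex ℝ B)
    (hBe : B ⊆ e.target) {a b : X} {γ γ' : Path a b} (h : ∀ t, γ t ∈ e.source ∩ e ⁻¹' B)
    (h' : ∀ t, γ' t ∈ e.source ∩ e ⁻¹' B) : γ.Homotopic γ' := by
  have hc : Continuous fun t => e (γ t) :=
    e.continuousOn.comp_continuous γ.continuous fun t => (h t).1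
  have hc' : Continuous fun t => e (γ' t) :=
    e.continuousOn.comp_continuous γ'.continuous fun t => (h' t).1
  have hmem : ∀ q : unitInterval × unitInterval,
      AffineMap.lineMap (e (γ q.2)) (e (γ' q.2)) (q.1 : ℝ) ∈ B := fun q =>
    hB.segment_subset (h q.2).2 (h' q.2).2 (by
      rw [segment_eq_image_lineMap]
      exact ⟨q.1, q.1.2, rfl⟩)
  refine ⟨⟨⟨⟨fun q => e.symm (AffineMap.lineMap (e (γ q.2)) (e (γ' q.2)) (q.1 : ℝ)), ?_⟩,
    fun t => ?_, fun t => ?_⟩, fun s t ht => ?_⟩⟩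
  · refine e.continuousOn_symm.comp_continuous ?_ fun q => hBe (hmem q)
    simp only [AffineMap.lineMap_apply_module]
    have h1 : Continuous fun q : unitInterval × unitInterval => e (γ q.2) := hc.comp continuous_snd
    have h2 : Continuous fun q : unitInterval × unitInterval => e (γ' q.2) :=
      hc'.comp continuous_snd
    have h0 : Continuous fun q : unitInterval × unitInterval => (q.1 : ℝ) :=
      continuous_subtype_val.comp continuous_fst
    exact ((continuous_const.sub h0).smul h1).add (h0.smul h2)
  · simp [e.left_inv (h t).1]
  · simp [e.left_inv (h' t).1]
  · have : γ' t = γ t := by rcases ht with rfl | rfl <;> simp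
    change e.symm (AffineMap.lineMap (e (γ t)) (e (γ' t)) (s : ℝ)) = γ t
    rw [this, AffineMap.lineMap_same_apply, e.left_inv (h t).1]

omit [ChartedSpace 𝓔 X] in
/-- Two points of the universal cover with the same image in `X` coincide if they are joined to
the same point by paths over a convex part of a chart. -/
lemma Raw.apply_eq_of_mem_chart {U : Opens X} {T : Type*} (s : Raw x U T) {y a b : X} (ha : a ∈ U)
    (hb : b ∈ U) (hab : a = b) (p : FundamentalGroupoid.mk x ⟶ FundamentalGroupoid.mk y)
    (γ : Path y a) (γ' : Path y b) {e : OpenPartialHomeomorph X 𝓔} {B : Set 𝓔} (hB : Convex ℝ B)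
    (hBe : B ⊆ e.target) (h : ∀ t, γ t ∈ e.source ∩ e ⁻¹' B)
    (h' : ∀ t, γ' t ∈ e.source ∩ e ⁻¹' B) :
    s ⟨a, ha⟩ (p ≫ FundamentalGroupoid.fromPath ⟦γ⟧) =
      s ⟨b, hb⟩ (p ≫ FundamentalGroupoid.fromPath ⟦γ'⟧) := by
  subst hab
  have : (⟦γ⟧ : Path.Homotopic.Quotient y a) = ⟦γ'⟧ :=
    Quotient.sound (homotopic_of_mem_chart hB hBe h h')
  rw [this]

variable (n) in
/-- The ball of radius `r` around the coordinate of `y` in the chart at `y` lies in the domain of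
the inverse chart, which maps it to `U`. -/
def IsChartBall (U : Opens X) (y : X) (r : ℝ) : Prop :=
  0 < r ∧ ∀ u ∈ Metric.ball (chart n y y) r, u ∈ (chart n y).target ∧ (chart n y).symm u ∈ U

lemma exists_isChartBall {U : Opens X} {y : X} (hy : y ∈ U) : ∃ r, IsChartBall n U y r := by
  have h1 : (chart n y).target ∈ 𝓝 (chart n y y) := chart_target_mem_nhds _ y
  have h2 : (chart n y).symm ⁻¹' (U : Set X) ∈ 𝓝 (chart n y y) := by
    refine (chart n y).continuousAt_symm ((chart n y).map_source (mem_chart_source _ y))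
      (U.isOpen.mem_nhds ?_)
    rwa [(chart n y).left_inv (mem_chart_source _ y)]
  obtain ⟨r, hr, h⟩ := Metric.mem_nhds_iff.1 (Filter.inter_mem h1 h2)
  exact ⟨r, hr, fun u hu => h hu⟩

namespace IsChartBall

variable {U V : Opens X} {y : X} {r : ℝ} {T : Type*} [Zero T]

lemma mono (h : IsChartBall n U y r) (hUV : U ≤ V) : IsChartBall n V y r :=
  ⟨h.1, fun u hu => ⟨(h.2 u hu).1, hUV (h.2 u hu).2⟩⟩

lemma mem_ball (h : IsChartBall n U y r) : chart n y y ∈ Metric.ball (chart n y y) r :=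
  Metric.mem_ball_self h.1

lemma ball_mem_nhds (h : IsChartBall n U y r) : Metric.ball (chart n y y) r ∈ 𝓝 (chart n y y) :=
  Metric.ball_mem_nhds _ h.1

lemma segment_subset_ball (h : IsChartBall n U y r) {u : 𝓔}
    (hu : u ∈ Metric.ball (chart n y y) r) :
    segment ℝ (chart n y y) u ⊆ Metric.ball (chart n y y) r :=
  (convex_ball _ _).segment_subset h.mem_ball hu

lemma segment_subset (h : IsChartBall n U y r) {u : 𝓔} (hu : u ∈ Metric.ball (chart n y y) r) :
    segment ℝ (chart n y y) u ⊆ (chart n y).target := fun v hv =>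
  (h.2 v (h.segment_subset_ball hu hv)).1

/-- The image of the ball, an open subset of `X`. -/
def opens (_ : IsChartBall n U y r) : Opens X :=
  ⟨(chart n y).source ∩ chart n y ⁻¹' Metric.ball (chart n y y) r,
    (chart n y).isOpen_inter_preimage Metric.isOpen_ball⟩

lemma mem_opens (h : IsChartBall n U y r) : y ∈ h.opens :=
  ⟨mem_chart_source _ y, h.mem_ball⟩

lemma opens_le (h : IsChartBall n U y r) : h.opens ≤ U := fun z hz => by
  have := (h.2 _ hz.2).2
  rwa [(chart n y).left_inv hz.1] at this

lemma symm_mem_opens (h : IsChartBall n U y r) {u : 𝓔} (hu : u ∈ Metric.ball (chart n y y) r) :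
    (chart n y).symm u ∈ h.opens :=
  ⟨(chart n y).map_target (h.2 u hu).1, by
    rwa [Set.mem_preimage, (chart n y).right_inv (h.2 u hu).1]⟩

lemma chartPath_mem_opens (h : IsChartBall n U y r) {u : 𝓔}
    (hu : u ∈ Metric.ball (chart n y y) r) (t : unitInterval) :
    chartPath n y u (h.segment_subset hu) t ∈ h.opens :=
  h.symm_mem_opens (h.segment_subset_ball hu (by
    rw [segment_eq_image_lineMap]
    exact ⟨t, t.2, rfl⟩))

lemma branch_eq (h : IsChartBall n U y r) (s : Raw x U T) (hy : y ∈ U)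
    (p : FundamentalGroupoid.mk x ⟶ FundamentalGroupoid.mk y) {u : 𝓔}
    (hu : u ∈ Metric.ball (chart n y y) r) :
    branch n s ⟨y, hy⟩ p u = s ⟨(chart n y).symm u, (h.2 u hu).2⟩
      (p ≫ FundamentalGroupoid.fromPath ⟦chartPath n y u (h.segment_subset hu)⟧) := by
  rw [branch, dif_pos ⟨h.segment_subset hu, (h.2 u hu).2⟩]

/-- Any path inside the ball can be used to compute a branch. -/
lemma branch_eq_of_path (h : IsChartBall n U y r) (s : Raw x U T) (hy : y ∈ U)
    (p : FundamentalGroupoid.mk x ⟶ FundamentalGroupoid.mk y) {u : 𝓔}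
    (hu : u ∈ Metric.ball (chart n y y) r) {z : X} (hz : z ∈ U) (hzu : (chart n y).symm u = z)
    (γ : Path y z) (hγ : ∀ t, γ t ∈ h.opens) :
    branch n s ⟨y, hy⟩ p u = s ⟨z, hz⟩ (p ≫ FundamentalGroupoid.fromPath ⟦γ⟧) := by
  rw [h.branch_eq s hy p hu]
  exact Raw.apply_eq_of_mem_chart s _ _ hzu p _ _ (convex_ball _ _) (fun u hu => (h.2 u hu).1)
    (h.chartPath_mem_opens hu) hγ

/-- Branches at two points of a chart ball, over a path in the ball, agree up to the change of
coordinates. -/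
lemma branch_eventuallyEq (h : IsChartBall n U y r) (s : Raw x U T) (hy : y ∈ U)
    (p : FundamentalGroupoid.mk x ⟶ FundamentalGroupoid.mk y) {z : X} (hz : z ∈ U) (γ : Path y z)
    (hγ : ∀ t, γ t ∈ h.opens) :
    branch n s ⟨z, hz⟩ (p ≫ FundamentalGroupoid.fromPath ⟦γ⟧) =ᶠ[𝓝 (chart n z z)]
      fun u => branch n s ⟨y, hy⟩ p (chart n y ((chart n z).symm u)) := by
  have hzo : z ∈ h.opens := by simpa using hγ 1
  obtain ⟨r', h'⟩ := exists_isChartBall (n := n) hzo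
  filter_upwards [h'.ball_mem_nhds] with u hu
  have hm := (h'.2 u hu).2
  rw [(h'.mono h.opens_le).branch_eq s hz _ hu,
    h.branch_eq_of_path s hy p hm.2 (h.opens_le hm) ((chart n y).left_inv hm.1)
      (γ.trans (chartPath n z u (h'.segment_subset hu))) (fun t => ?_), Category.assoc]
  · rfl
  · have := Set.mem_range_self (f := γ.trans (chartPath n z u (h'.segment_subset hu))) t
    rw [Path.trans_range] at this
    rcases this with ⟨t, ht⟩ | ⟨t, ht⟩
    · exact ht ▸ hγ t
    · exact ht ▸ h'.opens_le (h'.chartPath_mem_opens hu t)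

end IsChartBall

/-- The branch at a point takes the value of the function there. -/
@[simp]
lemma branch_self {U : Opens X} {T : Type*} [Zero T] (s : Raw x U T) (y : U)
    (p : FundamentalGroupoid.mk x ⟶ FundamentalGroupoid.mk y.1) :
    branch n s y p (chart n y.1 y.1) = s y p := by
  obtain ⟨r, h⟩ := exists_isChartBall (n := n) y.2
  rw [h.branch_eq_of_path s y.2 p h.mem_ball y.2 ((chart n y.1).left_inv (mem_chart_source _ y.1))
    (Path.refl y.1) fun t => h.mem_opens]
  exact congrArg (s y) (Category.comp_id p)

end Geometry

/-! ### Changes of coordinates -/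

section Transition

variable {n : ℕ} {X : Type u} [TopologicalSpace X] [ChartedSpace (EuclideanSpace ℝ (Fin n)) X]
  {x : X}

local notation "𝓔" => EuclideanSpace ℝ (Fin n)

variable (n) in
/-- The change of coordinates from the chart at `y` to the chart at `z`. -/
def transition (y z : X) : 𝓔 → 𝓔 := fun u => chart n z ((chart n y).symm u)

variable [IsManifold (𝓡 n) ∞ X]

lemma contDiffAt_transition {y z : X} {u : 𝓔} (hu : u ∈ (chart n y).target)
    (hz : (chart n y).symm u ∈ (chart n z).source) : ContDiffAt ℝ ∞ (transition n y z) u := by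
  have h1 : ContMDiffAt (𝓡 n) (𝓡 n) ∞ (chart n y).symm u :=
    contMDiffOn_chart_symm.contMDiffAt ((chart n y).open_target.mem_nhds hu)
  have h2 : ContMDiffAt (𝓡 n) (𝓡 n) ∞ (chart n z) ((chart n y).symm u) :=
    contMDiffOn_chart.contMDiffAt ((chart n z).open_source.mem_nhds hz)
  exact contMDiffAt_iff_contDiffAt.1 (h2.comp u h1)

lemma mdifferentiableAt_chart_symm {y : X} {u : 𝓔} (hu : u ∈ (chart n y).target) :
    MDifferentiableAt (𝓡 n) (𝓡 n) (chart n y).symm u :=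
  (contMDiffOn_chart_symm (n := ∞).contMDiffAt
    ((chart n y).open_target.mem_nhds hu)).mdifferentiableAt (by simp)

lemma chartDeriv_self (y : X) : chartDeriv n y (chart n y y) = ContinuousLinearMap.id ℝ 𝓔 := by
  have hy := (chart n y).map_source (mem_chart_source 𝓔 y)
  have h : chartDeriv n y (chart n y y) =
      fderiv ℝ (transition n y ((chart n y).symm (chart n y y))) (chart n y y) := by
    refine (if_pos (mdifferentiableAt_chart_symm hy)).trans ?_
    simp only [writtenInExtChartAt, mfld_simps, fderivWithin_univ]
    rfl
  rw [h, (chart n y).left_inv (mem_chart_source 𝓔 y)]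
  have h1 : transition n y y =ᶠ[𝓝 (chart n y y)] id := by
    filter_upwards [(chart n y).open_target.mem_nhds hy] with u hu
    exact (chart n y).right_inv hu
  rw [h1.fderiv_eq, fderiv_id]

lemma chartDeriv_eq_comp {y z : X} {u : 𝓔} (hu : u ∈ (chart n y).target)
    (hz : (chart n y).symm u ∈ (chart n z).source) :
    chartDeriv n y u =
      (chartDeriv n z (transition n y z u)).comp (fderiv ℝ (transition n y z) u) := by
  have h1 : (chart n y).symm =ᶠ[𝓝 u] (chart n z).symm ∘ transition n y z := by
    filter_upwards [((chart n y).continuousAt_symm hu) ((chart n z).open_source.mem_nhds hz)]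
      with v hv
    exact ((chart n z).left_inv hv).symm
  have h2 : MDifferentiableAt (𝓡 n) (𝓡 n) (transition n y z) u :=
    ((contDiffAt_transition hu hz).differentiableAt (by simp)).mdifferentiableAt
  have h3 : transition n y z u ∈ (chart n z).target := (chart n z).map_source hz
  have h4 := mfderiv_comp u (mdifferentiableAt_chart_symm h3) h2
  rw [← h1.mfderiv_eq, mfderiv_eq_fderiv] at h4
  exact h4

end Transition

/-! ### Functions and forms on a chart ball -/

section Ball

variable {n : ℕ} {X : Type u} [TopologicalSpace X] [ChartedSpace (EuclideanSpace ℝ (Fin n)) X]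
  {x : X} {𝔤 : NilpRep x} {U : Opens X}

local notation "𝓔" => EuclideanSpace ℝ (Fin n)

/-- The point of the universal cover over `(chart n y).symm u` which is joined to `(y, p)` inside
the chart ball. -/
def IsChartBall.lift {y : X} {r : ℝ} (h : IsChartBall n U y r)
    (p : FundamentalGroupoid.mk x ⟶ FundamentalGroupoid.mk y) {u : 𝓔}
    (hu : u ∈ Metric.ball (chart n y y) r) :
    FundamentalGroupoid.mk x ⟶ FundamentalGroupoid.mk ((chart n y).symm u) :=
  p ≫ FundamentalGroupoid.fromPath ⟦chartPath n y u (h.segment_subset hu)⟧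

lemma IsChartBall.branch_transition [IsManifold (𝓡 n) ∞ X] {T : Type*} [Zero T] {y : X} {r : ℝ}
    (h : IsChartBall n U y r) (s : Raw x U T) (hy : y ∈ U)
    (p : FundamentalGroupoid.mk x ⟶ FundamentalGroupoid.mk y) {u : 𝓔}
    (hu : u ∈ Metric.ball (chart n y y) r) :
    branch n s ⟨y, hy⟩ p =ᶠ[𝓝 u]
      branch n s ⟨(chart n y).symm u, (h.2 u hu).2⟩ (h.lift p hu) ∘
        transition n y ((chart n y).symm u) := by
  have h1 := h.branch_eventuallyEq s hy p (h.2 u hu).2 _ (h.chartPath_mem_opens hu)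
  have hs := mem_chart_source 𝓔 ((chart n y).symm u)
  have h2 : ContinuousAt (transition n y ((chart n y).symm u)) u :=
    (contDiffAt_transition (h.2 u hu).1 hs).continuousAt
  filter_upwards [h2 h1, (chart n y).open_target.mem_nhds (h.2 u hu).1,
    ((chart n y).continuousAt_symm (h.2 u hu).1) ((chart n _).open_source.mem_nhds hs)]
    with v hv hv2 hv3
  rw [Function.comp, IsChartBall.lift]
  refine Eq.trans ?_ hv.symm
  rw [transition, (chart n ((chart n y).symm u)).left_inv hv3, (chart n y).right_inv hv2]

variable [IsManifold (𝓡 n) ∞ X]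

lemma IsChartBall.branchForm_transition {V : Type*} [NormedAddCommGroup V] [NormedSpace ℝ V]
    {y : X} {r : ℝ} (h : IsChartBall n U y r) (s : Raw x U (𝓔 →L[ℝ] V)) (hy : y ∈ U)
    (p : FundamentalGroupoid.mk x ⟶ FundamentalGroupoid.mk y) {u : 𝓔}
    (hu : u ∈ Metric.ball (chart n y y) r) :
    branchForm n s ⟨y, hy⟩ p =ᶠ[𝓝 u] fun v =>
      (branchForm n s ⟨(chart n y).symm u, (h.2 u hu).2⟩ (h.lift p hu)
        (transition n y ((chart n y).symm u) v)).comp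
          (fderiv ℝ (transition n y ((chart n y).symm u)) v) := by
  filter_upwards [h.branch_transition s hy p hu,
    (chart n y).open_target.mem_nhds (h.2 u hu).1,
    ((chart n y).continuousAt_symm (h.2 u hu).1)
      ((chart n _).open_source.mem_nhds (mem_chart_source 𝓔 ((chart n y).symm u)))]
    with v hv hv2 hv3
  rw [branchForm, branchForm, hv, chartDeriv_eq_comp hv2 hv3]
  rfl

@[simp]
lemma branchForm_self {V : Type*} [NormedAddCommGroup V] [NormedSpace ℝ V]
    (s : Raw x U (𝓔 →L[ℝ] V)) (y : U)
    (p : FundamentalGroupoid.mk x ⟶ FundamentalGroupoid.mk y.1) :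
    branchForm n s y p (chart n y.1 y.1) = s y p := by
  rw [branchForm, branch_self, chartDeriv_self, ContinuousLinearMap.comp_id]

namespace IsChartBall

variable {y : X} {r : ℝ}

lemma contDiffOn_branch (h : IsChartBall n U y r) {s : Raw x U 𝔤} (hs : IsSmooth n s) (hy : y ∈ U)
    (p : FundamentalGroupoid.mk x ⟶ FundamentalGroupoid.mk y) :
    ContDiffOn ℝ ∞ (branch n s ⟨y, hy⟩ p) (Metric.ball (chart n y y) r) := fun u hu =>
  (((hs ⟨(chart n y).symm u, (h.2 u hu).2⟩ (h.lift p hu)).comp u (contDiffAt_transition (h.2 u hu).1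
    (mem_chart_source 𝓔 ((chart n y).symm u)))).congr_of_eventuallyEq
      (h.branch_transition s hy p hu)).contDiffWithinAt

lemma contDiffAt_branchForm (h : IsChartBall n U y r) {η : Raw x U (𝓔 →L[ℝ] 𝔤)}
    (hη : IsSmoothForm n η) (hy : y ∈ U)
    (p : FundamentalGroupoid.mk x ⟶ FundamentalGroupoid.mk y) {u : 𝓔}
    (hu : u ∈ Metric.ball (chart n y y) r) : ContDiffAt ℝ ∞ (branchForm n η ⟨y, hy⟩ p) u := by
  have h1 := contDiffAt_transition (h.2 u hu).1 (mem_chart_source 𝓔 ((chart n y).symm u))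
  have h2 := hη ⟨(chart n y).symm u, (h.2 u hu).2⟩ (h.lift p hu)
  exact ((ContDiffAt.comp (f := transition n y ((chart n y).symm u)) u h2 h1).clm_comp
    (contDiffAt_fderiv h1)).congr_of_eventuallyEq
    (h.branchForm_transition η hy p hu)

lemma contDiffOn_branchForm (h : IsChartBall n U y r) {η : Raw x U (𝓔 →L[ℝ] 𝔤)}
    (hη : IsSmoothForm n η) (hy : y ∈ U)
    (p : FundamentalGroupoid.mk x ⟶ FundamentalGroupoid.mk y) :
    ContDiffOn ℝ ∞ (branchForm n η ⟨y, hy⟩ p) (Metric.ball (chart n y y) r) := fun _ hu =>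
  (h.contDiffAt_branchForm hη hy p hu).contDiffWithinAt

end IsChartBall

/-- `dη (v, w) + [η v, η w]` is the curvature of the branch of `η`. -/
lemma extD_add_lie (η : Raw x U (𝓔 →L[ℝ] 𝔤)) (y : U)
    (p : FundamentalGroupoid.mk x ⟶ FundamentalGroupoid.mk y.1) (v w : 𝓔) :
    extD n η y p v w + ⁅η y p v, η y p w⁆ =
      curvature (branchForm n η y p) (chart n y.1 y.1) v w := by
  rw [extD, curvature, branchForm_self]

/-- The curvature of the branch of a Maurer-Cartan element vanishes on the whole ball. -/
lemma IsChartBall.curvature_branchForm {y : X} {r : ℝ} (h : IsChartBall n U y r)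
    {η : Raw x U (𝓔 →L[ℝ] 𝔤)} (hη : IsSmoothForm n η)
    (heq : ∀ y p v w, extD n η y p v w + ⁅η y p v, η y p w⁆ = 0) (hy : y ∈ U)
    (p : FundamentalGroupoid.mk x ⟶ FundamentalGroupoid.mk y) {u : 𝓔}
    (hu : u ∈ Metric.ball (chart n y y) r) (v w : 𝓔) :
    curvature (branchForm n η ⟨y, hy⟩ p) u v w = 0 := by
  have h1 := contDiffAt_transition (h.2 u hu).1 (mem_chart_source 𝓔 ((chart n y).symm u))
  rw [curvature_congr (h.branchForm_transition η hy p hu),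
    curvature_pullback h1 ((hη _ _).differentiableAt (by simp))]
  exact (extD_add_lie η _ _ _ _).symm.trans (heq _ _ _ _)

omit [IsManifold (𝓡 n) ∞ X] in
/-- The logarithmic derivative is the Maurer-Cartan form of the branch. -/
lemma logDeriv_eq_mcForm (a : Raw x U 𝔤) (y : U)
    (p : FundamentalGroupoid.mk x ⟶ FundamentalGroupoid.mk y.1) :
    logDeriv n a y p = mcForm (branch n a y p) (chart n y.1 y.1) := by
  ext w
  rw [mcForm_apply, branch_self, ← fderiv_bch_neg]
  rfl

lemma IsChartBall.mcForm_branch {y : X} {r : ℝ} (h : IsChartBall n U y r)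
    {a : Raw x U 𝔤} (ha : IsSmooth n a) (hy : y ∈ U)
    (p : FundamentalGroupoid.mk x ⟶ FundamentalGroupoid.mk y) {u : 𝓔}
    (hu : u ∈ Metric.ball (chart n y y) r) :
    mcForm (branch n a ⟨y, hy⟩ p) u = branchForm n (logDeriv n a) ⟨y, hy⟩ p u := by
  have h1 := contDiffAt_transition (h.2 u hu).1 (mem_chart_source 𝓔 ((chart n y).symm u))
  rw [mcForm_congr (h.branch_transition a hy p hu),
    mcForm_comp (τ := transition n y ((chart n y).symm u))
      ((ha ⟨(chart n y).symm u, (h.2 u hu).2⟩ (h.lift p hu)).differentiableAt (by simp))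
      (h1.differentiableAt (by simp)),
    (h.branchForm_transition _ hy p hu).eq_of_nhds]
  congr 1
  exact ((logDeriv_eq_mcForm a _ _).symm.trans (branchForm_self (logDeriv n a)
    ⟨(chart n y).symm u, (h.2 u hu).2⟩ (h.lift p hu)).symm)

/-- The gauge action, pointwise. -/
lemma gauge_eq_gaugeForm (a : Raw x U 𝔤) (η : Raw x U (𝓔 →L[ℝ] 𝔤)) (y : U)
    (p : FundamentalGroupoid.mk x ⟶ FundamentalGroupoid.mk y.1) :
    gauge n a η y p = gaugeForm (branch n a y p) (branchForm n η y p) (chart n y.1 y.1) := by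
  obtain ⟨K, hK⟩ := exists_adExt_pow_eq_zero n a
  obtain ⟨M, hM⟩ := exists_ad_pow_eq_zero 𝔤
  have hfin : (∑ᶠ k : ℕ, ((k ! : ℝ)⁻¹ • (adExt n a ^ k) (η, (1 : ℝ)))) =
      ∑ k ∈ Finset.range (K + M + 1), ((k ! : ℝ)⁻¹ • (adExt n a ^ k) (η, (1 : ℝ))) := by
    refine finsum_eq_sum_of_support_subset _ fun k hk => ?_
    rw [Finset.coe_range, Set.mem_Iio]
    by_contra h
    refine hk ?_
    simp only [pow_eq_zero_of_le (show K ≤ k by omega) hK, LinearMap.zero_apply, smul_zero]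
  have hstep : ∀ k v, ((adExt n a ^ (k + 1)) (η, (1 : ℝ))).1 y p v =
      (LieAlgebra.ad ℝ 𝔤 (a y p) ^ (k + 1)) (η y p v) -
        (LieAlgebra.ad ℝ 𝔤 (a y p) ^ k) (d n a y p v) := fun k v => by
    have h1 : adExt n a (η, (1 : ℝ)) =
        (fun y p => (𝔤.ad (a y p)).comp (η y p) - (1 : ℝ) • d n a y p, 0) := rfl
    rw [pow_succ, Module.End.mul_apply, h1, (adExt_pow n a k _ y p v).1, pow_succ,
      Module.End.mul_apply, ← map_sub]
    simp [NilpRep.ad_apply]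
    rfl
  ext v
  have hd : fderiv ℝ (fun v => -branch n a y p v) (chart n y.1 y.1) v = -d n a y p v := by
    rw [fderiv_fun_neg]
    rfl
  have hM' : LieAlgebra.ad ℝ 𝔤 (a y p) ^ (K + M + 1) = 0 :=
    pow_eq_zero_of_le (by omega) (hM _)
  have hM'' : LieAlgebra.ad ℝ 𝔤 (-a y p) ^ (K + M) = 0 := pow_eq_zero_of_le (by omega) (hM _)
  rw [gaugeForm_apply, mcForm_apply, branch_self, branchForm_self, hd, adSeries_apply _ hM',
    adSeries_apply _ hM'', Finset.sum_range_succ']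
  have h : gauge n a η y p v = ((∑ᶠ k : ℕ, ((k ! : ℝ)⁻¹ • (adExt n a ^ k) (η, (1 : ℝ)))).1 y p v) -
      ((0, (1 : ℝ)) : Raw x U (𝓔 →L[ℝ] 𝔤) × ℝ).1 y p v := rfl
  rw [h, hfin, Finset.sum_range_succ']
  simp only [Prod.fst_add, Prod.fst_sum, Prod.smul_fst, Pi.add_apply, Finset.sum_apply,
    add_apply, sum_apply, Pi.smul_apply,
    smul_apply, hstep, smul_sub, Finset.sum_sub_distrib]
  have h2 : ∀ k, ((-1) ^ k * ((k + 1)! : ℝ)⁻¹) •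
      (LieAlgebra.ad ℝ 𝔤 (-a y p) ^ k) (-d n a y p v) =
      -(((k + 1)! : ℝ)⁻¹ • (LieAlgebra.ad ℝ 𝔤 (a y p) ^ k) (d n a y p v)) := fun k => by
    have h3 : (LieAlgebra.ad ℝ 𝔤 (-a y p)) ^ k =
        ((-1 : ℝ) ^ k) • (LieAlgebra.ad ℝ 𝔤 (a y p)) ^ k := by
      rw [map_neg, ← neg_one_smul ℝ (LieAlgebra.ad ℝ 𝔤 (a y p)), smul_pow]
    rw [h3, map_neg, smul_neg, LinearMap.smul_apply, smul_smul, mul_right_comm, ← mul_pow]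
    simp
  simp only [h2, Finset.sum_neg_distrib]
  simp
  abel

end Ball

/-! ### Calculus on the universal cover -/

section Calculus

variable {n : ℕ} {X : Type u} [TopologicalSpace X] [ChartedSpace (EuclideanSpace ℝ (Fin n)) X]
  {x : X} {𝔤 : NilpRep x} {U V : Opens X}

local notation "𝓔" => EuclideanSpace ℝ (Fin n)

lemma branch_mul (a b : Raw x U 𝔤) (y : U)
    (p : FundamentalGroupoid.mk x ⟶ FundamentalGroupoid.mk y.1) :
    branch n (a.mul b) y p = fun u => bch (branch n a y p u) (branch n b y p u) :=
  funext fun u => branch_map₂ n bch bch_zero_zero a b y p u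

lemma branch_inv (a : Raw x U 𝔤) (y : U)
    (p : FundamentalGroupoid.mk x ⟶ FundamentalGroupoid.mk y.1) :
    branch n a.inv y p = fun u => -branch n a y p u :=
  funext fun u => branch_map n (fun z : 𝔤 => -z) neg_zero a y p u

/-- Branches at two points of the universal cover over the same point. -/
lemma branch_comp {T : Type*} [Zero T] {s : Raw x U T} {y : U} {f : T → T} (hf : f 0 = 0)
    {γ : FundamentalGroup X x} (hs : ∀ (y : U) p, s y (γ.toArrow ≫ p) = f (s y p))
    (p : FundamentalGroupoid.mk x ⟶ FundamentalGroupoid.mk y.1) :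
    branch n s y (γ.toArrow ≫ p) = fun u => f (branch n s y p u) := by
  funext u
  rw [branch, branch]
  split_ifs with h
  · rw [Category.assoc, hs]
  · exact hf.symm

lemma IsEquivariant.branch {s : Raw x U 𝔤} (hs : IsEquivariant 𝔤 s) (y : U)
    (γ : FundamentalGroup X x) (p : FundamentalGroupoid.mk x ⟶ FundamentalGroupoid.mk y.1) :
    branch n s y (γ.toArrow ≫ p) = fun u => 𝔤.repLie γ⁻¹ (branch n s y p u) :=
  branch_comp (map_zero _) (fun y p => hs y γ p) p

lemma fderiv_lieHom {E : Type*} [NormedAddCommGroup E] [NormedSpace ℝ E] {α : E → 𝔤}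
    {u : E} (f : 𝔤 →ₗ⁅ℝ⁆ 𝔤) (hα : DifferentiableAt ℝ α u) :
    fderiv ℝ (fun v => f (α v)) u =
      (LinearMap.toContinuousLinearMap (f : 𝔤 →ₗ[ℝ] 𝔤)).comp (fderiv ℝ α u) :=
  ((LinearMap.toContinuousLinearMap (f : 𝔤 →ₗ[ℝ] 𝔤)).hasFDerivAt.comp u hα.hasFDerivAt).fderiv

lemma mcForm_lieHom {E : Type*} [NormedAddCommGroup E] [NormedSpace ℝ E] {α : E → 𝔤} {u : E}
    (f : 𝔤 →ₗ⁅ℝ⁆ 𝔤) (hα : DifferentiableAt ℝ α u) (w : E) :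
    mcForm (fun v => f (α v)) u w = f (mcForm α u w) := by
  rw [mcForm_apply, mcForm_apply, fderiv_lieHom f hα, map_adSeries]
  rfl

lemma IsEquivariant.logDeriv {s : Raw x U 𝔤} (hs : IsEquivariant 𝔤 s) (hs' : IsSmooth n s) :
    IsEquivariantForm n 𝔤 (logDeriv n s) := fun y γ p w => by
  rw [logDeriv_eq_mcForm, logDeriv_eq_mcForm, hs.branch,
    mcForm_lieHom _ ((hs' y p).differentiableAt (by simp))]
  rfl

lemma logDeriv_mul {a b : Raw x U 𝔤} (ha : IsSmooth n a) (hb : IsSmooth n b) (y : U)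
    (p : FundamentalGroupoid.mk x ⟶ FundamentalGroupoid.mk y.1) (w : 𝓔) :
    logDeriv n (a.mul b) y p w = expAd (-b y p) (logDeriv n a y p w) + logDeriv n b y p w := by
  simp only [logDeriv_eq_mcForm, branch_mul]
  rw [mcForm_bch ((ha y p).differentiableAt (by simp)) ((hb y p).differentiableAt (by simp)),
    branch_self]

lemma gauge_apply (a : Raw x U 𝔤) (η : Raw x U (𝓔 →L[ℝ] 𝔤)) [IsManifold (𝓡 n) ∞ X] (y : U)
    (p : FundamentalGroupoid.mk x ⟶ FundamentalGroupoid.mk y.1) (w : 𝓔) :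
    gauge n a η y p w = expAd (a y p) (η y p w) + logDeriv n a.inv y p w := by
  rw [gauge_eq_gaugeForm, gaugeForm_apply, branch_self, branchForm_self, logDeriv_eq_mcForm,
    branch_inv]

lemma IsLocConst.isSmooth {s : Raw x U 𝔤} (hs : IsLocConst n s) : IsSmooth n s := fun y p =>
  contDiffAt_const.congr_of_eventuallyEq (hs y p)

lemma IsLocConst.logDeriv_eq_zero {s : Raw x U 𝔤} (hs : IsLocConst n s) : logDeriv n s = 0 := by
  funext y p
  rw [logDeriv_eq_mcForm, mcForm_congr (hs y p), mcForm_const]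
  rfl

/-- The Maurer-Cartan form determines the derivative, because `dexpAd` is injective. -/
lemma isLocConst_of_logDeriv_eq_zero [IsManifold (𝓡 n) ∞ X] {s : Raw x U 𝔤} (hs : IsSmooth n s)
    (h : logDeriv n s = 0) : IsLocConst n s := fun y p => by
  obtain ⟨r, hr⟩ := exists_isChartBall (n := n) y.2
  have h0 : ∀ u, branchForm n (logDeriv n s) y p u = 0 := fun u => by
    rw [h, branchForm, branch]
    split_ifs <;> rfl
  have h1 : ∀ u ∈ Metric.ball (chart n y.1 y.1) r, fderiv ℝ (branch n s y p) u = 0 :=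
    fun u hu => fderiv_eq_zero_of_mcForm_eq_zero ((hr.mcForm_branch hs y.2 p hu).trans (h0 u))
  filter_upwards [hr.ball_mem_nhds] with u hu
  rw [← branch_self (n := n) s y p]
  exact Metric.isOpen_ball.is_const_of_fderiv_eq_zero (convex_ball _ _).isPreconnected
    ((hr.contDiffOn_branch hs y.2 p).differentiableOn (by simp)) h1 hu hr.mem_ball

variable [IsManifold (𝓡 n) ∞ X]

omit [IsManifold (𝓡 n) ∞ X] in
lemma logDeriv_inv {a : Raw x U 𝔤} (ha : IsSmooth n a) (y : U)
    (p : FundamentalGroupoid.mk x ⟶ FundamentalGroupoid.mk y.1) (w : 𝓔) :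
    logDeriv n a.inv y p w = -expAd (a y p) (logDeriv n a y p w) := by
  have h := expAd_mcForm_neg ((ha y p).differentiableAt (by simp)) w
  rw [logDeriv_eq_mcForm, logDeriv_eq_mcForm, branch_inv, ← map_neg, ← h, branch_self,
    expAd_cancel_neg]

/-- The logarithmic derivative of `α a⁻¹` is the gauge transform of the one of `α`. -/
lemma logDeriv_mul_inv {α a : Raw x U 𝔤} (hα : IsSmooth n α) (ha : IsSmooth n a) :
    logDeriv n (α.mul a.inv) = gauge n a (logDeriv n α) := by
  funext y p
  ext w
  rw [logDeriv_mul hα (ha.inv n), gauge_apply]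
  simp [Raw.inv]

lemma gauge_res (h : V ≤ U) (a : Raw x U 𝔤) (η : Raw x U (𝓔 →L[ℝ] 𝔤)) :
    gauge n (a.res h) (η.res h) = (gauge n a η).res h := by
  funext y p
  ext w
  have h1 : (a.res h).inv = a.inv.res h := rfl
  rw [gauge_apply, h1, logDeriv_res]
  exact (gauge_apply a η ⟨y.1, h y.2⟩ p w).symm

/-- Two smooth functions with values in `exp(𝔤)` with the same logarithmic derivative differ by a
locally constant one. -/
lemma isLocConst_mul_inv {α β : Raw x U 𝔤} (hα : IsSmooth n α) (hβ : IsSmooth n β)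
    (h : logDeriv n α = logDeriv n β) : IsLocConst n (α.mul β.inv) := by
  refine isLocConst_of_logDeriv_eq_zero (hα.mul n (hβ.inv n)) ?_
  funext y p
  ext w
  rw [logDeriv_mul_inv hα hβ, gauge_apply, h, logDeriv_inv hβ]
  simp

omit [IsManifold (𝓡 n) ∞ X] in
lemma IsLocConst.logDeriv_mul {g α : Raw x U 𝔤} (hg : IsLocConst n g) (hα : IsSmooth n α) :
    FlatTorsor.logDeriv n (g.mul α) = FlatTorsor.logDeriv n α := by
  funext y p
  ext w
  rw [FlatTorsor.logDeriv_mul hg.isSmooth hα, hg.logDeriv_eq_zero]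
  simp

lemma IsChartBall.branchForm_gauge {y : X} {r : ℝ} (h : IsChartBall n U y r) {a : Raw x U 𝔤}
    (ha : IsSmooth n a) (η : Raw x U (𝓔 →L[ℝ] 𝔤)) (hy : y ∈ U)
    (p : FundamentalGroupoid.mk x ⟶ FundamentalGroupoid.mk y) {u : 𝓔}
    (hu : u ∈ Metric.ball (chart n y y) r) :
    branchForm n (gauge n a η) ⟨y, hy⟩ p u =
      gaugeForm (branch n a ⟨y, hy⟩ p) (branchForm n η ⟨y, hy⟩ p) u := by
  ext w
  have h1 : branch n (gauge n a η) ⟨y, hy⟩ p u = (adCLM (fun k => (k ! : ℝ)⁻¹)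
      (branch n a ⟨y, hy⟩ p u)).comp (branch n η ⟨y, hy⟩ p u) +
        branch n (logDeriv n a.inv) ⟨y, hy⟩ p u := by
    simp only [branch_eq h _ hy p hu]
    ext w
    exact gauge_apply a η _ _ w
  rw [gaugeForm_apply, ← branch_inv, h.mcForm_branch (ha.inv n) hy p hu, branchForm, h1]
  rfl

lemma isSmoothForm_gauge {a : Raw x U 𝔤} (ha : IsSmooth n a) {η : Raw x U (𝓔 →L[ℝ] 𝔤)}
    (hη : IsSmoothForm n η) : IsSmoothForm n (gauge n a η) := fun y p => by
  obtain ⟨r, h⟩ := exists_isChartBall (n := n) y.2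
  refine (ContDiffAt.gaugeForm (ha y p) (hη y p)).congr_of_eventuallyEq ?_
  filter_upwards [h.ball_mem_nhds] with u hu
  exact h.branchForm_gauge ha η y.2 p hu

lemma isEquivariantForm_gauge {a : Raw x U 𝔤} (ha : IsEquivariant 𝔤 a) (ha' : IsSmooth n a)
    {η : Raw x U (𝓔 →L[ℝ] 𝔤)} (hη : IsEquivariantForm n 𝔤 η) :
    IsEquivariantForm n 𝔤 (gauge n a η) := fun y γ p w => by
  rw [gauge_apply, gauge_apply, ha.inv.logDeriv (ha'.inv n) y γ p w, hη y γ p w, ha y γ p, map_add]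
  congr 1
  exact (map_adSeries (𝔤.repLie γ⁻¹) _ _ _).symm

/-- The curvature is transformed by `exp(ad a)` under a gauge transformation. -/
lemma extD_gauge {a : Raw x U 𝔤} (ha : IsSmooth n a) {η : Raw x U (𝓔 →L[ℝ] 𝔤)}
    (hη : IsSmoothForm n η) (y : U) (p : FundamentalGroupoid.mk x ⟶ FundamentalGroupoid.mk y.1)
    (v w : 𝓔) : extD n (gauge n a η) y p v w + ⁅gauge n a η y p v, gauge n a η y p w⁆ =
      expAd (a y p) (extD n η y p v w + ⁅η y p v, η y p w⁆) := by
  obtain ⟨r, h⟩ := exists_isChartBall (n := n) y.2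
  have h1 : branchForm n (gauge n a η) y p =ᶠ[𝓝 (chart n y.1 y.1)]
      gaugeForm (branch n a y p) (branchForm n η y p) := by
    filter_upwards [h.ball_mem_nhds] with u hu
    exact h.branchForm_gauge ha η y.2 p hu
  rw [extD_add_lie, extD_add_lie, curvature_congr h1,
    curvature_gaugeForm (ha y p) ((hη y p).differentiableAt (by simp))
      ((ContDiffAt.gaugeForm (ha y p) (hη y p)).differentiableAt (by simp)), branch_self]

variable (n 𝔤) in
theorem isGaugeGroupoid : IsGaugeGroupoid n 𝔤 where
  mul_assoc := bch_assoc
  one_mul := bch_zero_left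
  mul_one := bch_zero_right
  inv_mul := bch_neg_left
  gauge_mem a η := ⟨⟨gauge n a.val η.form,
    isEquivariantForm_gauge a.equivariant a.smooth η.equivariant,
    isSmoothForm_gauge a.smooth η.smooth, fun y p v w => by
      rw [extD_gauge a.smooth η.smooth, η.eqn, map_zero]⟩, rfl⟩
  gauge_one η := by
    funext y p
    ext w
    have h : IsLocConst n (FunSec.one : FunSec n 𝔤 ⊤).val.inv := fun y p =>
      Filter.Eventually.of_forall fun u => by
        rw [branch]
        split_ifs
        · rfl
        · simp [Raw.inv, FunSec.one]
    rw [gauge_apply, h.logDeriv_eq_zero]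
    change expAd 0 _ + 0 = _
    rw [adSeries_zero]
    simp
  gauge_mul a b η := by
    funext y p
    ext w
    have h : (a.mul b).val.inv = b.val.inv.mul a.val.inv :=
      funext fun y => funext fun p => neg_bch _ _
    rw [gauge_apply, gauge_apply, gauge_apply, h, logDeriv_mul (b.smooth.inv n) (a.smooth.inv n),
      map_add]
    change expAd (bch _ _) _ + (expAd (- -_) _ + _) = _
    rw [expAd_bch, neg_neg]
    abel

end Calculus

/-! ### Local solutions of `α⁻¹ dα = η` -/

section LocalSection

variable {n : ℕ} {X : Type u} [TopologicalSpace X] [ChartedSpace (EuclideanSpace ℝ (Fin n)) X]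
  {x : X} {𝔤 : NilpRep x} {U V : Opens X}

local notation "𝓔" => EuclideanSpace ℝ (Fin n)

variable [IsManifold (𝓡 n) ∞ X]

lemma IsChartBall.branchForm_eventuallyEq {W : Type*} [NormedAddCommGroup W] [NormedSpace ℝ W]
    {y : X} {r : ℝ} (h : IsChartBall n U y r) (s : Raw x U (𝓔 →L[ℝ] W)) (hy : y ∈ U)
    (p : FundamentalGroupoid.mk x ⟶ FundamentalGroupoid.mk y) {z : X} (hz : z ∈ U) (γ : Path y z)
    (hγ : ∀ t, γ t ∈ h.opens) :
    branchForm n s ⟨z, hz⟩ (p ≫ FundamentalGroupoid.fromPath ⟦γ⟧) =ᶠ[𝓝 (chart n z z)] fun u =>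
      (branchForm n s ⟨y, hy⟩ p (transition n z y u)).comp (fderiv ℝ (transition n z y) u) := by
  have hzo : z ∈ (chart n y).source := by simpa using (hγ 1).1
  have hz' := (chart n z).map_source (mem_chart_source 𝓔 z)
  filter_upwards [h.branch_eventuallyEq s hy p hz γ hγ, (chart n z).open_target.mem_nhds hz',
    (chart n z).continuousAt_symm hz' ((chart n y).open_source.mem_nhds
      (by rwa [(chart n z).left_inv (mem_chart_source 𝓔 z)]))] with u h1 h2 h3
  rw [branchForm, branchForm, h1, chartDeriv_eq_comp h2 h3]
  rfl

/-- The equation `α⁻¹ dα = η` has a solution near every point, for a Maurer-Cartan element `η`. -/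
theorem exists_mcPredicate [ConnectedSpace X] (η : MC n 𝔤) (y : X) :
    ∃ (W : Opens X) (_ : y ∈ W) (s : Raw x W 𝔤), (mcPredicate η).pred (U := W) s := by
  have : LocallyPathConnectedSpace X := ChartedSpace.locallyPathConnectedSpace 𝓔 X
  have : PathConnectedSpace X := pathConnectedSpace_iff_connectedSpace.2 inferInstance
  let p : FundamentalGroupoid.mk x ⟶ FundamentalGroupoid.mk y :=
    FundamentalGroupoid.fromPath ⟦PathConnectedSpace.somePath x y⟧
  obtain ⟨r, h⟩ := exists_isChartBall (n := n) (U := ⊤) (y := y) trivial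
  obtain ⟨β, hβ, hβη⟩ := exists_mcForm_eq (convex_ball _ _) Metric.isOpen_ball
    (h.contDiffOn_branchForm η.smooth trivial p)
    (fun u hu => h.curvature_branchForm η.smooth η.eqn trivial p hu)
  have h' : IsChartBall n h.opens y r := ⟨h.1, fun u hu => ⟨(h.2 u hu).1, h.symm_mem_opens hu⟩⟩
  -- A point of the universal cover over the ball is uniquely of the form `γ p σ`, where `γ` is a
  -- loop and `σ` a path in the ball. Thus `β`, placed on the sheet of `p`, extends equivariantly.
  let seg : ∀ z : h.opens, Path y z.1 := fun z =>
    (chartPath n y (chart n y z.1) (h.segment_subset z.2.2)).cast rfl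
      ((chart n y).left_inv z.2.1).symm
  have hseg : ∀ z t, seg z t ∈ h.opens := fun z t => h.chartPath_mem_opens z.2.2 t
  let σ : ∀ z : h.opens, FundamentalGroupoid.mk y ⟶ FundamentalGroupoid.mk z.1 := fun z =>
    FundamentalGroupoid.fromPath ⟦seg z⟧
  let loop : ∀ (z : h.opens) (_ : FundamentalGroupoid.mk x ⟶ FundamentalGroupoid.mk z.1),
    FundamentalGroup X x := fun z q =>
      FundamentalGroup.fromArrow (q ≫ inv (σ z) ≫ inv p)
  have hloop : ∀ z q, q = (loop z q).toArrow ≫ p ≫ σ z := fun z q => by simp [loop]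
  let s : Raw x h.opens 𝔤 := fun z q => 𝔤.rep (loop z q)⁻¹ (β (chart n y z.1))
  have hs1 : ∀ z, s z (p ≫ σ z) = β (chart n y z.1) := fun z => by
    have : loop z (p ≫ σ z) = 1 := by
      simp only [loop, Category.assoc, IsIso.hom_inv_id_assoc, IsIso.hom_inv_id]
      rfl
    simp only [s, this, inv_one, map_one, Module.End.one_apply]
  have hse : IsEquivariant 𝔤 s := fun z γ q => by
    have : loop z (γ.toArrow ≫ q) = loop z q * γ := by
      simp only [loop, Category.assoc]
      rfl
    simp only [s, this, mul_inv_rev, map_mul, Module.End.mul_apply]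
  have hs2 : ∀ u ∈ Metric.ball (chart n y y) r,
      branch n s ⟨y, h.mem_opens⟩ p u = β u := fun u hu => by
    rw [h'.branch_eq_of_path s h.mem_opens p hu (h.symm_mem_opens hu) rfl
      (seg ⟨_, h.symm_mem_opens hu⟩) (hseg ⟨_, h.symm_mem_opens hu⟩)]
    refine (hs1 ⟨_, h.symm_mem_opens hu⟩).trans ?_
    rw [(chart n y).right_inv (h.2 u hu).1]
  have hτ : ∀ z : h.opens, ContDiffAt ℝ ∞ (transition n z.1 y) (chart n z.1 z.1) := fun z =>
    contDiffAt_transition ((chart n z.1).map_source (mem_chart_source 𝓔 z.1))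
      (by rw [(chart n z.1).left_inv (mem_chart_source 𝓔 z.1)]; exact z.2.1)
  have hτz : ∀ z : h.opens, transition n z.1 y (chart n z.1 z.1) = chart n y z.1 := fun z => by
    rw [transition, (chart n z.1).left_inv (mem_chart_source 𝓔 z.1)]
  have hβ' : ∀ z : h.opens, ContDiffAt ℝ ∞ β (transition n z.1 y (chart n z.1 z.1)) := fun z => by
    rw [hτz]
    exact hβ.contDiffAt (Metric.isOpen_ball.mem_nhds z.2.2)
  have hs3 : ∀ z : h.opens, branch n s z (p ≫ σ z) =ᶠ[𝓝 (chart n z.1 z.1)]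
      β ∘ transition n z.1 y := fun z => by
    filter_upwards [h'.branch_eventuallyEq s h.mem_opens p z.2 (seg z) (hseg z),
      (hτ z).continuousAt (Metric.isOpen_ball.mem_nhds (by rw [hτz]; exact z.2.2))] with u h1 h2
    exact h1.trans (hs2 _ h2)
  have hss : IsSmooth n s := fun z q => by
    rw [hloop z q, hse.branch]
    exact (LinearMap.toContinuousLinearMap
      (𝔤.repLie (loop z q)⁻¹ : 𝔤 →ₗ[ℝ] 𝔤)).contDiff.contDiffAt.comp _
        (((hβ' z).comp _ (hτ z)).congr_of_eventuallyEq (hs3 z))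
  refine ⟨h.opens, h.mem_opens, s, hse, hss, ?_⟩
  funext z q
  ext w
  have h2 : logDeriv n s z (p ≫ σ z) = η.form ⟨z.1, trivial⟩ (p ≫ σ z) := by
    rw [logDeriv_eq_mcForm, mcForm_congr (hs3 z),
      mcForm_comp ((hβ' z).differentiableAt (by simp)) ((hτ z).differentiableAt (by simp)),
      hβη _ (by rw [hτz]; exact z.2.2)]
    rw [← branchForm_self (n := n) η.form]
    exact (h.branchForm_eventuallyEq η.form trivial p trivial (seg z) (hseg z)).eq_of_nhds.symm
  have h3 := hse.logDeriv hss z (loop z q) (p ≫ σ z) w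
  have h4 := η.equivariant ⟨z.1, trivial⟩ (loop z q) (p ≫ σ z) w
  rw [← hloop z q] at h3
  rw [← hloop z q] at h4
  rw [h3, h2, ← h4]
  rfl

end LocalSection

/-! ### Stalks and local sections -/

section Stalks

variable {n : ℕ} {X : Type u} [TopologicalSpace X] [ChartedSpace (EuclideanSpace ℝ (Fin n)) X]
  {x : X} {𝔤 : NilpRep x} {U V W : Opens X}

variable (F : TopCat.Sheaf (Type u) (TopCat.of X))

lemma germ_resSec (h : V ≤ U) {y : X} (hy : y ∈ V) (s : F.presheaf.obj (op U)) :
    F.presheaf.germ V y hy (resSec F h s) = F.presheaf.germ U y (h hy) s :=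
  TopCat.Presheaf.germ_res_apply F.presheaf (homOfLE h) y hy s

lemma resSec_resSec (h : V ≤ U) (h' : W ≤ V) (s : F.presheaf.obj (op U)) :
    resSec F h' (resSec F h s) = resSec F (h'.trans h) s := by
  have := F.presheaf.map_comp (homOfLE h).op (homOfLE h').op
  exact (congrArg (fun f => f s) this).symm

@[simp]
lemma resSec_self (s : F.presheaf.obj (op U)) : resSec F le_rfl s = s :=
  congrArg (fun f => f s) (F.presheaf.map_id (op U))

lemma exists_germ_eq' {y : X} (t : F.presheaf.stalk y) :
    ∃ (U : Opens X) (hy : y ∈ U) (s : F.presheaf.obj (op U)), F.presheaf.germ U y hy s = t :=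
  TopCat.Presheaf.exists_germ_eq F.presheaf t

lemma exists_resSec_eq {y : X} (hU : y ∈ U) (hV : y ∈ V) {s : F.presheaf.obj (op U)}
    {t : F.presheaf.obj (op V)} (h : F.presheaf.germ U y hU s = F.presheaf.germ V y hV t) :
    ∃ (W : Opens X) (_ : y ∈ W) (h1 : W ≤ U) (h2 : W ≤ V), resSec F h1 s = resSec F h2 t := by
  obtain ⟨W, hW, i, j, h⟩ := TopCat.Presheaf.germ_eq F.presheaf y hU hV s t h
  exact ⟨W, hW, i.le, j.le, h⟩

lemma germ_eq_of_resSec_eq {y : X} (hU : y ∈ U) (hV : y ∈ V) {s : F.presheaf.obj (op U)}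
    {t : F.presheaf.obj (op V)} (hW : y ∈ W) (h1 : W ≤ U) (h2 : W ≤ V)
    (h : resSec F h1 s = resSec F h2 t) :
    F.presheaf.germ U y hU s = F.presheaf.germ V y hV t := by
  rw [← germ_resSec F h1 hW, ← germ_resSec F h2 hW, h]

/-- Sections which agree near every point are equal. -/
lemma eq_of_forall_resSec_eq {s t : F.presheaf.obj (op U)}
    (h : ∀ y ∈ U, ∃ (V : Opens X) (_ : y ∈ V) (hV : V ≤ U), resSec F hV s = resSec F hV t) :
    s = t := by
  choose V hy hV h using h
  refine F.eq_of_locally_eq' (fun y : U => V y.1 y.2) U (fun y => homOfLE (hV y.1 y.2)) ?_ s t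
    fun y => h y.1 y.2
  intro y hyU
  exact Opens.mem_iSup.2 ⟨⟨y, hyU⟩, hy y hyU⟩

/-- Sections can be constructed locally if they are characterized by a property. -/
lemma exists_section_of_locally (p : ∀ V : Opens X, F.presheaf.obj (op V) → Prop)
    (hres : ∀ (V W : Opens X) (h : W ≤ V) s, p V s → p W (resSec F h s))
    (huniq : ∀ (V : Opens X) s t, V ≤ U → p V s → p V t → s = t)
    (hloc : ∀ (s : F.presheaf.obj (op U)), (∀ y ∈ U, ∃ (V : Opens X) (_ : y ∈ V) (hV : V ≤ U),
      p V (resSec F hV s)) → p U s)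
    (hex : ∀ y ∈ U, ∃ (V : Opens X) (_ : y ∈ V) (_ : V ≤ U) (s : F.presheaf.obj (op V)), p V s) :
    ∃ s, p U s := by
  choose V hy hV s hs using hex
  obtain ⟨t, ht, -⟩ := F.existsUnique_gluing' (fun y : U => V y.1 y.2) U
    (fun y => homOfLE (hV y.1 y.2)) (fun y hyU => Opens.mem_iSup.2 ⟨⟨y, hyU⟩, hy y hyU⟩)
    (fun y => s y.1 y.2) fun y z => huniq _ _ _ (inf_le_left.trans (hV y.1 y.2))
      (hres _ _ inf_le_left _ (hs y.1 y.2)) (hres _ _ inf_le_right _ (hs z.1 z.2))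
  refine ⟨t, hloc t fun y hyU => ⟨V y hyU, hy y hyU, hV y hyU, ?_⟩⟩
  have h : resSec F (hV y hyU) t = s y hyU := ht ⟨y, hyU⟩
  rw [h]
  exact hs y hyU

/-- A sheaf with an action of `exp(𝔤)` is stalkwise trivial if it has local sections, on which the
action is free and locally transitive. -/
theorem isStalkwiseTrivial_of_locally
    (act : ∀ {U : Opens X}, ExpSec n 𝔤 U → F.presheaf.obj (op U) → F.presheaf.obj (op U))
    (act_res : ∀ {U V : Opens X} (h : V ≤ U) (g : ExpSec n 𝔤 U) (b : F.presheaf.obj (op U)),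
      resSec F h (act g b) = act (resSec (expSheaf n 𝔤) h g) (resSec F h b))
    (mul_act : ∀ {U : Opens X} (g h : ExpSec n 𝔤 U) (b : F.presheaf.obj (op U)),
      act g (act h b) = act (g.mul h) b)
    (hex : ∀ y : X, ∃ (U : Opens X) (_ : y ∈ U), Nonempty (F.presheaf.obj (op U)))
    (hfree : ∀ {U : Opens X} (g h : ExpSec n 𝔤 U) (b : F.presheaf.obj (op U)),
      act g b = act h b → g = h)
    (htrans : ∀ {U : Opens X} (b c : F.presheaf.obj (op U)), ∃ g : ExpSec n 𝔤 U, act g b = c) :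
    IsStalkwiseTrivial F act := fun y => by
  obtain ⟨W, hW, ⟨b₀⟩⟩ := hex y
  choose U hU g hg using exists_germ_eq' (expSheaf n 𝔤) (y := y)
  -- the bijection takes the germ of `g` to the germ of `g · b₀`
  let f : (expSheaf n 𝔤).presheaf.stalk y → F.presheaf.stalk y := fun t =>
    F.presheaf.germ (U t ⊓ W) y ⟨hU t, hW⟩
      (act (resSec (expSheaf n 𝔤) inf_le_left (g t)) (resSec F inf_le_right b₀))
  have hf : ∀ (V : Opens X) (hV : y ∈ V) (hVW : V ≤ W) (h : ExpSec n 𝔤 V),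
      f ((expSheaf n 𝔤).presheaf.germ V y hV h) =
        F.presheaf.germ V y hV (act h (resSec F hVW b₀)) := fun V hV hVW h => by
    obtain ⟨V', hV', h1, h2, h3⟩ := exists_resSec_eq (expSheaf n 𝔤) _ _
      (hg ((expSheaf n 𝔤).presheaf.germ V y hV h))
    refine germ_eq_of_resSec_eq F _ _ hV' (le_inf h1 (h2.trans hVW)) h2 ?_
    rw [act_res, act_res, resSec_resSec, resSec_resSec, resSec_resSec, h3]
  have hf' : ∀ (V : Opens X) (hV : y ∈ V) (h : ExpSec n 𝔤 V),
      ∃ (V' : Opens X) (_ : y ∈ V') (h1 : V' ≤ V) (h2 : V' ≤ W),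
        f ((expSheaf n 𝔤).presheaf.germ V y hV h) = F.presheaf.germ V' y ‹_›
          (act (resSec (expSheaf n 𝔤) h1 h) (resSec F h2 b₀)) := fun V hV h => by
    have hVW : y ∈ V ⊓ W := ⟨hV, hW⟩
    refine ⟨V ⊓ W, hVW, inf_le_left, inf_le_right, ?_⟩
    rw [← hf _ hVW, germ_resSec]
  refine ⟨Equiv.ofBijective f ⟨fun t t' ht => ?_, fun b => ?_⟩, fun V hV g h b hb => ?_⟩
  · obtain ⟨V, hV, h, rfl⟩ := exists_germ_eq' _ t
    obtain ⟨V', hV', h', rfl⟩ := exists_germ_eq' _ t'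
    obtain ⟨A, hA, a1, a2, ha⟩ := hf' V hV h
    obtain ⟨A', hA', a1', a2', ha'⟩ := hf' V' hV' h'
    rw [ha, ha'] at ht
    obtain ⟨B, hB, b1, b2, hb⟩ := exists_resSec_eq F _ _ ht
    rw [act_res, act_res, resSec_resSec, resSec_resSec, resSec_resSec, resSec_resSec] at hb
    exact germ_eq_of_resSec_eq _ _ _ hB (b1.trans a1) (b2.trans a1') (hfree _ _ _ hb)
  · obtain ⟨V, hV, b, rfl⟩ := exists_germ_eq' _ b
    obtain ⟨g, hg⟩ := htrans (resSec F (inf_le_right : V ⊓ W ≤ W) b₀)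
      (resSec F (inf_le_left : V ⊓ W ≤ V) b)
    have hVW : y ∈ V ⊓ W := ⟨hV, hW⟩
    refine ⟨(expSheaf n 𝔤).presheaf.germ (V ⊓ W) y hVW g, ?_⟩
    rw [hf _ _ inf_le_right, hg, germ_resSec]
  · change f _ = _ at hb
    change f _ = _
    obtain ⟨A, hA, a1, a2, ha⟩ := hf' V hV h
    rw [ha] at hb
    obtain ⟨B, hB, b1, b2, hb⟩ := exists_resSec_eq F _ _ hb
    rw [act_res, resSec_resSec, resSec_resSec] at hb
    have h1 : (expSheaf n 𝔤).presheaf.germ V y hV (g.mul h) =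
        (expSheaf n 𝔤).presheaf.germ B y hB
          (ExpSec.mul (resSec (expSheaf n 𝔤) b2 g) (resSec (expSheaf n 𝔤) b2 h)) :=
      (germ_resSec (expSheaf n 𝔤) b2 hB (g.mul h)).symm
    rw [h1, hf B hB (b1.trans a2), ← mul_act, hb, ← act_res, germ_resSec]

end Stalks

/-! ### The sheaves of solutions are torsors -/

section SolutionTorsor

variable {n : ℕ} {X : Type u} [TopologicalSpace X] [ChartedSpace (EuclideanSpace ℝ (Fin n)) X]
  {x : X} {𝔤 : NilpRep x} {U V W : Opens X} [IsManifold (𝓡 n) ∞ X]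

omit [IsManifold (𝓡 n) ∞ X] in
lemma mcPredicate_mul {η : MC n 𝔤} {g : Raw x U 𝔤} (hg : (flatPredicate n 𝔤).pred (U := U) g)
    {α : Raw x U 𝔤} (hα : (mcPredicate η).pred (U := U) α) :
    (mcPredicate η).pred (U := U) (g.mul α) :=
  ⟨IsEquivariant.mul (U := U) hg.1 hα.1, IsSmooth.mul (U := U) n (IsLocConst.isSmooth hg.2) hα.2.1,
    (IsLocConst.logDeriv_mul hg.2 hα.2.1).trans hα.2.2⟩

lemma mcPredicate_mul_inv {η : MC n 𝔤} {α β : Raw x U 𝔤} (hα : (mcPredicate η).pred (U := U) α)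
    (hβ : (mcPredicate η).pred (U := U) β) :
    (flatPredicate n 𝔤).pred (U := U) (α.mul β.inv) :=
  ⟨IsEquivariant.mul (U := U) hα.1 (IsEquivariant.inv (U := U) hβ.1),
    isLocConst_mul_inv (U := U) hα.2.1 hβ.2.1 (hα.2.2.trans hβ.2.2.symm)⟩

/-- The quotient of two solutions is locally constant, which gives the transitivity of the action;
solutions exist locally. -/
theorem isMCTorsor [ConnectedSpace X] (η : MC n 𝔤) : IsMCTorsor η where
  mul_mem U g α := mcPredicate_mul g.2 α.2
  stalk := by
    refine isStalkwiseTrivial_of_locally _ _ (fun _ _ _ => rfl) (fun g h b => ?_) (fun y => ?_)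
      (fun {U} g h b hb => ?_) fun {U} b c => ?_
    · exact Subtype.ext (funext fun _ => funext fun _ => (bch_assoc _ _ _).symm)
    · obtain ⟨W, hW, s, hs⟩ := exists_mcPredicate η y
      exact ⟨W, hW, ⟨⟨s, hs⟩⟩⟩
    · refine Subtype.ext (funext fun y => funext fun p => ?_)
      have h1 : bch (g.1 y p) (b.1 y p) = bch (h.1 y p) (b.1 y p) :=
        congrFun (congrFun (congrArg Subtype.val hb) y) p
      rw [← bch_cancel_neg_right (g.1 y p) (b.1 y p), h1, bch_cancel_neg_right]
    · exact ⟨⟨_, mcPredicate_mul_inv c.2 b.2⟩,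
        Subtype.ext (funext fun _ => funext fun _ => bch_neg_cancel_right _ _)⟩

variable (n 𝔤) in
theorem isTorsorFunctor [ConnectedSpace X] : IsTorsorFunctor n 𝔤 where
  torsor := isMCTorsor
  map_mem η η' a h U α := by
    refine ⟨IsEquivariant.mul (U := U) α.2.1 (a.equivariant.res le_top).inv,
      IsSmooth.mul (U := U) n α.2.2.1 ((a.smooth.res n le_top).inv n), ?_⟩
    refine (logDeriv_mul_inv (U := U) α.2.2.1 (a.smooth.res n le_top)).trans ?_
    rw [α.2.2.2]
    exact (gauge_res le_top a.val η.form).trans (by rw [h])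

end SolutionTorsor

/-! ### Torsors -/

section Torsors

variable {n : ℕ} {X : Type u} [TopologicalSpace X] [ChartedSpace (EuclideanSpace ℝ (Fin n)) X]
  {x : X} {𝔤 𝔥 : NilpRep x} {U V W : Opens X}

lemma isLocConst_const (U : Opens X) : IsLocConst n (fun _ _ => (0 : 𝔤) : Raw x U 𝔤) :=
  fun y p => Filter.Eventually.of_forall fun u => by
    rw [branch]
    split_ifs <;> rfl

/-- The unit section of `exp(𝔤)`. -/
def ExpSec.one : ExpSec n 𝔤 U :=
  ⟨fun _ _ => 0, fun _ _ _ => (map_zero _).symm, isLocConst_const (n := n) U⟩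

/-- The inverse of a section of `exp(𝔤)`. -/
def ExpSec.inv (g : ExpSec n 𝔤 U) : ExpSec n 𝔤 U :=
  ⟨Raw.inv (U := U) g.1, IsEquivariant.inv (U := U) g.2.1, fun y p => by
    filter_upwards [g.2.2 y p] with u hu
    rw [branch_inv (U := U)]
    exact congrArg Neg.neg hu⟩

lemma ExpSec.ext' {g h : ExpSec n 𝔤 U} (H : ∀ y p, g.1 y p = h.1 y p) : g = h :=
  Subtype.ext (funext fun y => funext fun p => H y p)

lemma ExpSec.mul_inv_mul (g h : ExpSec n 𝔤 U) : (g.mul h.inv).mul h = g :=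
  ExpSec.ext' fun _ _ => bch_neg_cancel_right _ _

lemma ExpSec.mul_right_cancel {g h k : ExpSec n 𝔤 U} (H : g.mul k = h.mul k) : g = h :=
  ExpSec.ext' fun y p => by
    have h1 : bch (g.1 y p) (k.1 y p) = bch (h.1 y p) (k.1 y p) :=
      congrFun (congrFun (congrArg Subtype.val H) y) p
    rw [← bch_cancel_neg_right (g.1 y p) (k.1 y p), h1, bch_cancel_neg_right]

namespace Torsor

variable (P : Torsor n 𝔤)

/-- Sections of a torsor. -/
abbrev Sec (U : Opens X) : Type u := P.sheaf.presheaf.obj (op U)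

lemma exists_sec (y : X) : ∃ (U : Opens X) (_ : y ∈ U), Nonempty (P.Sec U) := by
  obtain ⟨e, -⟩ := P.stalk y
  obtain ⟨U, hU, b, -⟩ := exists_germ_eq' P.sheaf
    (e ((expSheaf n 𝔤).presheaf.germ ⊤ y trivial ExpSec.one))
  exact ⟨U, hU, ⟨b⟩⟩

lemma act_injective {g h : ExpSec n 𝔤 U} {b : P.Sec U} (H : P.act g b = P.act h b) : g = h := by
  refine eq_of_forall_resSec_eq _ fun y hy => ?_
  obtain ⟨e, he⟩ := P.stalk y
  beta_reduce at he
  obtain ⟨V, hV, k, hk⟩ := exists_germ_eq' (expSheaf n 𝔤) (e.symm (P.sheaf.presheaf.germ U y hy b))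
  have hyW : y ∈ U ⊓ V := ⟨hy, hV⟩
  have h1 : e ((expSheaf n 𝔤).presheaf.germ (U ⊓ V) y hyW
      (resSec (expSheaf n 𝔤) inf_le_right k)) =
        P.sheaf.presheaf.germ (U ⊓ V) y hyW (resSec P.sheaf inf_le_left b) := by
    rw [germ_resSec, germ_resSec, hk, e.apply_symm_apply]
  have h2 := he _ hyW (resSec (expSheaf n 𝔤) inf_le_left g) _ _ h1
  have h3 := he _ hyW (resSec (expSheaf n 𝔤) inf_le_left h) _ _ h1
  rw [← P.act_res, H, P.act_res, ← h3] at h2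
  obtain ⟨W, hW, w1, w2, hw⟩ := exists_resSec_eq _ _ _ (e.injective h2)
  exact ⟨W, hW, w1.trans inf_le_left, ExpSec.mul_right_cancel
    (g := resSec (expSheaf n 𝔤) (w1.trans inf_le_left) g)
    (h := resSec (expSheaf n 𝔤) (w1.trans inf_le_left) h)
    (k := resSec (expSheaf n 𝔤) (w1.trans inf_le_right) k) hw⟩

lemma exists_act_eq (b c : P.Sec U) : ∃ g : ExpSec n 𝔤 U, P.act g b = c := by
  obtain ⟨g, h, hg⟩ := exists_section_of_locally (U := U) (expSheaf n 𝔤)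
    (fun V g => ∃ h : V ≤ U, P.act g (resSec P.sheaf h b) = resSec P.sheaf h c)
    (fun V W h g ⟨h', hg⟩ => ⟨h.trans h', by
      rw [← resSec_resSec P.sheaf h' h, ← P.act_res, hg, resSec_resSec]⟩)
    (fun V g g' _ ⟨h, hg⟩ ⟨_, hg'⟩ => P.act_injective (hg.trans hg'.symm))
    (fun g h => ⟨le_rfl, by
      rw [resSec_self, resSec_self]
      refine eq_of_forall_resSec_eq _ fun y hy => ?_
      obtain ⟨V, hyV, hV, _, hg⟩ := h y hy
      exact ⟨V, hyV, hV, (P.act_res hV g b).trans hg⟩⟩)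
    fun y hy => by
      obtain ⟨e, he⟩ := P.stalk y
      beta_reduce at he
      obtain ⟨V, hV, k, hk⟩ := exists_germ_eq' (expSheaf n 𝔤)
        (e.symm (P.sheaf.presheaf.germ U y hy b))
      obtain ⟨V', hV', k', hk'⟩ := exists_germ_eq' (expSheaf n 𝔤)
        (e.symm (P.sheaf.presheaf.germ U y hy c))
      have hyW : y ∈ U ⊓ (V ⊓ V') := ⟨hy, hV, hV'⟩
      have h1 : U ⊓ (V ⊓ V') ≤ V := inf_le_right.trans inf_le_left
      have h2 : U ⊓ (V ⊓ V') ≤ V' := inf_le_right.trans inf_le_right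
      have h3 := he _ hyW (ExpSec.mul (resSec (expSheaf n 𝔤) h2 k')
        (ExpSec.inv (resSec (expSheaf n 𝔤) h1 k))) (resSec (expSheaf n 𝔤) h1 k)
        (resSec P.sheaf inf_le_left b) (by
          rw [germ_resSec, germ_resSec, hk, e.apply_symm_apply])
      rw [ExpSec.mul_inv_mul, germ_resSec, hk', e.apply_symm_apply] at h3
      obtain ⟨W, hW, w1, w2, hw⟩ := exists_resSec_eq _ _ _ h3
      rw [P.act_res, resSec_resSec] at hw
      exact ⟨W, hW, w1, _, w1, hw.symm⟩
  rw [resSec_self, resSec_self] at hg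
  exact ⟨g, hg⟩

end Torsor

namespace Torsor.HomOver

variable {θ : 𝔤 ⟶ 𝔥} {P : Torsor n 𝔤} {Q R : Torsor n 𝔥}

/-- The value of an equivariant morphism on a section. -/
def app (f : HomOver θ P Q) (b : P.Sec U) : Q.Sec U := f.hom.app (op U) b

lemma app_res (f : HomOver θ P Q) (h : V ≤ U) (b : P.Sec U) :
    f.app (resSec P.sheaf h b) = resSec Q.sheaf h (f.app b) :=
  congrArg (fun k => k b) (f.hom.naturality (homOfLE h).op)

lemma app_act (f : HomOver θ P Q) (g : ExpSec n 𝔤 U) (b : P.Sec U) :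
    f.app (P.act g b) = Q.act (g.map θ) (f.app b) := f.equivariant g b

end Torsor.HomOver

namespace Torsor.Hom

variable {P Q : Torsor n 𝔤}

/-- The value of a morphism of torsors on a section. -/
def app (f : P ⟶ Q) (b : P.Sec U) : Q.Sec U := (Torsor.Hom.hom f).app (op U) b

lemma app_res (f : P ⟶ Q) (h : V ≤ U) (b : P.Sec U) :
    app f (resSec P.sheaf h b) = resSec Q.sheaf h (app f b) :=
  congrArg (fun k => k b) ((Torsor.Hom.hom f).naturality (homOfLE h).op)

lemma app_act (f : P ⟶ Q) (g : ExpSec n 𝔤 U) (b : P.Sec U) :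
    app f (P.act g b) = Q.act g (app f b) := Torsor.Hom.equivariant f g b

lemma ext_app {f f' : P ⟶ Q} (h : ∀ (U : Opens X) (b : P.Sec U), app f b = app f' b) : f = f' :=
  Torsor.Hom.ext (NatTrans.ext (funext fun U => by
    ext b
    exact h U.unop b))

/-- A morphism of torsors, from its values on sections. -/
def ofApp (F : ∀ (U : Opens X), P.Sec U → Q.Sec U)
    (hres : ∀ (U V : Opens X) (h : V ≤ U) b, F V (resSec P.sheaf h b) = resSec Q.sheaf h (F U b))
    (hact : ∀ (U : Opens X) (g : ExpSec n 𝔤 U) b, F U (P.act g b) = Q.act g (F U b)) : P ⟶ Q where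
  hom :=
    { app := fun U => ↾(F U.unop)
      naturality := fun U V i => by
        ext b
        exact hres U.unop V.unop i.unop.le b }
  equivariant g b := hact _ g b

end Torsor.Hom

namespace Torsor.HomOver

variable {θ : 𝔤 ⟶ 𝔥} {P : Torsor n 𝔤} {Q R : Torsor n 𝔥}

/-- The graph of the morphism `Q ⟶ R` through which `h` factors: it takes `g · f(b)` to
`g · h(b)`. -/
def FactorRel (f : HomOver θ P Q) (h : HomOver θ P R) (c : Q.Sec U) (r : R.Sec U) : Prop :=
  ∀ (V : Opens X) (hV : V ≤ U) (b : P.Sec V) (g : ExpSec n 𝔥 V),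
    resSec Q.sheaf hV c = Q.act g (f.app b) → resSec R.sheaf hV r = R.act g (h.app b)

variable (f : HomOver θ P Q) (h : HomOver θ P R)

lemma act_app_eq {b b' : P.Sec U} {g g' : ExpSec n 𝔥 U}
    (H : Q.act g (f.app b) = Q.act g' (f.app b')) :
    R.act g (h.app b) = R.act g' (h.app b') := by
  obtain ⟨s, rfl⟩ := P.exists_act_eq b b'
  rw [f.app_act, Q.mul_act] at H
  rw [h.app_act, R.mul_act, Q.act_injective H]

variable {f h}

lemma FactorRel.res {c : Q.Sec U} {r : R.Sec U} (H : FactorRel f h c r) (hV : V ≤ U) :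
    FactorRel f h (resSec Q.sheaf hV c) (resSec R.sheaf hV r) := fun W hW b g hb => by
  rw [resSec_resSec] at hb ⊢
  exact H W _ b g hb

/-- Near every point, a section of `Q` is of the form `g · f(b)`. -/
lemma exists_eq_act_app (f : HomOver θ P Q) (c : Q.Sec U) {y : X} (hy : y ∈ U) :
    ∃ (V : Opens X) (_ : y ∈ V) (hV : V ≤ U) (b : P.Sec V) (g : ExpSec n 𝔥 V),
      resSec Q.sheaf hV c = Q.act g (f.app b) := by
  obtain ⟨V, hV, ⟨b⟩⟩ := P.exists_sec y
  obtain ⟨g, hg⟩ := Q.exists_act_eq (f.app (resSec P.sheaf (inf_le_right : U ⊓ V ≤ V) b))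
    (resSec Q.sheaf (inf_le_left : U ⊓ V ≤ U) c)
  exact ⟨U ⊓ V, ⟨hy, hV⟩, inf_le_left, _, g, hg.symm⟩

lemma FactorRel.unique {c : Q.Sec U} {r r' : R.Sec U} (H : FactorRel f h c r)
    (H' : FactorRel f h c r') : r = r' :=
  eq_of_forall_resSec_eq _ fun y hy => by
    obtain ⟨V, hyV, hV, b, g, hb⟩ := exists_eq_act_app f c hy
    exact ⟨V, hyV, hV, (H V hV b g hb).trans (H' V hV b g hb).symm⟩

lemma factorRel_of_locally {c : Q.Sec U} {r : R.Sec U}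
    (H : ∀ y ∈ U, ∃ (V : Opens X) (_ : y ∈ V) (hV : V ≤ U),
      FactorRel f h (resSec Q.sheaf hV c) (resSec R.sheaf hV r)) : FactorRel f h c r :=
  fun V hV b g hb => eq_of_forall_resSec_eq _ fun y hy => by
    obtain ⟨W, hyW, hW, H⟩ := H y (hV hy)
    refine ⟨V ⊓ W, ⟨hy, hyW⟩, inf_le_left, ?_⟩
    have h1 := H (V ⊓ W) inf_le_right (resSec P.sheaf inf_le_left b)
      (resSec (expSheaf n 𝔥) inf_le_left g) (by
        rw [resSec_resSec, f.app_res, ← Q.act_res, ← hb, resSec_resSec])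
    rw [resSec_resSec] at h1 ⊢
    rw [h1, h.app_res, ← R.act_res]

/-- The sections which are related to `c` exist near each point and are unique, hence glue. -/
lemma exists_factorRel (f : HomOver θ P Q) (h : HomOver θ P R) (c : Q.Sec U) :
    ∃ r, FactorRel f h c r := by
  obtain ⟨r, hU, hr⟩ := exists_section_of_locally (U := U) R.sheaf
    (fun V r => ∃ hV : V ≤ U, FactorRel f h (resSec Q.sheaf hV c) r)
    (fun V W hW r ⟨hV, H⟩ => ⟨hW.trans hV, by
      rw [← resSec_resSec Q.sheaf hV hW]
      exact H.res hW⟩)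
    (fun V r r' _ ⟨_, H⟩ ⟨_, H'⟩ => H.unique H')
    (fun r H => ⟨le_rfl, by
      rw [resSec_self]
      refine factorRel_of_locally fun y hy => ?_
      obtain ⟨V, hyV, hV, _, H⟩ := H y hy
      exact ⟨V, hyV, hV, H⟩⟩)
    fun y hy => by
      obtain ⟨V, hyV, hV, b, g, hb⟩ := exists_eq_act_app f c hy
      refine ⟨V, hyV, hV, R.act g (h.app b), hV, fun W hW b' g' hb' => ?_⟩
      rw [hb, Q.act_res, ← f.app_res] at hb'
      rw [R.act_res, ← h.app_res]
      exact act_app_eq f h hb'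
  rw [resSec_self] at hr
  exact ⟨r, hr⟩

lemma FactorRel.act {c : Q.Sec U} {r : R.Sec U} (H : FactorRel f h c r) (s : ExpSec n 𝔥 U) :
    FactorRel f h (Q.act s c) (R.act s r) := fun V hV b g hb => by
  have h1 : resSec Q.sheaf hV c =
      Q.act (ExpSec.mul (ExpSec.inv (resSec (expSheaf n 𝔥) hV s)) g) (f.app b) := by
    rw [← Q.mul_act, ← hb, Q.act_res, Q.mul_act]
    obtain ⟨k, hk⟩ := Q.exists_act_eq (f.app b) (resSec Q.sheaf hV c)
    rw [← hk, Q.mul_act]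
    congr 1
    exact ExpSec.ext' fun _ _ => (by
      change _ = bch (bch (-_) _) _
      rw [bch_neg_left, bch_zero_left])
  rw [R.act_res, H V hV b _ h1, R.mul_act]
  congr 1
  exact ExpSec.ext' fun _ _ => bch_cancel_neg_left _ _

/-- Every equivariant morphism is a change of structure group: near each point there is a section
`b` of the source, and the factorization of `h` through `f` has to take `g · f(b)` to `g · h(b)`. -/
theorem isPushforward (f : HomOver θ P Q) : f.IsPushforward := fun R h => by
  choose k hk using fun (U : Opens X) (c : Q.Sec U) => exists_factorRel f h c
  refine ⟨Torsor.Hom.ofApp k (fun U V hV c => (hk V _).unique ((hk U c).res hV))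
    (fun U g c => (hk U _).unique ((hk U c).act g)), ?_, fun k' hk' => ?_⟩
  · refine HomOver.ext (NatTrans.ext (funext fun U => ?_))
    ext b
    refine (hk U.unop (f.app b)).unique fun V hV b' g hb => ?_
    obtain ⟨s, hs⟩ := P.exists_act_eq b' (resSec P.sheaf hV b)
    rw [← f.app_res, ← hs, f.app_act] at hb
    change resSec R.sheaf hV (h.app b) = _
    rw [← h.app_res, ← hs, h.app_act, Q.act_injective hb]
  · refine Torsor.Hom.ext_app fun U c => ?_
    refine FactorRel.unique (f := f) (h := h) (fun V hV b g hb => ?_) (hk U c)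
    rw [← Torsor.Hom.app_res, hb, Torsor.Hom.app_act, ← hk']
    rfl

end Torsor.HomOver

/-- Every morphism of torsors is an isomorphism. -/
theorem Torsor.isIso {P Q : Torsor n 𝔤} (f : P ⟶ Q) : IsIso f := by
  let toOver : ∀ {R : Torsor n 𝔤}, (P ⟶ R) → Torsor.HomOver (𝟙 𝔤) P R := fun k =>
    ⟨Torsor.Hom.hom k, fun g b => Torsor.Hom.equivariant k g b⟩
  have hover : ∀ {R : Torsor n 𝔤} (k : Q ⟶ R), (toOver f).comp k = toOver (f ≫ k) := fun k => rfl
  have hinj : ∀ {R : Torsor n 𝔤} {k k' : P ⟶ R}, toOver k = toOver k' → k = k' := fun h =>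
    Torsor.Hom.ext (congrArg Torsor.HomOver.hom h)
  obtain ⟨k, hk, -⟩ := (toOver f).isPushforward P (toOver (𝟙 P))
  have h1 : f ≫ k = 𝟙 P := hinj hk
  obtain ⟨m, -, hm⟩ := (toOver f).isPushforward Q (toOver f)
  refine ⟨k, h1, ?_⟩
  rw [hm (k ≫ f) (by simp only [hover, ← Category.assoc, h1, Category.id_comp]),
    hm (𝟙 Q) (by simp only [hover, Category.comp_id])]

end Torsors

/-! ### Morphisms of the deformation groupoid and of torsors -/

section FullyFaithful

variable {n : ℕ} {X : Type u} [TopologicalSpace X] [ChartedSpace (EuclideanSpace ℝ (Fin n)) X]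
  {x : X} {𝔤 : NilpRep x} {U V W : Opens X} [IsManifold (𝓡 n) ∞ X]

/-- Sections of `𝔹_η`. -/
abbrev MCSec (η : MC n 𝔤) (U : Opens X) : Type u := (mcSheaf η).presheaf.obj (op U)

variable [ConnectedSpace X] (hG : IsGaugeGroupoid n 𝔤) (hB : IsTorsorFunctor n 𝔤)

/-- A gauge transformation `a` is determined by `α ↦ α a⁻¹`, since there are local sections `α`. -/
theorem faithful_torsorFunctor : (torsorFunctor hG hB).Faithful where
  map_injective {η η'} f g h := by
    refine Def.Hom.ext (FunSec.ext (funext fun y => funext fun p => ?_))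
    obtain ⟨W, hW, s, hs⟩ := exists_mcPredicate η.mc y.1
    have h1 : Torsor.Hom.app ((torsorFunctor hG hB).map f) (U := W) ⟨s, hs⟩ =
        Torsor.Hom.app ((torsorFunctor hG hB).map g) (U := W) ⟨s, hs⟩ := by rw [h]
    have h2 : bch (s ⟨y.1, hW⟩ p) (-f.elt.val y p) = bch (s ⟨y.1, hW⟩ p) (-g.elt.val y p) :=
      congrFun (congrFun (congrArg Subtype.val h1) ⟨y.1, hW⟩) p
    have h3 := congrArg (bch (-s ⟨y.1, hW⟩ p)) h2
    rwa [bch_neg_cancel_left, bch_neg_cancel_left, neg_inj] at h3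

variable {hG hB}

omit [IsManifold (𝓡 n) ∞ X] [ConnectedSpace X] in
/-- For a morphism of torsors `k`, the value of `k(α)⁻¹ α` does not depend on the section `α`. -/
lemma neg_app_bch_eq {η η' : MC n 𝔤} (k : torsorOf hG hB η ⟶ torsorOf hG hB η')
    (α : MCSec η U) (β : MCSec η V) {y : X} (hU : y ∈ U) (hV : y ∈ V)
    (p : FundamentalGroupoid.mk x ⟶ FundamentalGroupoid.mk y) :
    bch (-(show MCSec η' U from Torsor.Hom.app k α).1 ⟨y, hU⟩ p) (α.1 ⟨y, hU⟩ p) =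
      bch (-(show MCSec η' V from Torsor.Hom.app k β).1 ⟨y, hV⟩ p) (β.1 ⟨y, hV⟩ p) := by
  let W := U ⊓ V
  have hW : y ∈ W := ⟨hU, hV⟩
  let αW : MCSec η W := resSec (mcSheaf η) inf_le_left α
  let βW : MCSec η W := resSec (mcSheaf η) inf_le_right β
  obtain ⟨g, hg⟩ := (torsorOf hG hB η).exists_act_eq (U := W) βW αW
  have h1 : bch (g.1 ⟨y, hW⟩ p) (β.1 ⟨y, hV⟩ p) = α.1 ⟨y, hU⟩ p :=
    congrFun (congrFun (congrArg Subtype.val hg) ⟨y, hW⟩) p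
  have hα : Torsor.Hom.app k αW = resSec (mcSheaf η') inf_le_left (Torsor.Hom.app k α) :=
    Torsor.Hom.app_res k inf_le_left α
  have hβ : Torsor.Hom.app k βW = resSec (mcSheaf η') inf_le_right (Torsor.Hom.app k β) :=
    Torsor.Hom.app_res k inf_le_right β
  have h2 := Torsor.Hom.app_act k g βW
  rw [hg, hα, hβ] at h2
  have h3 : (show MCSec η' U from Torsor.Hom.app k α).1 ⟨y, hU⟩ p =
      bch (g.1 ⟨y, hW⟩ p) ((show MCSec η' V from Torsor.Hom.app k β).1 ⟨y, hV⟩ p) :=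
    congrFun (congrFun (congrArg Subtype.val h2) ⟨y, hW⟩) p
  rw [h3, ← h1, neg_bch, bch_assoc, bch_neg_cancel_left]

variable (hG hB)

theorem full_torsorFunctor : (torsorFunctor hG hB).Full where
  map_surjective {η η'} k := by
    choose W hW s hs using fun y => exists_mcPredicate η.mc y
    let α : ∀ y, MCSec η.mc (W y) := fun y => ⟨s y, hs y⟩
    let app : ∀ {U : Opens X}, MCSec η.mc U → MCSec η'.mc U := fun α => Torsor.Hom.app k α
    -- the gauge transformation is `k(α)⁻¹ α` for any local section `α`
    let a : Raw x ⊤ 𝔤 := fun y p =>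
      bch (-(app (α y.1)).1 ⟨y.1, hW y.1⟩ p) ((α y.1).1 ⟨y.1, hW y.1⟩ p)
    have ha : ∀ {U : Opens X} (β : MCSec η.mc U),
        a.res le_top = Raw.mul (U := U) (Raw.inv (U := U) (app β).1) β.1 := fun {U} β =>
      funext fun y => funext fun p => neg_app_bch_eq (hG := hG) (hB := hB) k (α y.1) β (hW y.1) y.2 p
    have heq : IsEquivariant 𝔤 a := fun y γ p => by
      have h : IsEquivariant 𝔤 (a.res (le_top : W y.1 ≤ ⊤)) := by
        rw [ha (α y.1)]
        exact (IsEquivariant.inv (U := W y.1) (app (α y.1)).2.1).mul (α y.1).2.1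
      exact h ⟨y.1, hW y.1⟩ γ p
    have hsm : IsSmooth n a := fun y p => by
      have h : IsSmooth n (a.res (le_top : W y.1 ≤ ⊤)) := by
        rw [ha (α y.1)]
        exact (IsSmooth.inv (U := W y.1) n (app (α y.1)).2.2.1).mul n (α y.1).2.2.1
      exact (h ⟨y.1, hW y.1⟩ p).congr_of_eventuallyEq
        (branch_res n (le_top : W y.1 ≤ ⊤) a ⟨y.1, hW y.1⟩ p).symm
    have happ : ∀ {U : Opens X} (β : MCSec η.mc U),
        Raw.mul (U := U) β.1 (a.res le_top).inv = (app β).1 := fun {U} β => by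
      funext y p
      rw [ha β]
      change bch _ (-bch (-_) _) = _
      rw [neg_bch, neg_neg, bch_cancel_neg_left]
    have hgauge : gauge n a η.mc.form = η'.mc.form := by
      funext y p
      have h := logDeriv_mul_inv (U := W y.1) (α y.1).2.2.1 (hsm.res n le_top)
      rw [happ (α y.1), (α y.1).2.2.2, gauge_res, (app (α y.1)).2.2.2] at h
      exact (congrFun (congrFun h ⟨y.1, hW y.1⟩) p).symm
    refine ⟨⟨⟨a, heq, hsm⟩, hgauge⟩, Torsor.Hom.ext_app fun U b => Subtype.ext ?_⟩
    exact happ b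

end FullyFaithful

/-! ### Weighted means in `exp(𝔤)` -/

section Mean

variable {L : Type*} [LieRing L] [LieAlgebra ℝ L]

lemma nestedBracket_mem_of_lie_mem {I : LieIdeal ℝ L} {x y : L} (h : ⁅x, y⁆ ∈ I) :
    ∀ l : List L, (∀ z ∈ l, z = x ∨ z = y) → 2 ≤ l.length → nestedBracket l ∈ I
  | [], _, h2 => by simp at h2
  | [_], _, h2 => by simp at h2
  | [a, b], hl, _ => by
    have hyx : ⁅y, x⁆ ∈ I := by
      rw [← lie_skew]
      exact neg_mem h
    simp only [nestedBracket]
    rcases hl a (by simp) with rfl | rfl <;> rcases hl b (by simp) with rfl | rfl <;>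
      simp_all
  | a :: b :: c :: l, hl, _ => by
    rw [nestedBracket]
    exact I.lie_mem (nestedBracket_mem_of_lie_mem h (b :: c :: l)
      (fun z hz => hl z (List.mem_cons_of_mem _ hz)) (by simp))

omit [LieRing L] [LieAlgebra ℝ L] in
lemma mem_dynkinWord {x y z : L} {l : List (ℕ × ℕ)} (hz : z ∈ dynkinWord x y l) :
    z = x ∨ z = y := by
  simp only [dynkinWord, List.mem_flatMap, List.mem_append, List.mem_replicate] at hz
  obtain ⟨_, _, ⟨-, rfl⟩ | ⟨-, rfl⟩⟩ := hz <;> simp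

lemma eq_of_sum_eq_one {l : List (ℕ × ℕ)} (hl : l ∈ dynkinIndex)
    (h : (l.map fun rs => rs.1 + rs.2).sum ≤ 1) : l = [(1, 0)] ∨ l = [(0, 1)] := by
  obtain ⟨h1, h2⟩ := hl
  match l with
  | [] => exact absurd rfl h1
  | [(a, b)] =>
    have := h2 (a, b) (by simp)
    simp only [List.map_cons, List.map_nil, List.sum_cons, List.sum_nil] at h
    simp only [ne_eq, Prod.mk.injEq] at this
    simp only [List.cons.injEq, Prod.mk.injEq, and_true]
    omega
  | (a, b) :: (c, d) :: l =>
    have h3 := h2 (a, b) (by simp)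
    have h4 := h2 (c, d) (by simp)
    simp only [List.map_cons, List.sum_cons] at h
    simp only [ne_eq, Prod.mk.injEq] at h3 h4
    omega

/-- If `x` and `y` commute modulo an ideal, their product is `x + y` modulo this ideal. -/
theorem bch_sub_add_mem [LieRing.IsNilpotent L] {I : LieIdeal ℝ L} {x y : L} (h : ⁅x, y⁆ ∈ I) :
    bch x y - (x + y) ∈ I := by
  obtain ⟨s, hs, hs'⟩ := exists_finset_bch L
  have h1 : ∀ l ∈ dynkinIndex, l ≠ [(1, 0)] → l ≠ [(0, 1)] →
      dynkinCoeff l • nestedBracket (dynkinWord x y l) ∈ I := fun l hl hl1 hl2 => by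
    refine I.smul_mem _ (nestedBracket_mem_of_lie_mem h _ (fun z hz => mem_dynkinWord hz) ?_)
    rw [length_dynkinWord]
    by_contra hc
    rcases eq_of_sum_eq_one hl (by omega) with h | h
    · exact hl1 h
    · exact hl2 h
  let t : Finset (List (ℕ × ℕ)) := s ∪ {[(1, 0)], [(0, 1)]}
  have ht : ↑t ⊆ dynkinIndex := by
    intro l hl
    simp only [t, Finset.coe_union, Finset.coe_insert, Finset.coe_singleton, Set.mem_union,
      Set.mem_insert_iff, Set.mem_singleton_iff] at hl
    rcases hl with hl | rfl | rfl
    · exact hs hl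
    · exact ⟨by simp, by simp⟩
    · exact ⟨by simp, by simp⟩
  rw [bch_eq_sum ht x y fun l hl hlt => hs' x y l hl fun hls =>
    hlt (Finset.mem_union_left _ hls)]
  have h2 : ({[(1, 0)], [(0, 1)]} : Finset (List (ℕ × ℕ))) ⊆ t := Finset.subset_union_right
  rw [← Finset.sum_sdiff h2, Finset.sum_pair (by simp)]
  have h3 : dynkinCoeff [(1, 0)] • nestedBracket (dynkinWord x y [(1, 0)]) = x := by
    simp [dynkinCoeff, dynkinWord, nestedBracket]
  have h4 : dynkinCoeff [(0, 1)] • nestedBracket (dynkinWord x y [(0, 1)]) = y := by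
    simp [dynkinCoeff, dynkinWord, nestedBracket]
  rw [h3, h4, add_sub_cancel_right]
  refine sum_mem fun l hl => ?_
  simp only [Finset.mem_sdiff, Finset.mem_insert, Finset.mem_singleton, not_or] at hl
  exact h1 l (ht hl.1) hl.2.1 hl.2.2

lemma nestedBracket_map_sub_mem {ι : Type*} {I : LieIdeal ℝ L} {f g : ι → L}
    (h : ∀ i, f i - g i ∈ I) (l : List ι) :
    nestedBracket (l.map f) - nestedBracket (l.map g) ∈ I := by
  induction l with
  | nil => simp [nestedBracket]
  | cons a l ih =>
    cases l with
    | nil => exact h a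
    | cons b l =>
      simp only [List.map_cons, nestedBracket] at ih ⊢
      have h1 : ∀ p q r s : L, ⁅p, r⁆ - ⁅q, s⁆ = ⁅p - q, r⁆ + ⁅q, r - s⁆ := fun p q r s => by
        rw [sub_lie, lie_sub]
        abel
      rw [h1]
      exact add_mem (lie_mem_left ℝ L I _ _ (h a)) (I.lie_mem ih)

/-- Congruence modulo an ideal is compatible with the Campbell-Baker-Hausdorff product. -/
theorem bch_sub_bch_mem [LieRing.IsNilpotent L] {I : LieIdeal ℝ L} {x x' y y' : L}
    (hx : x - x' ∈ I) (hy : y - y' ∈ I) : bch x y - bch x' y' ∈ I := by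
  obtain ⟨s, hs, h⟩ := exists_finset_bch L
  rw [bch_eq_sum hs x y (h x y), bch_eq_sum hs x' y' (h x' y'), ← Finset.sum_sub_distrib]
  refine sum_mem fun l _ => ?_
  rw [← smul_sub]
  refine I.smul_mem _ ?_
  have hw : ∀ p q : L, dynkinWord p q l =
      (dynkinWord true false l).map fun b => if b then p else q := fun p q => by
    simp [dynkinWord, List.map_flatMap]
  rw [hw x y, hw x' y']
  exact nestedBracket_map_sub_mem (by rintro (_ | _) <;> simpa) _

variable {ι : Type*}

/-- One step `m ↦ m · ∑ wᵢ (m⁻¹ cᵢ)` towards the weighted mean of the `cᵢ` in `exp(𝔤)`. -/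
def meanStep (s : Finset ι) (w : ι → ℝ) (c : ι → L) (m : L) : L :=
  bch m (∑ i ∈ s, w i • bch (-m) (c i))

/-- The `N`-th approximation to the weighted mean, starting at `m`. -/
def meanIter (s : Finset ι) (w : ι → ℝ) (c : ι → L) : ℕ → L → L
  | 0, m => m
  | N + 1, m => meanStep s w c (meanIter s w c N m)

lemma meanIter_congr {s : Finset ι} {w : ι → ℝ} {c c' : ι → L} (h : ∀ i ∈ s, w i ≠ 0 → c i = c' i)
    (N : ℕ) (m : L) : meanIter s w c N m = meanIter s w c' N m := by
  induction N with
  | zero => rfl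
  | succ N ih =>
    rw [meanIter, meanIter, ih, meanStep, meanStep]
    congr 1
    refine Finset.sum_congr rfl fun i hi => ?_
    by_cases hw : w i = 0
    · simp [hw]
    · rw [h i hi hw]

lemma meanIter_subset {s t : Finset ι} (hst : s ⊆ t) {w : ι → ℝ} {c : ι → L}
    (h : ∀ i ∈ t, i ∉ s → w i = 0) (N : ℕ) (m : L) :
    meanIter s w c N m = meanIter t w c N m := by
  induction N with
  | zero => rfl
  | succ N ih =>
    rw [meanIter, meanIter, ih, meanStep, meanStep]
    congr 1
    exact Finset.sum_subset hst fun i hi his => by rw [h i hi his, zero_smul]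

lemma map_meanIter [LieRing.IsNilpotent L] (f : L →ₗ⁅ℝ⁆ L) (s : Finset ι) (w : ι → ℝ) (c : ι → L)
    (N : ℕ) (m : L) : f (meanIter s w c N m) = meanIter s w (fun i => f (c i)) N (f m) := by
  induction N with
  | zero => rfl
  | succ N ih => simp [meanIter, meanStep, map_bch, ih]

variable [LieRing.IsNilpotent L] [FiniteDimensional ℝ L]

lemma meanIter_bch (g : L) (s : Finset ι) (w : ι → ℝ) (c : ι → L) (N : ℕ) (m : L) :
    meanIter s w (fun i => bch g (c i)) N (bch g m) = bch g (meanIter s w c N m) := by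
  induction N with
  | zero => rfl
  | succ N ih =>
    rw [meanIter, ih, meanIter, meanStep, meanStep, bch_assoc]
    simp only [neg_bch g, bch_assoc, bch_neg_cancel_left]

/-- The step is a contraction for the filtration by the lower central series. -/
lemma meanStep_contract {s : Finset ι} {w : ι → ℝ} (hw : ∑ i ∈ s, w i = 1) (c : ι → L) {k : ℕ}
    {m m' : L} (h : bch (-m) m' ∈ lcs L k) :
    bch (-meanStep s w c m) (meanStep s w c m') ∈ lcs L (k + 1) := by
  obtain ⟨e, rfl⟩ : ∃ e, m' = bch m e := ⟨bch (-m) m', (bch_cancel_neg_left m m').symm⟩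
  rw [bch_neg_cancel_left] at h
  set d : ι → L := fun i => bch (-m) (c i)
  set C : L := ∑ i ∈ s, w i • d i with hC
  have h1 : meanStep s w c m = bch m C := rfl
  have h2 : meanStep s w c (bch m e) = bch m (bch e (∑ i ∈ s, w i • bch (-e) (d i))) := by
    rw [meanStep, bch_assoc]
    simp only [neg_bch m, bch_assoc, d]
  set D : L := ∑ i ∈ s, w i • bch (-e) (d i)
  -- Modulo `lcs L (k + 1)` the element `e` is central and products with it are sums. Since the
  -- weights have the sum `1`, replacing `m` by `m e` changes the mean of the `m⁻¹ cᵢ` by `-e`.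
  have h3 : D - (C - e) ∈ lcs L (k + 1) := by
    have : D - (C - e) = ∑ i ∈ s, w i • (bch (-e) (d i) - (-e + d i)) := by
      simp only [smul_sub, smul_add, Finset.sum_sub_distrib, Finset.sum_add_distrib,
        ← Finset.sum_smul, hw, one_smul, D, hC]
      abel
    rw [this]
    exact sum_mem fun i _ => (lcs L (k + 1)).smul_mem _
      (bch_sub_add_mem (lie_mem_lcs_succ' (neg_mem h) _))
  have h4 : bch e D - C ∈ lcs L (k + 1) := by
    have := add_mem (bch_sub_add_mem (I := lcs L (k + 1)) (lie_mem_lcs_succ' h D)) h3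
    convert this using 1
    abel
  rw [h1, h2, neg_bch m, bch_assoc, bch_neg_cancel_left]
  have h5 := bch_sub_bch_mem (I := lcs L (k + 1)) (x := -C) (x' := -C) (by simp) h4
  rwa [bch_neg_left, sub_zero] at h5

lemma meanIter_contract {s : Finset ι} {w : ι → ℝ} (hw : ∑ i ∈ s, w i = 1) (c : ι → L) (N : ℕ)
    (m m' : L) : bch (-meanIter s w c N m) (meanIter s w c N m') ∈ lcs L N := by
  induction N with
  | zero => simp [lcs]
  | succ N ih => exact meanStep_contract hw c ih

/-- After enough steps, the weighted mean is reached, so that the result does not depend on the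
starting point and is equivariant under left translations. -/
lemma meanIter_bch_zero {N : ℕ} (hN : LieModule.lowerCentralSeries ℝ L L N = ⊥) {s : Finset ι}
    {w : ι → ℝ} (hw : ∑ i ∈ s, w i = 1) (g : L) (c : ι → L) :
    meanIter s w (fun i => bch g (c i)) N 0 = bch g (meanIter s w c N 0) := by
  have h := meanIter_contract hw (fun i => bch g (c i)) N 0 (bch g 0)
  rw [lcs, hN, LieSubmodule.mem_bot, meanIter_bch] at h
  rw [← bch_cancel_neg_left (meanIter s w (fun i => bch g (c i)) N 0) (bch g _), h,
    bch_zero_right]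

end Mean

/-! ### Every torsor comes from a Maurer-Cartan element -/

section EssSurj

variable {n : ℕ} {X : Type u} [TopologicalSpace X] [ChartedSpace (EuclideanSpace ℝ (Fin n)) X]
  {x : X} {𝔤 : NilpRep x} {U V : Opens X}

local notation "𝓔" => EuclideanSpace ℝ (Fin n)

lemma contDiffAt_meanIter {E : Type*} [NormedAddCommGroup E] [NormedSpace ℝ E] {ι : Type*}
    (s : Finset ι) {w : E → ι → ℝ} {u : E} (hw : ∀ i, ContDiffAt ℝ ∞ (fun v => w v i) u)
    (c : ι → 𝔤) (N : ℕ) : ContDiffAt ℝ ∞ (fun v => meanIter s (w v) c N 0) u := by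
  induction N with
  | zero => exact contDiffAt_const
  | succ N ih =>
    refine 𝔤.contDiff_bch.contDiffAt.comp u (ih.prodMk (ContDiffAt.sum fun i _ => ?_))
    exact (hw i).smul (𝔤.contDiff_bch.contDiffAt.comp u (ih.neg.prodMk contDiffAt_const))

section MaurerCartan

variable [IsManifold (𝓡 n) ∞ X] {a : Raw x U 𝔤}

lemma branchForm_logDeriv (ha : IsSmooth n a) (y : U)
    (p : FundamentalGroupoid.mk x ⟶ FundamentalGroupoid.mk y.1) :
    branchForm n (logDeriv n a) y p =ᶠ[𝓝 (chart n y.1 y.1)] mcForm (branch n a y p) := by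
  obtain ⟨r, h⟩ := exists_isChartBall (n := n) y.2
  filter_upwards [h.ball_mem_nhds] with u hu
  exact (h.mcForm_branch ha y.2 p hu).symm

lemma isSmoothForm_logDeriv (ha : IsSmooth n a) : IsSmoothForm n (logDeriv n a) := fun y p =>
  (ContDiffAt.mcForm (ha y p)).congr_of_eventuallyEq (branchForm_logDeriv ha y p)

/-- The logarithmic derivative satisfies the Maurer-Cartan equation. -/
lemma extD_logDeriv (ha : IsSmooth n a) (y : U)
    (p : FundamentalGroupoid.mk x ⟶ FundamentalGroupoid.mk y.1) (v w : 𝓔) :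
    extD n (logDeriv n a) y p v w + ⁅logDeriv n a y p v, logDeriv n a y p w⁆ = 0 := by
  rw [extD_add_lie, curvature_congr (branchForm_logDeriv ha y p), curvature_mcForm (ha y p)]

end MaurerCartan

namespace Torsor

variable (P : Torsor n 𝔤) {ι : Type*} {W : ι → Opens X} (b₀ : ∀ i, P.Sec (W i))

/-- The section `g` of `exp(𝔤)` over `U ∩ Wᵢ` such that `b = g · b₀ᵢ`. -/
def ratio (b : P.Sec U) (i : ι) : ExpSec n 𝔤 (U ⊓ W i) :=
  (P.exists_act_eq (resSec P.sheaf inf_le_right (b₀ i)) (resSec P.sheaf inf_le_left b)).choose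

lemma act_ratio (b : P.Sec U) (i : ι) :
    P.act (P.ratio b₀ b i) (resSec P.sheaf inf_le_right (b₀ i)) = resSec P.sheaf inf_le_left b :=
  (P.exists_act_eq _ _).choose_spec

open Classical in
/-- The value at `(y, p)` of the section `g` such that `b = g · b₀ᵢ`, with the value `0` outside
of `Wᵢ`. -/
def coord (b : P.Sec U) (y : U) (p : FundamentalGroupoid.mk x ⟶ FundamentalGroupoid.mk y.1)
    (i : ι) : 𝔤 :=
  if h : y.1 ∈ W i then (P.ratio b₀ b i).1 ⟨y.1, y.2, h⟩ p else 0

lemma ratio_res (h : V ≤ U) (b : P.Sec U) (i : ι) :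
    P.ratio b₀ (resSec P.sheaf h b) i =
      resSec (expSheaf n 𝔤) (inf_le_inf_right (W i) h) (P.ratio b₀ b i) := by
  refine P.act_injective (b := resSec P.sheaf inf_le_right (b₀ i)) ?_
  have h1 := congrArg (resSec P.sheaf (inf_le_inf_right (W i) h)) (P.act_ratio b₀ b i)
  rw [P.act_res, resSec_resSec, resSec_resSec] at h1
  rw [P.act_ratio, h1, resSec_resSec]

lemma ratio_act (g : ExpSec n 𝔤 U) (b : P.Sec U) (i : ι) :
    P.ratio b₀ (P.act g b) i =
      ExpSec.mul (resSec (expSheaf n 𝔤) inf_le_left g) (P.ratio b₀ b i) := by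
  refine P.act_injective (b := resSec P.sheaf inf_le_right (b₀ i)) ?_
  rw [P.act_ratio, ← P.mul_act, P.act_ratio, P.act_res]

lemma coord_res (h : V ≤ U) (b : P.Sec U) (y : V)
    (p : FundamentalGroupoid.mk x ⟶ FundamentalGroupoid.mk y.1) :
    P.coord b₀ (resSec P.sheaf h b) y p = P.coord b₀ b ⟨y.1, h y.2⟩ p := by
  funext i
  rw [coord, coord]
  split_ifs with hy
  · rw [ratio_res]
    rfl
  · rfl

lemma coord_act (g : ExpSec n 𝔤 U) (b : P.Sec U) (y : U)
    (p : FundamentalGroupoid.mk x ⟶ FundamentalGroupoid.mk y.1) {i : ι} (hy : y.1 ∈ W i) :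
    P.coord b₀ (P.act g b) y p i = bch (g.1 y p) (P.coord b₀ b y p i) := by
  rw [coord, coord, dif_pos hy, dif_pos hy, ratio_act]
  rfl

lemma coord_equivariant (b : P.Sec U) (y : U) (γ : FundamentalGroup X x)
    (p : FundamentalGroupoid.mk x ⟶ FundamentalGroupoid.mk y.1) :
    P.coord b₀ b y (γ.toArrow ≫ p) = fun i => 𝔤.repLie γ⁻¹ (P.coord b₀ b y p i) := by
  funext i
  rw [coord, coord]
  split_ifs with hy
  · exact (P.ratio b₀ b i).2.1 ⟨y.1, y.2, hy⟩ γ p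
  · exact (map_zero _).symm

variable (ρ : SmoothPartitionOfUnity ι (𝓡 n) X Set.univ)

/-- The mean at `(y, p)` of the elements `gᵢ` such that `b = gᵢ · b₀ᵢ`, with the weights `ρᵢ(y)`:
the trivialization of the torsor over smooth functions which is defined by the partition of
unity. -/
def triv (N : ℕ) (b : P.Sec U) : Raw x U 𝔤 := fun y p =>
  meanIter (ρ.fintsupport y.1) (fun i => ρ i y.1) (P.coord b₀ b y p) N 0

variable {N : ℕ}

lemma triv_res (h : V ≤ U) (b : P.Sec U) :
    P.triv b₀ ρ N (resSec P.sheaf h b) = (P.triv b₀ ρ N b).res h :=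
  funext fun y => funext fun p => by rw [triv, coord_res, Raw.res, triv]

lemma triv_equivariant (b : P.Sec U) : IsEquivariant 𝔤 (P.triv b₀ ρ N b) := fun y γ p => by
  rw [triv, coord_equivariant, triv]
  refine Eq.trans ?_ (map_meanIter (𝔤.repLie γ⁻¹) _ _ _ N 0).symm
  rw [map_zero]

variable {ρ} (hρ : ρ.IsSubordinate fun i => (W i : Set X))

include hρ in
lemma triv_act (hN : LieModule.lowerCentralSeries ℝ 𝔤 𝔤 N = ⊥) (g : ExpSec n 𝔤 U) (b : P.Sec U) :
    P.triv b₀ ρ N (P.act g b) = Raw.mul (U := U) g.1 (P.triv b₀ ρ N b) := by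
  funext y p
  refine Eq.trans ?_ (meanIter_bch_zero hN
    (ρ.sum_finsupport' y.1 trivial (ρ.finsupport_subset_fintsupport y.1)) (g.1 y p) _)
  exact meanIter_congr (fun i _ hi => P.coord_act b₀ g b y p
    (hρ i (subset_tsupport _ hi))) N 0

include hρ in
lemma triv_isSmooth [IsManifold (𝓡 n) ∞ X] (b : P.Sec U) : IsSmooth n (P.triv b₀ ρ N b) :=
  fun y p => by
  have hy := (chart n y.1).map_source (mem_chart_source 𝓔 y.1)
  have hcont : Filter.Tendsto (chart n y.1).symm (𝓝 (chart n y.1 y.1)) (𝓝 y.1) := by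
    have := (chart n y.1).continuousAt_symm hy
    rwa [ContinuousAt, (chart n y.1).left_inv (mem_chart_source 𝓔 y.1)] at this
  have hw : ∀ i, ContDiffAt ℝ ∞ (fun u => ρ i ((chart n y.1).symm u)) (chart n y.1 y.1) :=
    fun i => contMDiffAt_iff_contDiffAt.1 (((ρ i).contMDiff.contMDiffAt).comp _
      (contMDiffOn_chart_symm.contMDiffAt ((chart n y.1).open_target.mem_nhds hy)))
  have hW : ∀ i ∈ ρ.fintsupport y.1, y.1 ∈ W i := fun i hi =>
    hρ i ((ρ.mem_fintsupport_iff y.1 i).1 hi)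
  -- near `y`, the elements `gᵢ` are constant
  have hev : ∀ i ∈ ρ.fintsupport y.1, ∀ᶠ u in 𝓝 (chart n y.1 y.1),
      branch n (fun y p => P.coord b₀ b y p i) y p u = P.coord b₀ b y p i := fun i hi => by
    obtain ⟨r, h⟩ := exists_isChartBall (n := n) (show y.1 ∈ U ⊓ W i from ⟨y.2, hW i hi⟩)
    filter_upwards [(P.ratio b₀ b i).2.2 ⟨y.1, y.2, hW i hi⟩ p, h.ball_mem_nhds] with u h1 hu
    rw [h.branch_eq (U := U ⊓ W i) (P.ratio b₀ b i).1 ⟨y.2, hW i hi⟩ p hu] at h1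
    have hz : (chart n y.1).symm u ∈ W i := (h.2 u hu).2.2
    rw [(h.mono inf_le_left).branch_eq _ y.2 p hu]
    exact ((dif_pos hz).trans h1).trans (dif_pos (hW i hi)).symm
  refine (contDiffAt_meanIter (ρ.fintsupport y.1) hw (P.coord b₀ b y p) N).congr_of_eventuallyEq ?_
  obtain ⟨r, h⟩ := exists_isChartBall (n := n) y.2
  filter_upwards [(Filter.eventually_all_finset _).2 hev, h.ball_mem_nhds,
    hcont.eventually (ρ.eventually_fintsupport_subset y.1)] with u h1 hu h2
  rw [h.branch_eq _ y.2 p hu, triv, meanIter_subset h2 fun i _ hi => ?_]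
  · refine meanIter_congr (fun i hi _ => ?_) N 0
    rw [← h1 i hi, h.branch_eq _ y.2 p hu]
  · by_contra hc
    exact hi ((ρ.mem_fintsupport_iff _ i).2 (subset_tsupport _ hc))

end Torsor

variable [IsManifold (𝓡 n) ∞ X] [T2Space X] [SecondCountableTopology X]

/-- The functions `P.triv b` have logarithmic derivatives which agree where two of them are defined.
Their common value is a Maurer-Cartan element `μ`, and `b ↦ P.triv b` is a morphism, hence an
isomorphism, from `P` to the torsor of `μ`. -/
theorem essSurj_torsorFunctor (hG : IsGaugeGroupoid n 𝔤) (hB : IsTorsorFunctor n 𝔤) :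
    (torsorFunctor hG hB).EssSurj where
  mem_essImage P := by
    have : LocallyCompactSpace X := ChartedSpace.locallyCompactSpace 𝓔 X
    obtain ⟨N, hN⟩ := LieModule.IsNilpotent.nilpotent ℝ 𝔤 𝔤
    choose W hW b₀ using P.exists_sec
    let b₀ : ∀ y, P.Sec (W y) := fun y => (b₀ y).some
    obtain ⟨ρ, hρ⟩ := SmoothPartitionOfUnity.exists_isSubordinate (𝓡 n) isClosed_univ
      (fun y => (W y : Set X)) (fun y => (W y).isOpen)
      (fun y _ => Set.mem_iUnion.2 ⟨y, hW y⟩)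
    have hsm : ∀ {U : Opens X} (b : P.Sec U), IsSmooth n (P.triv b₀ ρ N b) := fun b =>
      P.triv_isSmooth b₀ hρ b
    let η : Raw x ⊤ (𝓔 →L[ℝ] 𝔤) := fun y p => logDeriv n (P.triv b₀ ρ N (b₀ y.1)) ⟨y.1, hW y.1⟩ p
    -- the logarithmic derivative does not depend on the section
    have hη : ∀ {U : Opens X} (b : P.Sec U),
        logDeriv n (P.triv b₀ ρ N b) = η.res le_top := fun {U} b => by
      funext y p
      let V := U ⊓ W y.1
      have hy : y.1 ∈ V := ⟨y.2, hW y.1⟩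
      have h1 : logDeriv n (P.triv b₀ ρ N (resSec P.sheaf (inf_le_left : V ≤ U) b)) =
          logDeriv n (P.triv b₀ ρ N (resSec P.sheaf (inf_le_right : V ≤ W y.1) (b₀ y.1))) := by
        obtain ⟨g, hg⟩ := P.exists_act_eq
          (resSec P.sheaf (inf_le_right : V ≤ W y.1) (b₀ y.1))
          (resSec P.sheaf (inf_le_left : V ≤ U) b)
        rw [← hg, P.triv_act b₀ hρ hN]
        exact IsLocConst.logDeriv_mul (U := V) g.2.2 (hsm _)
      rw [P.triv_res, P.triv_res, logDeriv_res, logDeriv_res] at h1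
      exact congrFun (congrFun h1 ⟨y.1, hy⟩) p
    have hbr : ∀ (y : (⊤ : Opens X)) (p : FundamentalGroupoid.mk x ⟶ FundamentalGroupoid.mk y.1),
        branchForm n (logDeriv n (P.triv b₀ ρ N (b₀ y.1))) ⟨y.1, hW y.1⟩ p
          =ᶠ[𝓝 (chart n y.1 y.1)] branchForm n η y p := fun y p => by
      rw [hη]
      exact branchForm_res n le_top η ⟨y.1, hW y.1⟩ p
    let μ : MC n 𝔤 :=
      { form := η
        equivariant := fun y γ p v =>
          (P.triv_equivariant b₀ ρ (b₀ y.1)).logDeriv (hsm _) ⟨y.1, hW y.1⟩ γ p v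
        smooth := fun y p => (isSmoothForm_logDeriv (hsm (b₀ y.1)) ⟨y.1, hW y.1⟩ p)
          |>.congr_of_eventuallyEq (hbr y p).symm
        eqn := fun y p v w => by
          rw [extD_add_lie, ← curvature_congr (hbr y p), ← extD_logDeriv (hsm (b₀ y.1))
            ⟨y.1, hW y.1⟩ p v w, extD_add_lie] }
    let f : P ⟶ torsorOf hG hB μ := Torsor.Hom.ofApp
      (fun U b => ⟨P.triv b₀ ρ N b, P.triv_equivariant b₀ ρ b, hsm b, hη b⟩)
      (fun U V h b => Subtype.ext (P.triv_res b₀ ρ h b))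
      (fun U g b => Subtype.ext (P.triv_act b₀ hρ hN g b))
    have := Torsor.isIso f
    exact ⟨⟨μ⟩, ⟨(asIso f).symm⟩⟩

end EssSurj

end

end FlatTorsor

theorem mainTheorem8 (n : ℕ) {X : Type u} [TopologicalSpace X] [T2Space X]
    [SecondCountableTopology X] [ChartedSpace (EuclideanSpace ℝ (Fin n)) X]
    [IsManifold (𝓡 n) ∞ X] [ConnectedSpace X] (x : X) :
    ∃ (hG : ∀ 𝔤 : NilpRep x, IsGaugeGroupoid n 𝔤) (hB : ∀ 𝔤 : NilpRep x, IsTorsorFunctor n 𝔤),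
      (∀ 𝔤 : NilpRep x, (torsorFunctor (hG 𝔤) (hB 𝔤)).IsEquivalence) ∧
      (∀ (𝔤 𝔥 : NilpRep x) (θ : 𝔤 ⟶ 𝔥),
        (∀ (η η' : Def (hG 𝔤)) (f : η ⟶ η'),
          (torsorMap θ (hB 𝔤) (hB 𝔥) η).comp
              ((torsorFunctor (hG 𝔥) (hB 𝔥)).map ((Def.map θ (hG 𝔤) (hG 𝔥)).map f)) =
            Torsor.HomOver.precomp ((torsorFunctor (hG 𝔤) (hB 𝔤)).map f)
              (torsorMap θ (hB 𝔤) (hB 𝔥) η')) ∧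
        (∀ η : Def (hG 𝔤), (torsorMap (hH := hG 𝔥) θ (hB 𝔤) (hB 𝔥) η).IsPushforward)) ∧
      (∀ (𝔤 : NilpRep x) (η : Def (hG 𝔤)),
        (torsorMap (hH := hG 𝔤) (𝟙 𝔤) (hB 𝔤) (hB 𝔤) η).hom = 𝟙 _) ∧
      (∀ (𝔤 𝔥 𝔨 : NilpRep x) (θ : 𝔤 ⟶ 𝔥) (θ' : 𝔥 ⟶ 𝔨) (η : Def (hG 𝔤)),
        (torsorMap θ (hB 𝔤) (hB 𝔥) η).hom ≫
            (torsorMap θ' (hB 𝔥) (hB 𝔨) ((Def.map θ (hG 𝔤) (hG 𝔥)).obj η)).hom =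
          (torsorMap (hH := hG 𝔨) (θ ≫ θ') (hB 𝔤) (hB 𝔨) η).hom) := by

  refine ⟨fun 𝔤 => isGaugeGroupoid n 𝔤, fun 𝔤 => isTorsorFunctor n 𝔤, fun 𝔤 => ?_, fun 𝔤 𝔥 θ => ⟨fun η η' f => ?_, fun η =>
    Torsor.HomOver.isPushforward _⟩, fun 𝔤 η => rfl, fun 𝔤 𝔥 𝔨 θ θ' η => rfl⟩
  · have := faithful_torsorFunctor (isGaugeGroupoid n 𝔤) (isTorsorFunctor n 𝔤)
    have := full_torsorFunctor (isGaugeGroupoid n 𝔤) (isTorsorFunctor n 𝔤)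
    have := essSurj_torsorFunctor (isGaugeGroupoid n 𝔤) (isTorsorFunctor n 𝔤)
    exact { }
  · refine Torsor.HomOver.ext (NatTrans.ext (funext fun U => ?_))
    ext α
    refine Subtype.ext (funext fun y => funext fun p => ?_)
    change bch (θ.toLie _) (-θ.toLie _) = θ.toLie (bch _ (-_))
    rw [map_bch, map_neg]
    rfl
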